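/- **Setting.** Let $h$ be a formal parameter, $q=e^{h/2}$, $p=ah^{2b}$ with $a\in\mathbb{R}$, $b\in\mathbb{Z}$, $a,b>0$, and $p^{1/2}=\sqrt a\,h^{b}$. Let $c\in\mathbb{C}$ and $p^*=pq^{-2c}$, $(p^*)^{1/2}=p^{1/2}q^{-c}$. Write $(x;p)_\infty=\prod_{k\ge 0}(1-xp^k)$, let $f(z)\in\mathbb{C}[[h]][[z]]$ be the unique series with $f(0)=1$ and $f(zq^4)=f(z)\frac{(1-zq^2)^2}{(1-z)(1-zq^4)}$, and put $$\alpha(z)=\frac{(p^{1/2}qz;p)_\infty}{(p^{1/2}q^{-1}z;p)_\infty}\prod_{k\ge1}f(p^kz^2),\qquad \beta(z)=\frac{(-pqz;p)_\infty}{(-pq^{-1}z;p)_\infty}\prod_{k\ge1}f(p^kz^2).$$ The elliptic $R$-matrix $R(z)$ is the operator on $\mathbb{C}^2\otimes\mathbb{C}^2$ with matrix $$R(z)=\begin{pmatrix}a(z)&0&0&d(z)\\0&b(z)&c(z)&0\\0&c(z)&b(z)&0\\d(z)&0&0&a(z)\end{pmatrix},$$ where $a(z),b(z)$ are even and $c(z),d(z)$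 are odd in $z$ and $$a(z)+d(z)=\frac{q^{-1/2}}{f(z^2)}\frac{\alpha(z^{-1})}{\alpha(z)},\qquad b(z)+c(z)=\frac{q^{1/2}}{f(z^2)}\frac{1+q^{-1}z}{1+qz}\frac{\beta(z^{-1})}{\beta(z)}.$$ The coefficients of the powers of $h$ in $R(z)$ are rational functions of $z$. Unless otherwise specified, $R(z)$ is expanded in $\mathbb{C}((z))[[h]]$; $\iota_{x,y}R(x/y)$ denotes the expansion of $R(x/y)$ in $\mathbb{C}((x))((y))[[h]]$, and $R(e^u)$ the expansion at $z=e^u$ in $\mathbb{C}((u))[[h]]$. Let $R^*(z)$ be obtained from $R(z)$ by replacing $p$ with $p^*$. Subscripts of matrices and operators indicate tensor factors. Let $V(R)$ be the topologically free associative $\mathbb{C}[[h]]$-algebra with unit $\mathbf 1$ generated by $l_{ij}^{(-r)}$ ($r\ge1$, $i,j=1,2$) subject to $$R_{21}(e^{-u+v})L^+_1(u)L^+_2(v)=L^+_2(v)L^+_1(u)R^*_{12}(e^{u-v}),\qquad L^+(u)=\sum_{i,j}e_{ij}\otimes\sum_{r\ge1}l_{ij}^{(-r)}u^{r-1},$$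 with the $R$-matrices expanded in $\mathbb{C}((u))((v))[[h]]$. Let $A=\frac12(I-P)$, with $P$ the permutation operator on $\mathbb{C}^2\otimes\mathbb{C}^2$, and let $$\mathrm{qdet}\,L^+(u)=\mathrm{tr}_{1,2}\,A_{12}\,L^+_1(u)L^+_2(u-h/2)\mathbf 1\in V(R)[[u]].$$ Let $W$ be a topologically free $\mathbb{C}[[h]]$-module (torsion-free, separated and complete in the $h$-adic topology), and let $W((z))_h$ consist of the series $\sum_{r\in\mathbb{Z}}w_rz^r$ with $w_r\in W$ and $w_r\to0$ $h$-adically as $r\to-\infty$. An *FRT-operator* over $W$ is a series $\mathcal{L}(z)\in\mathrm{End}\,\mathbb{C}^2\otimes\mathrm{Hom}(W,W((z))_h)$ such that $$\iota_{x,y}(R_{12}(x/y))\,\mathcal{L}_1(x)\mathcal{L}_2(y)=\mathcal{L}_2(y)\mathcal{L}_1(x)R^*_{12}(x/y).$$ Given one, put, for $n\ge1$, $$\mathcal{L}_{[n]}(x_1,\ldots,x_n)=\Big(\prod^{\rightarrow}_{i=1,\ldots,n-1}\ \prod^{\rightarrow}_{j=i+1,\ldots,n}\iota_{x_i,x_j}R_{ij}(x_i/x_j)\Big)\mathcal{L}_1(x_1)\cdots\mathcal{L}_n(x_n),$$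 $$\mathfrak z(W)=\{w\in W:\ \mathcal{L}_{[n]}(z_1,\ldots,z_n)w\in(\mathrm{End}\,\mathbb{C}^2)^{\otimes n}\otimes W[[z_1,\ldots,z_n]]\ \text{for all } n\ge1\}.$$ The associated generalized $\phi$-coordinated $V(R)$-module structure on $W$ is the $\mathbb{C}[[h]]$-module map $Y_W(\cdot,z)\colon V(R)\otimes W\to W[[z^{\pm1/2}]]$ determined by $Y_W(\mathbf 1,z)w=w$ and $$Y_W(L^+_1(u_1)\cdots L^+_n(u_n)\mathbf 1,z)=\mathcal{L}_{[n]}(x_1,\ldots,x_n)\big|_{x_1=z^{1/2}e^{u_1},\ldots,x_n=z^{1/2}e^{u_n}}\qquad(n\ge1).$$ **Theorem.** Let $\mathcal{L}(z)$ be an FRT-operator over a topologically free $\mathbb{C}[[h]]$-module $W$ and $Y_W$ the associated module map. For any $w\in\mathfrak z(W)$ all coefficients of the series $$Y_W(\mathrm{qdet}\,L^+(0)\mathbf 1,z^2)w=\mathrm{tr}_{1,2}\,A_{12}\,\mathcal{L}_{[2]}(x_1,x_2)w\big|_{x_1=z,\ x_2=ze^{-h/2}}$$ belong to $\mathfrak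 z(W)$. -/

import Mathlib

open scoped PowerSeries

noncomputable section

namespace EllipticFRT

/-- The power series `e^{α h} ∈ ℂ[[h]]`; the formal parameter `h` is the variable `X` of `ℂ⟦X⟧`. -/
def hExp (α : ℂ) : ℂ⟦X⟧ := PowerSeries.rescale α (PowerSeries.exp ℂ)

/-- `(e^{nh} - 1) / (e^{nh} + 1)`, that is, `n` times the coefficient of `z^n` in `log f(z)`. -/
def fLog (n : ℕ) : ℂ⟦X⟧ := (hExp n - 1) * (hExp n + 1)⁻¹

/-- The coefficients of `f(z)` at `q = e^{h/2}`. -/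
def fCoeff : ℕ → ℂ⟦X⟧
  | 0 => 1
  | k + 1 => PowerSeries.C ((k : ℂ) + 1)⁻¹ * ∑ n : Fin (k + 1), fLog (n + 1) * fCoeff (k - n)

/-- The power series `f(z) ∈ ℂ[[h]][[z]]`, i.e. the series
`(z;q^4)_∞ (zq^4;q^4)_∞ / (zq^2;q^4)_∞^2` at `q = e^{h/2}`. By `fSeries_spec` and `fSeries_unique`
below it is the unique series with constant term `1` such that
`f(z q^4) = f(z) (1 - z q^2)^2 / ((1 - z)(1 - z q^4))`. -/
def fSeries : ℂ⟦X⟧⟦X⟧ := PowerSeries.mk fCoeff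

theorem hExp_add (α β : ℂ) : hExp (α + β) = hExp α * hExp β := by
  simpa [hExp] using (PowerSeries.exp_mul_exp_eq_exp_add (A := ℂ) α β).symm

theorem hExp_nat (n : ℕ) (α : ℂ) : hExp (n * α) = hExp α ^ n := by
  induction n with
  | zero => simp [hExp]
  | succ n ih => rw [pow_succ, ← ih, ← hExp_add]; congr 1; push_cast; ring

theorem hExp_const (α : ℂ) : PowerSeries.constantCoeff (hExp α) = 1 := by
  simp [hExp, ← PowerSeries.coeff_zero_eq_constantCoeff_apply]

theorem fLog_mul (n : ℕ) : fLog n * (hExp n + 1) = hExp n - 1 := by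
  have : (PowerSeries.constantCoeff (hExp n + 1)) ≠ 0 := by
    simp [hExp_const]
  rw [fLog, mul_assoc, PowerSeries.inv_mul_cancel _ this, mul_one]

/-- The derivation `z d/dz`. -/
abbrev zDeriv (F : ℂ⟦X⟧⟦X⟧) : ℂ⟦X⟧⟦X⟧ := PowerSeries.X * PowerSeries.derivative ℂ⟦X⟧ F

theorem coeff_zDeriv (F : ℂ⟦X⟧⟦X⟧) (n : ℕ) :
    PowerSeries.coeff n (zDeriv F) = n * PowerSeries.coeff n F := by
  cases n with
  | zero => simp
  | succ n => 
    rw [PowerSeries.coeff_succ_X_mul, PowerSeries.coeff_derivative]; push_cast; ring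

theorem ode_unique (F G T : ℂ⟦X⟧⟦X⟧) (hT : PowerSeries.constantCoeff T = 0)
    (h0 : PowerSeries.constantCoeff F = PowerSeries.constantCoeff G)
    (hF : zDeriv F = F * T) (hG : zDeriv G = G * T) : F = G := by
  rw [← sub_eq_zero]
  have hD : zDeriv (F - G) = (F - G) * T := by
    rw [sub_mul, ← hF, ← hG]; simp only [zDeriv, map_sub, mul_sub]
  have hD0 : PowerSeries.constantCoeff (F - G) = 0 := by rw [map_sub, h0, sub_self]
  generalize F - G = D at hD hD0
  ext1 n
  induction n using Nat.strong_induction_on with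
  | _ n ih =>
    by_cases hn : n = 0
    · subst hn; simpa using hD0
    · have h := congrArg (PowerSeries.coeff n) hD
      rw [coeff_zDeriv, PowerSeries.coeff_mul, Finset.sum_eq_zero] at h
      · rcases mul_eq_zero.1 h with h | h
        · exact absurd (by simpa using congrArg (PowerSeries.constantCoeff) h) hn
        · simpa using h
      · rintro ⟨i, j⟩ hij
        have hij := Finset.HasAntidiagonal.mem_antidiagonal.1 hij
        show PowerSeries.coeff i D * PowerSeries.coeff j T = 0
        by_cases hj : j = 0
        · subst hj; simp [hT]
        · rw [ih i (by simp at hij; omega)]; simp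


/-- The geometric series `∑_{n ≥ 1} c^n z^n`. -/
def fGen (c : ℂ⟦X⟧) : ℂ⟦X⟧⟦X⟧ := PowerSeries.mk (fun n => c ^ n) - 1

theorem zDeriv_lin (c : ℂ⟦X⟧) : zDeriv (1 - PowerSeries.C c * PowerSeries.X) =
    - ((1 - PowerSeries.C c * PowerSeries.X) * fGen c) := by
  have h : (1 - PowerSeries.C c * PowerSeries.X) * PowerSeries.mk (fun n => c ^ n) = 1 := by
    ext1 n
    cases n with
    | zero => simp [sub_mul, mul_assoc]
    | succ n =>
      rw [sub_mul, mul_assoc, map_sub, PowerSeries.coeff_C_mul, PowerSeries.coeff_succ_X_mul]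
      simp [PowerSeries.coeff_one, pow_succ, mul_comm]
  rw [fGen, mul_sub, h]
  simp [zDeriv, map_sub]
  ring

theorem zDeriv_mul (F G : ℂ⟦X⟧⟦X⟧) : zDeriv (F * G) = zDeriv F * G + F * zDeriv G := by
  simp only [zDeriv, Derivation.leibniz, smul_eq_mul]; ring

theorem zDeriv_rescale (c : ℂ⟦X⟧) (F : ℂ⟦X⟧⟦X⟧) :
    zDeriv (PowerSeries.rescale c F) = PowerSeries.rescale c (zDeriv F) := by
  ext1 n; rw [coeff_zDeriv, PowerSeries.coeff_rescale, PowerSeries.coeff_rescale, coeff_zDeriv]; ring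

theorem zDeriv_f : zDeriv fSeries = fSeries * PowerSeries.mk fLog := by
  have h0 : fLog 0 = 0 := by simp [fLog, hExp]
  ext1 n
  rw [coeff_zDeriv, mul_comm fSeries]
  cases n with
  | zero => simp [h0]
  | succ k =>
    rw [PowerSeries.coeff_mul, Finset.Nat.sum_antidiagonal_eq_sum_range_succ_mk,
      Finset.sum_range_succ']
    simp only [PowerSeries.coeff_mk, fSeries, h0, zero_mul, add_zero]
    rw [fCoeff, Finset.sum_range]
    have hk : ((k : ℂ) + 1) ≠ 0 := by exact_mod_cast Nat.succ_ne_zero k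
    have : ((k + 1 : ℕ) : ℂ⟦X⟧) * PowerSeries.C ((k : ℂ) + 1)⁻¹ = 1 := by
      rw [show ((k + 1 : ℕ) : ℂ⟦X⟧) = PowerSeries.C ((k : ℂ) + 1) by simp, ← map_mul,
        mul_inv_cancel₀ hk, map_one]
    rw [← mul_assoc, this, one_mul]
    refine Finset.sum_congr rfl fun n _ => ?_
    rw [Nat.add_sub_add_right]

theorem fSeries_spec : PowerSeries.constantCoeff fSeries = 1 ∧
    PowerSeries.rescale (hExp 2) fSeries *
        ((1 - PowerSeries.X) * (1 - PowerSeries.C (hExp 2) * PowerSeries.X)) =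
      fSeries * (1 - PowerSeries.C (hExp 1) * PowerSeries.X) ^ 2 := by
  have h0 : PowerSeries.constantCoeff fSeries = 1 := by
    rw [← PowerSeries.coeff_zero_eq_constantCoeff_apply]; simp [fSeries, fCoeff]
  refine ⟨h0, ?_⟩
  apply ode_unique _ _ (PowerSeries.mk fLog - 2 * fGen (hExp 1))
  · rw [← PowerSeries.coeff_zero_eq_constantCoeff_apply,
      show (2 : ℂ⟦X⟧⟦X⟧) = PowerSeries.C 2 from (map_ofNat PowerSeries.C 2).symm]
    simp only [map_sub, PowerSeries.coeff_C_mul, PowerSeries.coeff_mk, fGen]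
    simp [fLog, hExp]
  · have hr : PowerSeries.constantCoeff (PowerSeries.rescale (hExp 2) fSeries) = 1 := by
      rw [← PowerSeries.coeff_zero_eq_constantCoeff_apply, PowerSeries.coeff_rescale]
      simp [h0]
    rw [map_mul, map_mul, hr, map_mul, h0]; simp
  · have hT : PowerSeries.mk fLog - 2 * fGen (hExp 1) =
        PowerSeries.rescale (hExp 2) (PowerSeries.mk fLog) - fGen 1 - fGen (hExp 2) := by
      ext1 n
      have h2 : hExp 2 ^ n = hExp n * hExp n := by
        rw [← hExp_nat, ← hExp_add]; congr 1; ring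
      have h1 : hExp 1 ^ n = hExp n := by rw [← hExp_nat, mul_one]
      have ht := fLog_mul n
      have h22 : (2 : ℂ⟦X⟧⟦X⟧) = PowerSeries.C 2 := (map_ofNat PowerSeries.C 2).symm
      rw [h22]
      simp only [map_sub, PowerSeries.coeff_C_mul, fGen, PowerSeries.coeff_mk,
        PowerSeries.coeff_rescale, h1, h2, one_pow]
      have : fLog n * (hExp n * hExp n) = fLog n + (hExp n - 1) ^ 2 := by
        linear_combination (hExp n - 1) * ht
      rw [mul_comm (hExp n * hExp n), this]
      by_cases hn : n = 0
      · subst hn; simp [PowerSeries.coeff_one, fLog, hExp]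
      · simp only [PowerSeries.coeff_one, hn, if_false]; ring
    have h1 := zDeriv_lin 1
    rw [map_one, one_mul] at h1
    rw [zDeriv_mul, zDeriv_mul, zDeriv_lin, h1, zDeriv_rescale, zDeriv_f, map_mul, hT]
    ring
  · rw [pow_two, zDeriv_mul, zDeriv_mul, zDeriv_lin, zDeriv_f]
    ring

theorem fSeries_unique (F : ℂ⟦X⟧⟦X⟧) (h0 : PowerSeries.constantCoeff F = 1)
    (hF : PowerSeries.rescale (hExp 2) F *
        ((1 - PowerSeries.X) * (1 - PowerSeries.C (hExp 2) * PowerSeries.X)) =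
      F * (1 - PowerSeries.C (hExp 1) * PowerSeries.X) ^ 2) : F = fSeries := by
  obtain ⟨h0', hF'⟩ := fSeries_spec
  rw [← sub_eq_zero]
  have hD : PowerSeries.rescale (hExp 2) (F - fSeries) *
        ((1 - PowerSeries.X) * (1 - PowerSeries.C (hExp 2) * PowerSeries.X)) =
      (F - fSeries) * (1 - PowerSeries.C (hExp 1) * PowerSeries.X) ^ 2 := by
    rw [map_sub, sub_mul (PowerSeries.rescale _ F), hF, hF', ← sub_mul]
  have hD0 : PowerSeries.constantCoeff (F - fSeries) = 0 := by rw [map_sub, h0, h0', sub_self]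
  generalize F - fSeries = D at hD hD0
  have key : ∀ (n : ℕ) (G P : ℂ⟦X⟧⟦X⟧), PowerSeries.constantCoeff P = 1 →
      (∀ m < n, PowerSeries.coeff m G = 0) →
      PowerSeries.coeff n (G * P) = PowerSeries.coeff n G := by
    intro n G P hP hG
    rw [PowerSeries.coeff_mul, Finset.sum_eq_single (n, 0)]
    · simp [hP]
    · rintro ⟨i, j⟩ hij hne
      have hij := Finset.HasAntidiagonal.mem_antidiagonal.1 hij
      show PowerSeries.coeff i G * PowerSeries.coeff j P = 0
      rw [hG i, zero_mul]
      by_contra hlt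
      apply hne
      simp only [Prod.mk.injEq]; simp at hij; omega
    · simp
  ext1 n
  induction n using Nat.strong_induction_on with
  | _ n ih =>
    by_cases hn : n = 0
    · subst hn; simpa using hD0
    have ih' : ∀ m < n, PowerSeries.coeff m D = 0 := fun m hm => by simpa using ih m hm
    have h := congrArg (PowerSeries.coeff n) hD
    rw [key n _ _ (by simp) ih', key n _ _ (by simp)
      (fun m hm => by rw [PowerSeries.coeff_rescale, ih' m hm, mul_zero]),
      PowerSeries.coeff_rescale, ← hExp_nat] at h
    have h2 : hExp (n * 2) ≠ 1 := by
      intro h1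
      have := congrArg (PowerSeries.coeff 1) h1
      simp [hExp, PowerSeries.coeff_one, hn] at this
    have h3 : (hExp (n * 2) - 1) * PowerSeries.coeff n D = 0 := by
      rw [sub_mul, h, one_mul, sub_self]
    rcases mul_eq_zero.1 h3 with h4 | h4
    · exact absurd (sub_eq_zero.1 h4) h2
    · simpa using h4

/-! ### The elliptic R-matrix -/

/-- The coefficients `b_k` of the expansion `f(z) = ∑_{k ≥ 0} b_k (z / (1 - z))^k` (substitute
`z = y / (1 + y)` in `f(z)`). One has `b_k ∈ h^k ℂ[[h]]`. -/
def fB : ℕ → ℂ⟦X⟧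
  | 0 => 1
  | k + 1 => ∑ j ∈ Finset.range (k + 1),
      PowerSeries.C ((-1) ^ (k - j) * (k.choose j : ℂ)) * fCoeff (j + 1)

/-- For a family `u k ∈ A[[h]]` with `u k ≡ 1 mod h^k`, the infinite product `∏_{k ≥ 0} u k`. -/
def infProd {A : Type*} [CommRing A] (u : ℕ → A⟦X⟧) : A⟦X⟧ :=
  PowerSeries.mk fun n => PowerSeries.coeff n (∏ k ∈ Finset.range (n + 1), u k)

section Rmatrix

/- The coefficients of the powers of `h` in the entries of the `R`-matrix are rational functions of
`z`. We evaluate them at an element `ζ` of a field `K ⊇ ℂ`. Taking for `K` a field of formal Laurent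
series and for `ζ` one of `z`, `e^u` produces the various expansions of the `R`-matrix. -/

variable {K : Type*} [Field K] [Algebra ℂ K]

/-- The inclusion `ℂ[[h]] ⊆ K[[h]]`. -/
def toK (K : Type*) [Field K] [Algebra ℂ K] : ℂ⟦X⟧ →+* K⟦X⟧ :=
  PowerSeries.map (algebraMap ℂ K)

/-- `f(ζ) = ∑_k b_k (ζ / (1 - ζ))^k`. -/
def fAt (ζ : K) : K⟦X⟧ :=
  PowerSeries.mk fun n => ∑ k ∈ Finset.range (n + 1),
    algebraMap ℂ K (PowerSeries.coeff n (fB k)) * (ζ / (1 - ζ)) ^ k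

/-- `f(x) = ∑_j f_j x^j` for `x ∈ h K[[h]]`. -/
def fSub (x : K⟦X⟧) : K⟦X⟧ :=
  PowerSeries.mk fun n => PowerSeries.coeff n
    (∑ j ∈ Finset.range (n + 1), toK K (fCoeff j) * x ^ j)

/-- `(x; p)_∞ = ∏_{k ≥ 0} (1 - x p^k)` for `p ∈ h K[[h]]`. -/
def poch (x p : K⟦X⟧) : K⟦X⟧ := infProd fun k => 1 - x * p ^ k

/-- `α(ζ)`, where `s = p^{1/2}` and `q = e^{h/2}`. -/
def alphaAt (s : ℂ⟦X⟧) (ζ : K) : K⟦X⟧ :=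
  poch (toK K (s * hExp (1 / 2)) * PowerSeries.C ζ) (toK K (s ^ 2)) *
    (poch (toK K (s * hExp (-1 / 2)) * PowerSeries.C ζ) (toK K (s ^ 2)))⁻¹ *
    infProd fun k => fSub (toK K (s ^ 2) ^ (k + 1) * PowerSeries.C (ζ ^ 2))

/-- `β(ζ)`, where `s = p^{1/2}` and `q = e^{h/2}`. -/
def betaAt (s : ℂ⟦X⟧) (ζ : K) : K⟦X⟧ :=
  poch (-(toK K (s ^ 2 * hExp (1 / 2)) * PowerSeries.C ζ)) (toK K (s ^ 2)) *
    (poch (-(toK K (s ^ 2 * hExp (-1 / 2)) * PowerSeries.C ζ)) (toK K (s ^ 2)))⁻¹ *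
    infProd fun k => fSub (toK K (s ^ 2) ^ (k + 1) * PowerSeries.C (ζ ^ 2))

/-- The series `a(ζ) + d(ζ) = q^{-1/2} f(ζ^2)^{-1} α(ζ^{-1}) / α(ζ)`. -/
def sumAD (s : ℂ⟦X⟧) (ζ : K) : K⟦X⟧ :=
  toK K (hExp (-1 / 4)) * (fAt (ζ ^ 2))⁻¹ * alphaAt s ζ⁻¹ * (alphaAt s ζ)⁻¹

/-- The series
`b(ζ) + c(ζ) = q^{1/2} f(ζ^2)^{-1} (1 + q^{-1} ζ) (1 + q ζ)^{-1} β(ζ^{-1}) / β(ζ)`. -/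
def sumBC (s : ℂ⟦X⟧) (ζ : K) : K⟦X⟧ :=
  toK K (hExp (1 / 4)) * (fAt (ζ ^ 2))⁻¹ * (1 + toK K (hExp (-1 / 2)) * PowerSeries.C ζ) *
    (1 + toK K (hExp (1 / 2)) * PowerSeries.C ζ)⁻¹ * betaAt s ζ⁻¹ * (betaAt s ζ)⁻¹

/-- The elliptic `R`-matrix `R(ζ)` of the eight-vertex model with `q = e^{h/2}` and `p^{1/2} = s`,
as a matrix in the basis `e_i ⊗ e_j` of `ℂ² ⊗ ℂ²`: the entry at `((i, j), (k, l))` is the coefficient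
of `e_{ik} ⊗ e_{jl}`. The functions `a`, `b` (resp. `c`, `d`) are the even (resp. odd) parts of
`a + d` and `b + c`. -/
def ellR (s : ℂ⟦X⟧) (ζ : K) : Matrix (Fin 2 × Fin 2) (Fin 2 × Fin 2) K⟦X⟧ :=
  let half : K⟦X⟧ := toK K (PowerSeries.C (1 / 2))
  let a := half * (sumAD s ζ + sumAD s (-ζ))
  let b := half * (sumBC s ζ + sumBC s (-ζ))
  let c := half * (sumBC s ζ - sumBC s (-ζ))
  let d := half * (sumAD s ζ - sumAD s (-ζ))
  Matrix.of fun I J =>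
    !![a, 0, 0, d;
       0, b, c, 0;
       0, c, b, 0;
       d, 0, 0, a] (finProdFinEquiv I) (finProdFinEquiv J)

end Rmatrix

/-- The variable of `ℂ((t))`. -/
def lvar : LaurentSeries ℂ := HahnSeries.single 1 1

/-- The series `e^t ∈ ℂ((t))`. -/
def lexp : LaurentSeries ℂ := HahnSeries.ofPowerSeries ℤ ℂ (PowerSeries.exp ℂ)

/-- The coefficient of `t^m` of an element of `ℂ((t))[[h]]`, an element of `ℂ[[h]]`. -/
def lcoeff (m : ℤ) (x : (LaurentSeries ℂ)⟦X⟧) : ℂ⟦X⟧ :=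
  PowerSeries.mk fun n => (PowerSeries.coeff n x).coeff m

/-- The coefficient of `z^m` in `R(z)`, regarded as a series in `ℂ((z))[[h]]`. -/
def Rzero (s : ℂ⟦X⟧) (m : ℤ) : Matrix (Fin 2 × Fin 2) (Fin 2 × Fin 2) ℂ⟦X⟧ :=
  (ellR s lvar).map (lcoeff m)

/-- The coefficient of `z^m` in the expansion of `R(z)` at `z = ∞`, i.e. in `ℂ((z^{-1}))[[h]]`. Thus
`∑_m Rinfty s m x^m y^{-m}` is `ι_{x,y} R(x/y)`, the expansion of `R(x/y)` in `ℂ((x))((y))[[h]]`. -/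
def Rinfty (s : ℂ⟦X⟧) (m : ℤ) : Matrix (Fin 2 × Fin 2) (Fin 2 × Fin 2) ℂ⟦X⟧ :=
  (ellR s lvar⁻¹).map (lcoeff (-m))

/-- The coefficient of `u^m` in `R(e^u) ∈ ℂ((u))[[h]]`. -/
def Rexp (s : ℂ⟦X⟧) (m : ℤ) : Matrix (Fin 2 × Fin 2) (Fin 2 × Fin 2) ℂ⟦X⟧ :=
  (ellR s lexp).map (lcoeff m)

/-- `p^{1/2}` for the elliptic nome `p = a h^{2b}`. -/
def nome (a : ℝ) (b : ℕ) : ℂ⟦X⟧ := PowerSeries.C (Real.sqrt a : ℂ) * PowerSeries.X ^ b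

/-- `(p^*)^{1/2}` for `p^* = p q^{-2c}`, where `q = e^{h/2}`. -/
def nomeStar (a : ℝ) (b : ℕ) (c : ℂ) : ℂ⟦X⟧ := nome a b * hExp (-c / 2)

/-! ### Formal distributions with coefficients in a topologically free module -/

/-- A `ℂ[[h]]`-module is topologically free if it is torsion-free, separated and complete in the
`h`-adic topology. -/
def TopologicallyFree (W : Type*) [AddCommGroup W] [Module ℂ⟦X⟧ W] : Prop :=
  IsAdicComplete (Ideal.span {(PowerSeries.X : ℂ⟦X⟧)}) W ∧
    ∀ w : W, (PowerSeries.X : ℂ⟦X⟧) • w = 0 → w = 0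

section Distributions

variable {W : Type*} [AddCommGroup W] [Module ℂ⟦X⟧ W]

/-- The sum of a family in the `h`-adic topology of `W`. -/
def hSum {ι : Type*} (g : ι → W) : W :=
  @tsum W ι _ ((Ideal.span {(PowerSeries.X : ℂ⟦X⟧)}).adicModuleTopology W) g
    (SummationFilter.unconditional ι)

/-- Formal distributions in `x_1, …, x_n` with values in `(End ℂ²)^{⊗n} ⊗ W`: the coefficient of
`x_1^{m 1} ⋯ x_n^{m n}` is a matrix with entries in `W`, whose entry at `(I, J)` belongs to
`e_{I 1, J 1} ⊗ ⋯ ⊗ e_{I n, J n}`. -/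
abbrev Dist (n : ℕ) (W : Type*) : Type _ :=
  (Fin n → ℤ) → Matrix (Fin n → Fin 2) (Fin n → Fin 2) W

/-- `ρ_{ij}(x_i / x_j) S`, where `ρ(z) = ∑_k ρ k z^k` acts on the tensor factors `i`, `j`. -/
def mulLeft {n : ℕ} (ρ : ℤ → Matrix (Fin 2 × Fin 2) (Fin 2 × Fin 2) ℂ⟦X⟧) (i j : Fin n)
    (S : Dist n W) : Dist n W := fun m => Matrix.of fun I J =>
  ∑ k : Fin 2, ∑ l : Fin 2, hSum fun r : ℤ =>
    ρ r (I i, I j) (k, l) •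
      S (m - Pi.single i r + Pi.single j r) (Function.update (Function.update I i k) j l) J

/-- `S ρ_{ij}(x_i / x_j)`, where `ρ(z) = ∑_k ρ k z^k` acts on the tensor factors `i`, `j`. -/
def mulRight {n : ℕ} (ρ : ℤ → Matrix (Fin 2 × Fin 2) (Fin 2 × Fin 2) ℂ⟦X⟧) (i j : Fin n)
    (S : Dist n W) : Dist n W := fun m => Matrix.of fun I J =>
  ∑ k : Fin 2, ∑ l : Fin 2, hSum fun r : ℤ =>
    ρ r (k, l) (J i, J j) •
      S (m - Pi.single i r + Pi.single j r) I (Function.update (Function.update J i k) j l)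

/-- Operator series `∑_m 𝓛 m z^m` with coefficients in `End ℂ² ⊗ End W`. -/
abbrev OpSeries (W : Type*) [AddCommGroup W] [Module ℂ⟦X⟧ W] : Type _ :=
  ℤ → Matrix (Fin 2) (Fin 2) (Module.End ℂ⟦X⟧ W)

/-- An FRT-operator over `W`: an operator series `𝓛(z) ∈ End ℂ² ⊗ Hom(W, W((z))_h)` such that
`ι_{x,y}(R_{12}(x/y)) 𝓛_1(x) 𝓛_2(y) = 𝓛_2(y) 𝓛_1(x) R^*_{12}(x/y)`. -/
structure IsFRTOperator (a : ℝ) (b : ℕ) (c : ℂ) (𝓛 : OpSeries W) : Prop where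
  truncation : ∀ (w : W) (i j : Fin 2) (k : ℕ), ∃ N : ℤ, ∀ m < N, ∃ v : W,
    𝓛 m i j w = (PowerSeries.X : ℂ⟦X⟧) ^ k • v
  frt : ∀ w : W,
    mulLeft (n := 2) (Rinfty (nome a b)) 0 1
        (fun m => Matrix.of fun I J => 𝓛 (m 0) (I 0) (J 0) (𝓛 (m 1) (I 1) (J 1) w)) =
      mulRight (n := 2) (Rzero (nomeStar a b c)) 0 1
        (fun m => Matrix.of fun I J => 𝓛 (m 1) (I 1) (J 1) (𝓛 (m 0) (I 0) (J 0) w))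

/-- `𝓛_1(x_1) ⋯ 𝓛_n(x_n) w`. -/
def opProd (𝓛 : OpSeries W) (n : ℕ) (w : W) : Dist n W := fun m => Matrix.of fun I J =>
  (List.ofFn fun k => 𝓛 (m k) (I k) (J k)).prod w

/-- The pairs `(i, j)` with `i < j` in the lexicographic order. -/
def orderedPairs (n : ℕ) : List (Fin n × Fin n) :=
  (List.finRange n).flatMap fun i =>
    ((List.finRange n).filter fun j => i < j).map fun j => (i, j)

/-- `𝓛_{[n]}(x_1, …, x_n) w = R'_{[n]}(x) 𝓛_1(x_1) ⋯ 𝓛_n(x_n) w`, where `R'_{[n]}(x)` is the product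
of `ι_{x_i,x_j} R_{ij}(x_i/x_j)` over `i < j` in the lexicographic order. -/
def bracket (a : ℝ) (b : ℕ) (𝓛 : OpSeries W) (n : ℕ) (w : W) : Dist n W :=
  (orderedPairs n).foldr (fun ij S => mulLeft (Rinfty (nome a b)) ij.1 ij.2 S) (opProd 𝓛 n w)

/-- The submodule of invariants `𝔷(W)`: all `w` such that for all `n ≥ 1` the series
`𝓛_{[n]}(z_1, …, z_n) w` contains only nonnegative powers of `z_1, …, z_n`. -/
def invariants (a : ℝ) (b : ℕ) (𝓛 : OpSeries W) : Set W :=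
  {w | ∀ n : ℕ, 1 ≤ n → ∀ m : Fin n → ℤ, (∃ i, m i < 0) → bracket a b 𝓛 n w m = 0}

end Distributions

/-- The anti-symmetrizer `A = (I - P) / 2` on `ℂ² ⊗ ℂ²`. -/
def antisym : Matrix (Fin 2 → Fin 2) (Fin 2 → Fin 2) ℂ⟦X⟧ := Matrix.of fun I J =>
  PowerSeries.C (1 / 2) *
    ((if I 0 = J 0 ∧ I 1 = J 1 then 1 else 0) - (if I 0 = J 1 ∧ I 1 = J 0 then 1 else 0))

/-- The coefficient of `z^m` in `tr_{1,2} A_{12} 𝓛_{[2]}(x_1, x_2) w` at `x_1 = z`,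
`x_2 = z e^{-h/2}`. -/
def qdetAction {W : Type*} [AddCommGroup W] [Module ℂ⟦X⟧ W] (a : ℝ) (b : ℕ) (𝓛 : OpSeries W)
    (w : W) (m : ℤ) : W :=
  ∑ I : Fin 2 → Fin 2, ∑ J : Fin 2 → Fin 2, antisym I J •
    hSum fun e : {e : Fin 2 → ℤ // e 0 + e 1 = m} =>
      hExp (-(e.1 1 : ℂ) / 2) • bracket a b 𝓛 2 w e.1 J I

/-! ### The algebra `V(R)` and the quantum determinant -/

/-- The free algebra over `ℂ` on `l_{ij}^{(-r-1)}`, indexed by `(i, j, r)`. -/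
abbrev FreeL : Type := FreeAlgebra ℂ (Fin 2 × Fin 2 × ℕ)

/-- The generator `l_{ij}^{(-r-1)}`, which is the coefficient of `u^r` in `l_{ij}^+(u)`. -/
def lgen (i j : Fin 2) (r : ℕ) : FreeL := FreeAlgebra.ι ℂ (i, j, r)

/-- The topologically free associative `ℂ[[h]]`-algebra on the generators `l_{ij}^{(-r-1)}`, i.e.
the `h`-adic completion of the free `ℂ[[h]]`-algebra. -/
abbrev FreeLh : Type := FreeL⟦X⟧

instance : Algebra ℂ⟦X⟧ FreeLh :=
  (PowerSeries.map (algebraMap ℂ FreeL)).toAlgebra' (by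
    intro x y
    ext n
    rw [PowerSeries.coeff_mul, PowerSeries.coeff_mul, ← Finset.Nat.sum_antidiagonal_swap]
    refine Finset.sum_congr rfl fun p _ => ?_
    simp only [PowerSeries.coeff_map, Prod.fst_swap, Prod.snd_swap]
    exact Algebra.commutes _ _)

/-- The entry at `(I, J)` of the coefficient of `u^α v^β` in
`R_{21}(e^{-u+v}) L_1^+(u) L_2^+(v) - L_2^+(v) L_1^+(u) R^*(e^{u-v})`, with the `R`-matrices expanded
in `ℂ((u))((v))[[h]]`: for all integers `M`,
`(u - v)^M = ∑_{j ≥ 0} (-1)^j (M choose j) u^{M-j} v^j` and `(-u + v)^M = (-1)^M (u - v)^M`. -/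
def relation (a : ℝ) (b : ℕ) (c : ℂ) (α : ℤ) (β : ℕ) (I J : Fin 2 × Fin 2) : FreeLh :=
  PowerSeries.mk fun k =>
    (∑ K : Fin 2 × Fin 2, ∑ j ∈ Finset.range (β + 1), ∑ᶠ n : ℕ,
      (PowerSeries.coeff k (Rexp (nome a b) (α + j - n) I.swap K.swap) *
        (-1) ^ (α + j - n : ℤ) * ((-1) ^ j * ((Ring.choose (α + j - n : ℤ) j : ℤ) : ℂ))) •
          (lgen K.1 J.1 n * lgen K.2 J.2 (β - j))) -
    ∑ K : Fin 2 × Fin 2, ∑ j ∈ Finset.range (β + 1), ∑ᶠ n : ℕ,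
      (PowerSeries.coeff k (Rexp (nomeStar a b c) (α + j - n) K J) *
        ((-1) ^ j * ((Ring.choose (α + j - n : ℤ) j : ℤ) : ℂ))) •
          (lgen I.2 K.2 (β - j) * lgen I.1 K.1 n)

/-- The smallest `h`-adically closed two-sided ideal that contains all defining relations and has a
torsion-free quotient. -/
def relIdeal (a : ℝ) (b : ℕ) (c : ℂ) : TwoSidedIdeal FreeLh :=
  sInf {I | (∀ α β J K, relation a b c α β J K ∈ I) ∧
    (∀ x : FreeLh, (PowerSeries.X : FreeLh) * x ∈ I → x ∈ I) ∧
    (∀ x : FreeLh, (∀ n : ℕ, ∃ y ∈ I, ∃ t : FreeLh, x = y + PowerSeries.X ^ n * t) → x ∈ I)}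

/-- The algebra `V(R)`: the topologically free associative `ℂ[[h]]`-algebra generated by all
`l_{ij}^{(-r)}`, `r ≥ 1`, subject to
`R_{21}(e^{-u+v}) L_1^+(u) L_2^+(v) = L_2^+(v) L_1^+(u) R^*(e^{u-v})`. -/
abbrev VR (a : ℝ) (b : ℕ) (c : ℂ) : Type := (relIdeal a b c).ringCon.Quotient

/-- The image of an element of the free algebra in `V(R)`. -/
def toVR (a : ℝ) (b : ℕ) (c : ℂ) (x : FreeLh) : VR a b c := (x : (relIdeal a b c).ringCon.Quotient)

/-- The coefficient of `u^r` in `l_{ij}^+(u)`, as an element of `V(R)`. -/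
def vgen (a : ℝ) (b : ℕ) (c : ℂ) (i j : Fin 2) (r : ℕ) : VR a b c :=
  toVR a b c (PowerSeries.C (lgen i j r))

/-- The generator matrix `L^+(u)`. -/
def Lplus (a : ℝ) (b : ℕ) (c : ℂ) : Matrix (Fin 2) (Fin 2) (VR a b c)⟦X⟧ :=
  Matrix.of fun i j => PowerSeries.mk fun r => vgen a b c i j r

/-- The matrix `L^+(u - h/2)`: the coefficient of `u^n h^k` in the expansion of
`∑_r l_{ij}^{(-r-1)} (u - h/2)^r` is `(n+k choose n) (-1/2)^k l_{ij}^{(-n-k-1)}`. -/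
def LplusShift (a : ℝ) (b : ℕ) (c : ℂ) : Matrix (Fin 2) (Fin 2) (VR a b c)⟦X⟧ :=
  Matrix.of fun i j => PowerSeries.mk fun n => toVR a b c <| PowerSeries.mk fun k =>
    (((n + k).choose n : ℂ) * (-1 / 2) ^ k) • lgen i j (n + k)

/-- The quantum determinant
`qdet L^+(u) = tr_{1,2} A_{12} L_1^+(u) L_2^+(u - h/2) 1 ∈ V(R)[[u]]`. -/
def qdet (a : ℝ) (b : ℕ) (c : ℂ) : (VR a b c)⟦X⟧ :=
  ∑ I : Fin 2 → Fin 2, ∑ J : Fin 2 → Fin 2,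
    PowerSeries.C (algebraMap ℂ⟦X⟧ (VR a b c) (antisym I J)) *
      (Lplus a b c (J 0) (I 0) * LplusShift a b c (J 1) (I 1))

/-- `Y_W(·, z)` is the generalized `φ`-coordinated `V(R)`-module map associated with the FRT-operator
`𝓛(z)` over `W`. It is a `ℂ[[h]]`-module map `V(R) ⊗ W → W[[z^{±1/2}]]`; here `Y v w m` is the
coefficient of `z^{m/2}` in `Y_W(v, z) w`. It is determined by `Y_W(1, z) w = w` and
`Y_W(L_{[n]}^+(u_1, …, u_n) 1, z) = 𝓛_{[n]}(x_1, …, x_n)` at `x_k = z^{1/2} e^{u_k}` for `n ≥ 1`,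
where `L_{[n]}^+(u) = L_1^+(u_1) ⋯ L_n^+(u_n)`. -/
structure IsModuleMap {W : Type*} [AddCommGroup W] [Module ℂ⟦X⟧ W] (a : ℝ) (b : ℕ) (c : ℂ)
    (𝓛 : OpSeries W) (Y : VR a b c →ₗ[ℂ⟦X⟧] W →ₗ[ℂ⟦X⟧] (ℤ → W)) : Prop where
  vacuum : ∀ (w : W) (m : ℤ), Y 1 w m = if m = 0 then w else 0
  bracket : ∀ n : ℕ, 1 ≤ n → ∀ (I J : Fin n → Fin 2) (r : Fin n → ℕ) (w : W) (m : ℤ),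
    Y (List.ofFn fun k => vgen a b c (I k) (J k) (r k)).prod w m =
      hSum fun e : {e : Fin n → ℤ // ∑ k, e k = m} =>
        (PowerSeries.C (∏ k, (e.1 k : ℂ) ^ r k / (r k).factorial) : ℂ⟦X⟧) •
          bracket a b 𝓛 n w e.1 I J

end EllipticFRT

end

noncomputable section

namespace EllipticFRT

/-! ### Congruences modulo powers of h, and infinite products. -/

section Congruences

variable {A : Type*} [CommRing A]

/-! Write A for the antisymmetrizer on the last two of n + 2 tensor factors, and put x_{n+1} = z,
x_{n+2} = z e^{-h/2}. The theorem follows from the identity `qTrace_bracket`: the trace over the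
last two factors of A 𝓛_{[n+2]}(x_1, …, x_n, z, z e^{-h/2}) w is 𝓛_{[n]}(x_1, …, x_n) applied to tr
A 𝓛_{[2]}(z, z e^{-h/2}) w. If w is invariant, the left side has no negative powers of x_1, …, x_n,
hence neither has the right side, so the coefficients of the quantum determinant action are
invariant (`qdetAction_mem`).

The identity is a fusion argument. In lexicographic order the product of R-matrices in 𝓛_{[n+2]}
consists, row by row, of the R_{ij} with j ≤ n followed by R_{i,n+1} R_{i,n+2}, and it ends with
R_{n+1,n+2}. The R_{ij} with i, j ≤ n commute with A and with the trace (`qTrace_mulLeft`). The pair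
R_{i,n+1}(x_i/z) R_{i,n+2}(q x_i/z) is absorbed by A because of the crossing symmetry A_{12}
R_{01}(x) R_{02}(qx) = A_{12} (`qTrace_absorb`). What remains is 𝓛_1 ⋯ 𝓛_n applied to R_{n+1,n+2}
𝓛_{n+1} 𝓛_{n+2} w, that is, to 𝓛_{[2]} w (`mulLeft_opProd_append`).

Crossing symmetry amounts to four scalar relations, such as b(x) a(qx) - d(x) d(qx) = 1, and these
factor as (b ± d)(x) (a ∓ d)(qx) = 1 and (a ± c)(x) (b ∓ c)(qx) = 1 (`crossing`). The sums a + d and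
b + c are a common scalar factor times quotients of theta products. The scalar factor is controlled
by f(z) f(q²z) (1 - q²z) = 1 - z (`fSeries_mul_rescale`, `scalarFactor_mul`). The theta products
become theta series by the Jacobi triple product, and the series satisfy addition formulas obtained
by splitting ℤ² by parity (`theta_crossing_one`, `theta_crossing_two`).

All of this takes place h-adically, at two levels. The function f must be evaluated at elements of
K[[h]] that are not small; this rests on f(z) = ∑ b_k (z/(1-z))^k with h^k ∣ b_k (`X_pow_dvd_fB`).
The bi-infinite sums over exponents converge only h-adically, so each interchange of sums needs the
joint family to be null; the support conditions `LowerFinite` and `Tame` provide this. The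
identification with Y_W is the h-adic expansion e^{-lh/2} = ∑ (-lh/2)^k / k! (`moduleMap_qdet`). -/

theorem eq_of_forall_X_pow_dvd {x y : A⟦X⟧} (h : ∀ M : ℕ, PowerSeries.X ^ M ∣ x - y) : x = y := by
  ext n
  have := PowerSeries.X_pow_dvd_iff.1 (h (n + 1)) n (Nat.lt_succ_self n)
  rwa [map_sub, sub_eq_zero] at this

theorem X_pow_dvd_trans {x y z : A⟦X⟧} {d : A⟦X⟧} (h : d ∣ x - y) (h' : d ∣ y - z) :
    d ∣ x - z := by
  simpa using dvd_add h h'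

theorem dvd_sub_symm {x y d : A⟦X⟧} (h : d ∣ x - y) : d ∣ y - x := by
  rw [← neg_sub]; exact (dvd_neg).2 h

theorem dvd_mul_sub_mul' {x y x' y' d : A⟦X⟧} (h : d ∣ x - y) (h' : d ∣ x' - y') :
    d ∣ x * x' - y * y' := by
  have : x * x' - y * y' = (x - y) * x' + y * (x' - y') := by ring
  rw [this]
  exact dvd_add (h.mul_right _) (h'.mul_left _)

theorem dvd_prod_sub_one {ι : Type*} (s : Finset ι) (u : ι → A⟦X⟧) {d : A⟦X⟧}
    (h : ∀ i ∈ s, d ∣ u i - 1) : d ∣ ∏ i ∈ s, u i - 1 := by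
  classical
  induction s using Finset.induction_on with
  | empty => simp
  | insert i s hi ih =>
    rw [Finset.prod_insert hi]
    have := dvd_mul_sub_mul' (h i (Finset.mem_insert_self _ _))
      (ih fun j hj => h j (Finset.mem_insert_of_mem hj))
    simpa using this

/-- The factors of index at least M are congruent to 1 modulo X^M, so all partial products of length
at least M agree. -/
theorem prod_range_dvd_sub (u : ℕ → A⟦X⟧) (hu : ∀ k, PowerSeries.X ^ k ∣ u k - 1) {M N N' : ℕ}
    (hN : M ≤ N) (hN' : M ≤ N') :
    PowerSeries.X ^ M ∣ ∏ k ∈ Finset.range N, u k - ∏ k ∈ Finset.range N', u k := by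
  have key : ∀ N, M ≤ N →
      PowerSeries.X ^ M ∣ ∏ k ∈ Finset.range N, u k - ∏ k ∈ Finset.range M, u k := by
    intro N hN
    rw [← Finset.prod_range_mul_prod_Ico u hN]
    have h := dvd_prod_sub_one (Finset.Ico M N) u (d := PowerSeries.X ^ M) fun i hi =>
      (pow_dvd_pow _ (Finset.mem_Ico.1 hi).1).trans (hu i)
    have := dvd_mul_sub_mul' (x := ∏ k ∈ Finset.range M, u k) (y := ∏ k ∈ Finset.range M, u k)
      (by simp) h
    simpa using this
  exact X_pow_dvd_trans (key N hN) (dvd_sub_symm (key N' hN'))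

/-- Coefficient n of `infProd` is read off a partial product whose length depends on n. By the
stability of partial products, one sufficiently long finite product represents it modulo X^M;
identities of infinite products are deduced from finite ones in this way. -/
theorem X_pow_dvd_infProd_sub (u : ℕ → A⟦X⟧) (hu : ∀ k, PowerSeries.X ^ k ∣ u k - 1) {M N : ℕ}
    (hN : M ≤ N) : PowerSeries.X ^ M ∣ infProd u - ∏ k ∈ Finset.range N, u k := by
  rw [PowerSeries.X_pow_dvd_iff]
  intro m hm
  rw [map_sub, sub_eq_zero, infProd, PowerSeries.coeff_mk]
  have := prod_range_dvd_sub u hu (M := m + 1) (N := m + 1) (N' := N) le_rfl (by omega)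
  rw [PowerSeries.X_pow_dvd_iff] at this
  have := this m (by omega)
  rwa [map_sub, sub_eq_zero] at this

theorem infProd_mul (u v : ℕ → A⟦X⟧) (hu : ∀ k, PowerSeries.X ^ k ∣ u k - 1)
    (hv : ∀ k, PowerSeries.X ^ k ∣ v k - 1) :
    infProd (fun k => u k * v k) = infProd u * infProd v := by
  have huv : ∀ k, PowerSeries.X ^ k ∣ u k * v k - 1 := fun k => by
    simpa using dvd_mul_sub_mul' (hu k) (hv k)
  refine eq_of_forall_X_pow_dvd fun M => ?_
  refine X_pow_dvd_trans (X_pow_dvd_infProd_sub _ huv (le_refl M)) ?_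
  rw [Finset.prod_mul_distrib]
  exact dvd_sub_symm (dvd_mul_sub_mul' (X_pow_dvd_infProd_sub _ hu le_rfl)
    (X_pow_dvd_infProd_sub _ hv le_rfl))

theorem infProd_eq_mul_infProd_succ (u : ℕ → A⟦X⟧) (hu : ∀ k, PowerSeries.X ^ k ∣ u k - 1) :
    infProd u = u 0 * infProd (fun k => u (k + 1)) := by
  have hu' : ∀ k, PowerSeries.X ^ k ∣ u (k + 1) - 1 := fun k =>
    (pow_dvd_pow _ (Nat.le_succ k)).trans (hu (k + 1))
  refine eq_of_forall_X_pow_dvd fun M => ?_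
  refine X_pow_dvd_trans (X_pow_dvd_infProd_sub _ hu (Nat.le_succ M)) ?_
  rw [Finset.prod_range_succ', mul_comm]
  exact dvd_mul_sub_mul' (by simp) (dvd_sub_symm (X_pow_dvd_infProd_sub _ hu' le_rfl))

end Congruences

/-! ### Jacobi triple product and addition formulas for theta series. -/

section Theta

variable {K : Type*} [Field K]

theorem X_dvd_iff_constantCoeff {x : K⟦X⟧} :
    PowerSeries.X ∣ x ↔ PowerSeries.constantCoeff x = 0 := PowerSeries.X_dvd_iff

theorem X_pow_dvd_poch_factor {x p : K⟦X⟧} (hp : PowerSeries.X ∣ p) (k : ℕ) :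
    PowerSeries.X ^ k ∣ (1 - x * p ^ k) - 1 := by
  rw [sub_sub_cancel_left, dvd_neg]
  exact (pow_dvd_pow_of_dvd hp k).mul_left _

theorem poch_dvd {x p : K⟦X⟧} (hp : PowerSeries.X ∣ p) {M N : ℕ} (h : M ≤ N) :
    PowerSeries.X ^ M ∣ poch x p - ∏ k ∈ Finset.range N, (1 - x * p ^ k) :=
  X_pow_dvd_infProd_sub _ (X_pow_dvd_poch_factor hp) h

theorem poch_eq_mul {x p : K⟦X⟧} (hp : PowerSeries.X ∣ p) :
    poch x p = (1 - x) * poch (x * p) p := by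
  rw [poch, infProd_eq_mul_infProd_succ _ (X_pow_dvd_poch_factor hp), poch]
  simp [pow_succ', mul_assoc]

theorem isUnit_of_constantCoeff {x : K⟦X⟧} (h : PowerSeries.constantCoeff x ≠ 0) : IsUnit x :=
  PowerSeries.isUnit_iff_constantCoeff.2 h.isUnit

theorem constantCoeff_poch_of_dvd {x p : K⟦X⟧} (hx : PowerSeries.X ∣ x) (hp : PowerSeries.X ∣ p) :
    PowerSeries.constantCoeff (poch x p) = 1 := by
  rw [poch_eq_mul hp, poch, infProd, map_mul,
    ← PowerSeries.coeff_zero_eq_constantCoeff_apply (PowerSeries.mk _), PowerSeries.coeff_mk]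
  simp [X_dvd_iff_constantCoeff.1 hx]

theorem constantCoeff_poch {x p : K⟦X⟧} (hp : PowerSeries.X ∣ p) :
    PowerSeries.constantCoeff (poch x p) = 1 - PowerSeries.constantCoeff x := by
  rw [poch_eq_mul hp, map_mul, constantCoeff_poch_of_dvd (hp.mul_left _) hp]
  simp

/-- The factors `(p; p)_m⁻¹`, extended by `0` to negative `m`. -/
def invFac (p : K⟦X⟧) (m : ℤ) : K⟦X⟧ :=
  if 0 ≤ m then (∏ k ∈ Finset.range m.toNat, (1 - p * p ^ k))⁻¹ else 0

theorem constantCoeff_prod_fac {p : K⟦X⟧} (hp : PowerSeries.X ∣ p) (n : ℕ) :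
    PowerSeries.constantCoeff (∏ k ∈ Finset.range n, (1 - p * p ^ k)) = 1 := by
  rw [map_prod]
  exact Finset.prod_eq_one fun i _ => by simp [X_dvd_iff_constantCoeff.1 hp]

theorem fac_mul_invFac {p : K⟦X⟧} (hp : PowerSeries.X ∣ p) (n : ℕ) :
    (∏ k ∈ Finset.range n, (1 - p * p ^ k)) * invFac p n = 1 := by
  rw [invFac, if_pos (by positivity), Int.toNat_natCast, PowerSeries.mul_inv_cancel]
  rw [constantCoeff_prod_fac hp]; exact one_ne_zero

/-- The range includes m = -1: there the left side is 0 by convention and the factor 1 - p^0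
vanishes. Boundary Gaussian coefficients therefore need no separate treatment. -/
theorem invFac_eq_mul_succ {p : K⟦X⟧} (hp : PowerSeries.X ∣ p) {m : ℤ} (hm : -1 ≤ m) :
    invFac p m = (1 - p ^ (m + 1).toNat) * invFac p (m + 1) := by
  rcases eq_or_lt_of_le hm with rfl | hm
  · simp [invFac]
  · lift m to ℕ using (by omega) with n
    have h1 := fac_mul_invFac hp n
    have h2 := fac_mul_invFac hp (n + 1)
    rw [Finset.prod_range_succ] at h2
    push_cast at h2
    rw [show ((n : ℤ) + 1).toNat = n + 1 by omega, pow_succ']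
    calc invFac p n = invFac p n * (((∏ k ∈ Finset.range n, (1 - p * p ^ k)) *
          (1 - p * p ^ n)) * invFac p (n + 1)) := by rw [h2, mul_one]
      _ = ((∏ k ∈ Finset.range n, (1 - p * p ^ k)) * invFac p n) *
          ((1 - p * p ^ n) * invFac p (n + 1)) := by ring
      _ = _ := by rw [h1, one_mul]

/-- The Gaussian binomial coefficient `[2N choose N + n]_p`. -/
def gaussCoeff (p : K⟦X⟧) (N : ℕ) (n : ℤ) : K⟦X⟧ :=
  (∏ k ∈ Finset.range (2 * N), (1 - p * p ^ k)) * invFac p (N + n) * invFac p (N - n)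

theorem gaussCoeff_eq_zero {p : K⟦X⟧} {N : ℕ} {n : ℤ} (h : n < -N ∨ (N : ℤ) < n) :
    gaussCoeff p N n = 0 := by
  rcases h with h | h
  · rw [gaussCoeff, invFac, if_neg (by omega)]; simp
  · rw [gaussCoeff, invFac, invFac, if_neg (by omega : ¬ (0 : ℤ) ≤ N - n)]; simp

/-- Two Pascal steps for Gaussian binomials at once. With i = N + 1 + n and j = N + 1 - n, so that i
+ j = 2N + 2, all terms share the denominator (p;p)_i (p;p)_j, and a polynomial identity in p^i and
p^j remains. -/
theorem gaussCoeff_succ {p : K⟦X⟧} (hp : PowerSeries.X ∣ p) (hp0 : p ≠ 0) (N : ℕ) {n : ℤ}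
    (h1 : -(N + 1 : ℤ) ≤ n) (h2 : n ≤ N + 1) :
    gaussCoeff p (N + 1) n = (1 + p ^ (2 * N + 1)) * gaussCoeff p N n +
      p ^ (N + 1 - n).toNat * gaussCoeff p N (n - 1) +
      p ^ (N + 1 + n).toNat * gaussCoeff p N (n + 1) := by
  have e1 : ∀ i : ℕ, invFac p ((i : ℤ) - 1) = (1 - p ^ i) * invFac p i := by
    intro i
    have := invFac_eq_mul_succ hp (m := (i : ℤ) - 1) (by omega)
    simpa using this
  -- The natural factor 1 - p^{i-1} is not a power series when i = 0; the extra p clears it and is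
  -- cancelled at the end using p ≠ 0.
  have e2 : ∀ i : ℕ, p * invFac p ((i : ℤ) - 2) = (p - p ^ i) * (1 - p ^ i) * invFac p i := by
    intro i
    rcases Nat.eq_zero_or_pos i with rfl | hi
    · simp [invFac]
    · have := e1 (i - 1)
      rw [show ((i - 1 : ℕ) : ℤ) - 1 = i - 2 by omega, show ((i - 1 : ℕ) : ℤ) = i - 1 by omega,
        e1 i] at this
      rw [this]
      have hpi : p * p ^ (i - 1) = p ^ i := by rw [← pow_succ']; congr 1; omega
      linear_combination (-(1 - p ^ i) * invFac p i) * hpi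
  obtain ⟨i, hi⟩ : ∃ i : ℕ, (i : ℤ) = N + 1 + n := ⟨(N + 1 + n).toNat, by omega⟩
  obtain ⟨j, hj⟩ : ∃ j : ℕ, (j : ℤ) = N + 1 - n := ⟨(N + 1 - n).toNat, by omega⟩
  simp only [gaussCoeff]
  rw [← hi, ← hj, Int.toNat_natCast, Int.toNat_natCast]
  push_cast
  rw [show (N : ℤ) + 1 + n = i by omega, show (N : ℤ) + 1 - n = j by omega,
    show (N : ℤ) + n = i - 1 by omega, show (N : ℤ) - n = j - 1 by omega,
    show (N : ℤ) + (n - 1) = i - 2 by omega, show (N : ℤ) - (n - 1) = j by omega,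
    show (N : ℤ) + (n + 1) = i by omega, show (N : ℤ) - (n + 1) = j - 2 by omega,
    show 2 * (N + 1) = 2 * N + 1 + 1 by ring, Finset.prod_range_succ, Finset.prod_range_succ,
    e1 i, e1 j]
  have hij : i + j = 2 * N + 2 := by omega
  have hp2 : p ^ i * p ^ j = p * p ^ (2 * N + 1) := by
    rw [← pow_add, hij, ← pow_succ']
  have hp1 : p * p ^ (2 * N) = p ^ (2 * N + 1) := by rw [← pow_succ']
  have ei := e2 i
  have ej := e2 j
  rw [hp1]
  apply mul_left_cancel₀ hp0
  generalize p ^ i = P at *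
  generalize p ^ j = Q at *
  generalize p ^ (2 * N + 1) = u at *
  generalize invFac p i = r at *
  generalize invFac p j = r' at *
  generalize (∏ k ∈ Finset.range (2 * N), (1 - p * p ^ k)) = F at *
  linear_combination (F * r * r' * (p - p * u + 2 - P - Q)) * hp2 - Q * F * r' * ei - P * F * r * ej

/-- A family `τ n` (`n ∈ ℤ`) proportional to `p^{n(n-1)/2} u^n`, where `u v = p`. -/
structure IsThetaFamily (p u v : K⟦X⟧) (τ : ℤ → K⟦X⟧) : Prop where
  zero : τ 0 = 1
  left : ∀ (N : ℕ) (n : ℤ), n ≤ N + 1 → u * p ^ N * τ (n - 1) = p ^ (N + 1 - n).toNat * τ n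
  right : ∀ (N : ℕ) (n : ℤ), -(N + 1 : ℤ) ≤ n →
    v * p ^ N * τ (n + 1) = p ^ (N + 1 + n).toNat * τ n
  mul : u * v = p
  finite : ∀ M : ℕ, {n | ¬ PowerSeries.X ^ M ∣ τ n}.Finite

/-- The finite form of the triple product. Since uv = p, the new factor (1 + u p^N)(1 + v p^N)
equals 1 + p^{2N+1} + u p^N + v p^N. The last two terms shift the summation index by one, which
reproduces the recursion `gaussCoeff_succ`. -/
theorem IsThetaFamily.prod_eq {p u v : K⟦X⟧} {τ : ℤ → K⟦X⟧} (h : IsThetaFamily p u v τ)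
    (hp : PowerSeries.X ∣ p) (hp0 : p ≠ 0) (N : ℕ) :
    (∏ k ∈ Finset.range N, (1 + u * p ^ k)) * ∏ k ∈ Finset.range N, (1 + v * p ^ k) =
      ∑ᶠ n : ℤ, gaussCoeff p N n * τ n := by
  have hfin : ∀ N : ℕ, (Function.support fun n : ℤ => gaussCoeff p N n).Finite := by
    intro N
    refine (Set.finite_Icc (-(N : ℤ)) N).subset fun n hn => ?_
    by_contra hn'
    refine hn (gaussCoeff_eq_zero ?_)
    simp only [Set.mem_Icc, not_and_or, not_le] at hn'
    exact hn'
  have hfin' : ∀ (N : ℕ) (e : ℤ ≃ ℤ) (f : ℤ → K⟦X⟧),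
      (Function.support fun n : ℤ => f n * gaussCoeff p N (e n)).Finite := by
    intro N e f
    refine ((hfin N).preimage (e.injective.injOn)).subset fun n hn => ?_
    exact right_ne_zero_of_mul hn
  induction N with
  | zero =>
    rw [finsum_eq_single _ (0 : ℤ)]
    · simp [gaussCoeff, invFac, h.zero]
    · intro n hn
      rw [gaussCoeff_eq_zero, zero_mul]
      simp only [Nat.cast_zero, neg_zero]; omega
  | succ N ih =>
    rw [Finset.prod_range_succ, Finset.prod_range_succ]
    have e0 : (1 + p ^ (2 * N + 1)) * ∑ᶠ n : ℤ, gaussCoeff p N n * τ n =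
        ∑ᶠ n : ℤ, ((1 + p ^ (2 * N + 1)) * τ n) * gaussCoeff p N n := by
      rw [mul_finsum]; exact finsum_congr fun n => by ring
    have e1 : (u * p ^ N) * ∑ᶠ n : ℤ, gaussCoeff p N n * τ n =
        ∑ᶠ n : ℤ, (u * p ^ N * τ (n - 1)) * gaussCoeff p N (n - 1) := by
      rw [← finsum_comp_equiv (Equiv.subRight (1 : ℤ)), mul_finsum]
      exact finsum_congr fun n => by simp only [Equiv.subRight_apply]; ring
    have e2 : (v * p ^ N) * ∑ᶠ n : ℤ, gaussCoeff p N n * τ n =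
        ∑ᶠ n : ℤ, (v * p ^ N * τ (n + 1)) * gaussCoeff p N (n + 1) := by
      rw [← finsum_comp_equiv (Equiv.addRight (1 : ℤ)), mul_finsum]
      exact finsum_congr fun n => by simp only [Equiv.coe_addRight]; ring
    have : (1 + u * p ^ N) * (1 + v * p ^ N) =
        (1 + p ^ (2 * N + 1)) + u * p ^ N + v * p ^ N := by
      linear_combination (p ^ N * p ^ N) * h.mul
    have a0 : (Function.support fun n : ℤ =>
      ((1 + p ^ (2 * N + 1)) * τ n) * gaussCoeff p N n).Finite := hfin' N (Equiv.refl _) _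
    have a1 : (Function.support fun n : ℤ =>
      (u * p ^ N * τ (n - 1)) * gaussCoeff p N (n - 1)).Finite := hfin' N (Equiv.subRight 1) _
    have a2 : (Function.support fun n : ℤ =>
      (v * p ^ N * τ (n + 1)) * gaussCoeff p N (n + 1)).Finite := hfin' N (Equiv.addRight 1) _
    rw [show ∀ a b c d : K⟦X⟧, a * b * (c * d) = (b * d) * (a * c) by intros; ring, this, ih,
      add_mul, add_mul, e0, e1, e2, ← finsum_add_distrib a0 a1, ← finsum_add_distrib _ a2]
    · refine finsum_congr fun n => ?_
      by_cases hn : n < -(N + 1 : ℤ) ∨ (N : ℤ) + 1 < n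
      · rw [gaussCoeff_eq_zero (n := n) (by omega), gaussCoeff_eq_zero (n := n - 1) (by omega),
          gaussCoeff_eq_zero (n := n + 1) (by omega), gaussCoeff_eq_zero (n := n) (by push_cast; omega)]
        simp
      · rw [gaussCoeff_succ hp hp0 N (by omega) (by omega), h.left N n (by omega),
          h.right N n (by omega)]
        ring
    · exact (a0.union a1).subset
        (Function.support_add _ _)

/-- Quantitative version of the limit [2N choose N + n]_p → 1/(p;p)_∞: both lower factorials have
length at least M once |n| + M ≤ N. -/
theorem gaussCoeff_mul_dvd {p : K⟦X⟧} (hp : PowerSeries.X ∣ p) {M N : ℕ} {n : ℤ}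
    (h : |n| + M ≤ N) : PowerSeries.X ^ M ∣ gaussCoeff p N n * poch p p - 1 := by
  have hr : ∀ m : ℕ, M ≤ m → PowerSeries.X ^ M ∣ invFac p m * poch p p - 1 := by
    intro m hm
    have := dvd_mul_sub_mul' (x := invFac p m) (y := invFac p m) (by simp) (poch_dvd (x := p) hp hm)
    rwa [mul_comm (invFac p m) (∏ _ ∈ _, _), fac_mul_invFac hp] at this
  have h1 := abs_le.1 (show |n| ≤ N - M by omega)
  obtain ⟨i, hi⟩ : ∃ i : ℕ, (i : ℤ) = N + n := ⟨(N + n).toNat, by omega⟩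
  obtain ⟨j, hj⟩ : ∃ j : ℕ, (j : ℤ) = N - n := ⟨(N - n).toNat, by omega⟩
  rw [gaussCoeff, ← hi, ← hj]
  have h2 := dvd_mul_sub_mul' (dvd_mul_sub_mul' (dvd_sub_symm (poch_dvd (x := p) hp
    (show M ≤ 2 * N by omega))) (show PowerSeries.X ^ M ∣ invFac p i - invFac p i by simp))
    (hr j (by omega))
  rw [mul_comm (poch p p)] at h2
  have := X_pow_dvd_trans h2 (by rw [mul_one]; exact hr i (by omega))
  rwa [← mul_assoc] at this

open scoped PowerSeries.WithPiTopology

variable [TopologicalSpace K] [DiscreteTopology K]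

omit [DiscreteTopology K] in
-- For discrete K the product topology on K⟦X⟧ is the X-adic one, and the hypothesis says that the
-- family tends to 0 in it.
theorem summable_of_finite {ι : Type*} {f : ι → K⟦X⟧}
    (h : ∀ M : ℕ, {i | ¬ PowerSeries.X ^ M ∣ f i}.Finite) : Summable f := by
  rw [PowerSeries.WithPiTopology.summable_iff_summable_coeff]
  intro d
  refine summable_of_hasFiniteSupport ((h (d + 1)).subset fun i hi hd => hi ?_)
  exact PowerSeries.X_pow_dvd_iff.1 hd d (Nat.lt_succ_self d)

theorem X_pow_dvd_tsum_sub {ι : Type*} {f : ι → K⟦X⟧}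
    (h : ∀ M : ℕ, {i | ¬ PowerSeries.X ^ M ∣ f i}.Finite) {M : ℕ} (F : Finset ι)
    (hF : ∀ i ∉ F, PowerSeries.X ^ M ∣ f i) : PowerSeries.X ^ M ∣ ∑' i, f i - ∑ i ∈ F, f i := by
  rw [PowerSeries.X_pow_dvd_iff]
  intro m hm
  have h1 := (summable_of_finite h).hasSum
  rw [PowerSeries.WithPiTopology.hasSum_iff_hasSum_coeff] at h1
  have h2 : HasSum (fun i => PowerSeries.coeff m (f i)) (∑ i ∈ F, PowerSeries.coeff m (f i)) :=
    hasSum_sum_of_ne_finset_zero fun i hi => PowerSeries.X_pow_dvd_iff.1 (hF i hi) m hm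
  rw [map_sub, map_sum, (h1 m).unique h2, sub_self]

/-- The Jacobi triple product identity. -/
theorem IsThetaFamily.poch_mul_poch {p u v : K⟦X⟧} {τ : ℤ → K⟦X⟧} (h : IsThetaFamily p u v τ)
    (hp : PowerSeries.X ∣ p) (hp0 : p ≠ 0) :
    poch (-u) p * poch (-v) p * poch p p = ∑' n : ℤ, τ n := by
  refine eq_of_forall_X_pow_dvd fun M => ?_
  have hF := h.finite M
  set F := hF.toFinset with hFd
  have hF' : ∀ i ∉ F, PowerSeries.X ^ M ∣ τ i := fun i hi => by
    by_contra hc; exact hi (by simpa [hFd] using hc)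
  -- Off F the terms of both sides vanish modulo X^M. On F the Gaussian coefficient has to agree
  -- with its limit modulo X^M, which dictates the size of N.
  obtain ⟨N, hN⟩ : ∃ N : ℕ, ∀ n ∈ F, |n| + M ≤ N := by
    refine ⟨∑ n ∈ F, n.natAbs + M, fun n hn => ?_⟩
    have := Finset.single_le_sum (f := fun n : ℤ => n.natAbs) (fun _ _ => Nat.zero_le _) hn
    have := Int.abs_eq_natAbs n
    omega
  refine X_pow_dvd_trans ?_ (dvd_sub_symm (X_pow_dvd_tsum_sub h.finite F hF'))
  have h1 := dvd_mul_sub_mul' (poch_dvd (x := -u) hp (show M ≤ N + M by omega))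
    (poch_dvd (x := -v) hp (show M ≤ N + M by omega))
  simp only [neg_mul, sub_neg_eq_add] at h1
  rw [h.prod_eq hp hp0] at h1
  refine X_pow_dvd_trans (dvd_mul_sub_mul' h1 (show _ ∣ poch p p - poch p p by simp)) ?_
  rw [finsum_eq_sum_of_support_subset (s := Finset.Icc (-((N + M : ℕ) : ℤ)) (N + M : ℕ) ∪ F),
    Finset.sum_mul, ← Finset.sum_sdiff (Finset.subset_union_right (s₂ := F)), add_sub_assoc,
    ← Finset.sum_sub_distrib]
  · refine dvd_add (Finset.dvd_sum fun i hi => ?_) (Finset.dvd_sum fun i hi => ?_)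
    · exact ((hF' i (Finset.mem_sdiff.1 hi).2).mul_left _).mul_right _
    · have := gaussCoeff_mul_dvd hp (M := M) (N := N + M) (n := i)
        (by have := hN i hi; push_cast; omega)
      rw [show gaussCoeff p (N + M) i * τ i * poch p p - τ i =
        (gaussCoeff p (N + M) i * poch p p - 1) * τ i by ring]
      exact this.mul_right _
  · intro n hn
    simp only [Finset.coe_union, Set.mem_union, Finset.coe_Icc, Set.mem_Icc]
    left
    by_contra hc
    exact left_ne_zero_of_mul hn (gaussCoeff_eq_zero (by omega))

/-! The theta series `∑ s^{n²} x^n` and `∑ s^{n(n-1)} x^n`. -/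

def thetaA (s : K⟦X⟧) (x : K⟦X⟧ˣ) : K⟦X⟧ :=
  ∑' n : ℤ, s ^ (n * n).toNat * ((x ^ n : K⟦X⟧ˣ) : K⟦X⟧)

def thetaB (s : K⟦X⟧) (x : K⟦X⟧ˣ) : K⟦X⟧ :=
  ∑' n : ℤ, s ^ (n * (n - 1)).toNat * ((x ^ n : K⟦X⟧ˣ) : K⟦X⟧)

omit [TopologicalSpace K] [DiscreteTopology K] in
theorem finite_not_dvd_pow_mul {ι : Type*} {s : K⟦X⟧} (hs : PowerSeries.X ∣ s) (e : ι → ℕ)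
    (u : ι → K⟦X⟧) (he : ∀ M : ℕ, {i | e i < M}.Finite) (M : ℕ) :
    {i | ¬ PowerSeries.X ^ M ∣ s ^ e i * u i}.Finite := by
  refine (he M).subset fun i hi => ?_
  by_contra hc
  simp only [Set.mem_ofPred_eq, not_lt] at hc
  exact hi ((((pow_dvd_pow _ hc).trans (pow_dvd_pow_of_dvd hs _))).mul_right _)

theorem finite_sq_lt (M : ℕ) : {n : ℤ | (n * n).toNat < M}.Finite := by
  refine (Set.finite_Icc (-(M : ℤ)) M).subset fun n hn => ?_
  have hn : (n * n).toNat < M := hn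
  constructor <;> nlinarith [Int.self_le_toNat (n * n)]

theorem mul_pred_nonneg (n : ℤ) : 0 ≤ n * (n - 1) := by
  rcases le_or_gt n 0 with h | h <;> nlinarith

theorem finite_mul_pred_lt (M : ℕ) : {n : ℤ | (n * (n - 1)).toNat < M}.Finite := by
  refine (Set.finite_Icc (-(M : ℤ) - 1) (M + 1)).subset fun n hn => ?_
  have hn : (n * (n - 1)).toNat < M := hn
  constructor <;> nlinarith [Int.self_le_toNat (n * (n - 1)), mul_pred_nonneg n]

omit [TopologicalSpace K] [DiscreteTopology K] in
theorem finite_thetaA {s : K⟦X⟧} (hs : PowerSeries.X ∣ s) (x : K⟦X⟧ˣ) (M : ℕ) :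
    {n : ℤ | ¬ PowerSeries.X ^ M ∣ s ^ (n * n).toNat * ((x ^ n : K⟦X⟧ˣ) : K⟦X⟧)}.Finite :=
  finite_not_dvd_pow_mul hs _ _ finite_sq_lt M

omit [TopologicalSpace K] [DiscreteTopology K] in
theorem finite_thetaB {s : K⟦X⟧} (hs : PowerSeries.X ∣ s) (x : K⟦X⟧ˣ) (M : ℕ) :
    {n : ℤ | ¬ PowerSeries.X ^ M ∣ s ^ (n * (n - 1)).toNat * ((x ^ n : K⟦X⟧ˣ) : K⟦X⟧)}.Finite :=
  finite_not_dvd_pow_mul hs _ _ finite_mul_pred_lt M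

omit [TopologicalSpace K] [DiscreteTopology K] in
theorem isThetaFamilyA {s : K⟦X⟧} (hs : PowerSeries.X ∣ s) (x : K⟦X⟧ˣ) :
    IsThetaFamily (s ^ 2) (s * (↑x : K⟦X⟧)) (s * (↑x⁻¹ : K⟦X⟧))
      (fun n : ℤ => s ^ (n * n).toNat * ((x ^ n : K⟦X⟧ˣ) : K⟦X⟧)) where
  zero := by simp
  left N n hn := by
    have e1 : ((x ^ n : K⟦X⟧ˣ) : K⟦X⟧) = x * ((x ^ (n - 1) : K⟦X⟧ˣ) : K⟦X⟧) := by
      rw [← Units.val_mul, mul_self_zpow, sub_add_cancel]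
    have e2 : s * (s ^ 2) ^ N * s ^ ((n - 1) * (n - 1)).toNat =
        (s ^ 2) ^ (N + 1 - n).toNat * s ^ (n * n).toNat := by
      rw [← pow_mul, ← pow_mul, ← pow_succ', ← pow_add, ← pow_add]
      congr 1
      have := mul_self_nonneg n
      have := mul_self_nonneg (n - 1)
      have : 0 ≤ (N : ℤ) + 1 - n := by omega
      zify
      rw [Int.toNat_of_nonneg (by assumption), Int.toNat_of_nonneg (by assumption),
        Int.toNat_of_nonneg (by assumption)]
      ring
    rw [e1]; linear_combination ((x : K⟦X⟧) * ((x ^ (n - 1) : K⟦X⟧ˣ) : K⟦X⟧)) * e2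
  right N n hn := by
    have e1 : ((x ^ n : K⟦X⟧ˣ) : K⟦X⟧) = (↑x⁻¹ : K⟦X⟧) * ((x ^ (n + 1) : K⟦X⟧ˣ) : K⟦X⟧) := by
      rw [← Units.val_mul, ← zpow_neg_one, ← zpow_add]; congr 2; ring
    have e2 : s * (s ^ 2) ^ N * s ^ ((n + 1) * (n + 1)).toNat =
        (s ^ 2) ^ (N + 1 + n).toNat * s ^ (n * n).toNat := by
      rw [← pow_mul, ← pow_mul, ← pow_succ', ← pow_add, ← pow_add]
      congr 1
      have := mul_self_nonneg n
      have := mul_self_nonneg (n + 1)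
      have : 0 ≤ (N : ℤ) + 1 + n := by omega
      zify
      rw [Int.toNat_of_nonneg (by assumption), Int.toNat_of_nonneg (by assumption),
        Int.toNat_of_nonneg (by assumption)]
      ring
    rw [e1]
    linear_combination ((↑x⁻¹ : K⟦X⟧) * ((x ^ (n + 1) : K⟦X⟧ˣ) : K⟦X⟧)) * e2
  mul := by linear_combination s ^ 2 * x.mul_inv
  finite := finite_thetaA hs x

omit [TopologicalSpace K] [DiscreteTopology K] in
theorem isThetaFamilyB {s : K⟦X⟧} (hs : PowerSeries.X ∣ s) (x : K⟦X⟧ˣ) :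
    IsThetaFamily (s ^ 2) (↑x : K⟦X⟧) (s ^ 2 * (↑x⁻¹ : K⟦X⟧))
      (fun n : ℤ => s ^ (n * (n - 1)).toNat * ((x ^ n : K⟦X⟧ˣ) : K⟦X⟧)) where
  zero := by simp
  left N n hn := by
    have e1 : ((x ^ n : K⟦X⟧ˣ) : K⟦X⟧) = x * ((x ^ (n - 1) : K⟦X⟧ˣ) : K⟦X⟧) := by
      rw [← Units.val_mul, mul_self_zpow, sub_add_cancel]
    have e2 : (s ^ 2) ^ N * s ^ ((n - 1) * (n - 1 - 1)).toNat =
        (s ^ 2) ^ (N + 1 - n).toNat * s ^ (n * (n - 1)).toNat := by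
      rw [← pow_mul, ← pow_mul, ← pow_add, ← pow_add]
      congr 1
      have := mul_pred_nonneg n
      have := mul_pred_nonneg (n - 1)
      have : 0 ≤ (N : ℤ) + 1 - n := by omega
      zify
      rw [Int.toNat_of_nonneg (by assumption), Int.toNat_of_nonneg (by assumption),
        Int.toNat_of_nonneg (by assumption)]
      ring
    rw [e1]; linear_combination ((x : K⟦X⟧) * ((x ^ (n - 1) : K⟦X⟧ˣ) : K⟦X⟧)) * e2
  right N n hn := by
    have e1 : ((x ^ n : K⟦X⟧ˣ) : K⟦X⟧) = (↑x⁻¹ : K⟦X⟧) * ((x ^ (n + 1) : K⟦X⟧ˣ) : K⟦X⟧) := by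
      rw [← Units.val_mul, ← zpow_neg_one, ← zpow_add]; congr 2; ring
    have e2 : s ^ 2 * (s ^ 2) ^ N * s ^ ((n + 1) * (n + 1 - 1)).toNat =
        (s ^ 2) ^ (N + 1 + n).toNat * s ^ (n * (n - 1)).toNat := by
      rw [← pow_mul, ← pow_mul, ← pow_add, ← pow_add, ← pow_add]
      congr 1
      have := mul_pred_nonneg n
      have := mul_pred_nonneg (n + 1)
      have : 0 ≤ (N : ℤ) + 1 + n := by omega
      zify
      rw [Int.toNat_of_nonneg (by assumption), Int.toNat_of_nonneg (by assumption),
        Int.toNat_of_nonneg (by assumption)]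
      ring
    rw [e1]
    linear_combination ((↑x⁻¹ : K⟦X⟧) * ((x ^ (n + 1) : K⟦X⟧ˣ) : K⟦X⟧)) * e2
  mul := by linear_combination s ^ 2 * x.mul_inv
  finite := finite_thetaB hs x

theorem thetaA_eq {s : K⟦X⟧} (hs : PowerSeries.X ∣ s) (hs0 : s ≠ 0) (x : K⟦X⟧ˣ) :
    thetaA s x = poch (-(s * (↑x : K⟦X⟧))) (s ^ 2) * poch (-(s * (↑x⁻¹ : K⟦X⟧))) (s ^ 2) *
      poch (s ^ 2) (s ^ 2) :=
  ((isThetaFamilyA hs x).poch_mul_poch (hs.trans (dvd_pow_self _ two_ne_zero))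
    (pow_ne_zero _ hs0)).symm

theorem thetaB_eq {s : K⟦X⟧} (hs : PowerSeries.X ∣ s) (hs0 : s ≠ 0) (x : K⟦X⟧ˣ) :
    thetaB s x = poch (-(↑x : K⟦X⟧)) (s ^ 2) * poch (-(s ^ 2 * (↑x⁻¹ : K⟦X⟧))) (s ^ 2) *
      poch (s ^ 2) (s ^ 2) :=
  ((isThetaFamilyB hs x).poch_mul_poch (hs.trans (dvd_pow_self _ two_ne_zero))
    (pow_ne_zero _ hs0)).symm

/-- The splitting of `ℤ²` by the parity of the sum of the coordinates. -/
def paritySplit (c : ℤ) : (ℤ × ℤ) ⊕ (ℤ × ℤ) → ℤ × ℤ :=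
  Sum.elim (fun a => (a.1 + a.2, a.1 - a.2)) (fun a => (a.1 + a.2 + c, a.1 - a.2 + c + 1))

theorem paritySplit_bijective (c : ℤ) : Function.Bijective (paritySplit c) := by
  constructor
  · rintro (⟨i, j⟩ | ⟨i, j⟩) (⟨i', j'⟩ | ⟨i', j'⟩) h <;>
      simp only [paritySplit, Sum.elim_inl, Sum.elim_inr, Prod.mk.injEq] at h <;>
      simp only [reduceCtorEq, Sum.inl.injEq, Sum.inr.injEq, Prod.mk.injEq] <;> omega
  · rintro ⟨m, n⟩
    rcases Int.even_or_odd (m + n) with ⟨k, hk⟩ | ⟨k, hk⟩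
    · exact ⟨Sum.inl (k, m - k), by simp [paritySplit]; omega⟩
    · exact ⟨Sum.inr (k - c, m - k), by simp [paritySplit]; omega⟩

omit [TopologicalSpace K] [DiscreteTopology K] in
theorem finite_mul_prod {ι κ : Type*} {f : ι → K⟦X⟧} {g : κ → K⟦X⟧}
    (hf : ∀ M : ℕ, {i | ¬ PowerSeries.X ^ M ∣ f i}.Finite)
    (hg : ∀ M : ℕ, {i | ¬ PowerSeries.X ^ M ∣ g i}.Finite) (M : ℕ) :
    {i : ι × κ | ¬ PowerSeries.X ^ M ∣ f i.1 * g i.2}.Finite := by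
  refine ((hf M).prod (hg M)).subset fun i hi => ?_
  exact ⟨fun h => hi (h.mul_right _), fun h => hi (h.mul_left _)⟩

/-- Sort the double sum over (m, n) by the parity of m + n. The substitutions (i + j, i - j) and (i
+ j + c, i - j + c + 1) diagonalise the quadratic exponents and double the nome. The shift c is free
and serves to put the odd half in theta form. -/
theorem tsum_mul_tsum_split {f g f₁ g₁ f₂ g₂ : ℤ → K⟦X⟧} (c : ℤ) (d : K⟦X⟧)
    (hf : ∀ M : ℕ, {i | ¬ PowerSeries.X ^ M ∣ f i}.Finite)
    (hg : ∀ M : ℕ, {i | ¬ PowerSeries.X ^ M ∣ g i}.Finite)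
    (hf₁ : ∀ M : ℕ, {i | ¬ PowerSeries.X ^ M ∣ f₁ i}.Finite)
    (hg₁ : ∀ M : ℕ, {i | ¬ PowerSeries.X ^ M ∣ g₁ i}.Finite)
    (hf₂ : ∀ M : ℕ, {i | ¬ PowerSeries.X ^ M ∣ f₂ i}.Finite)
    (hg₂ : ∀ M : ℕ, {i | ¬ PowerSeries.X ^ M ∣ g₂ i}.Finite)
    (h₁ : ∀ i j : ℤ, f (i + j) * g (i - j) = f₁ i * g₁ j)
    (h₂ : ∀ i j : ℤ, f (i + j + c) * g (i - j + c + 1) = d * (f₂ i * g₂ j)) :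
    (∑' n, f n) * ∑' n, g n = (∑' n, f₁ n) * (∑' n, g₁ n) + d * ((∑' n, f₂ n) * ∑' n, g₂ n) := by
  have key : ∀ {f g : ℤ → K⟦X⟧}, (∀ M : ℕ, {i | ¬ PowerSeries.X ^ M ∣ f i}.Finite) →
      (∀ M : ℕ, {i | ¬ PowerSeries.X ^ M ∣ g i}.Finite) →
      HasSum (fun a : ℤ × ℤ => f a.1 * g a.2) ((∑' n, f n) * ∑' n, g n) := fun hf hg =>
    (summable_of_finite hf).hasSum.mul (summable_of_finite hg).hasSum
      (summable_of_finite (finite_mul_prod hf hg))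
  have h := key hf hg
  rw [← (Equiv.ofBijective _ (paritySplit_bijective c)).hasSum_iff] at h
  refine h.unique (HasSum.sum ?_ ?_)
  · convert! key hf₁ hg₁ using 2 with a
    exact h₁ a.1 a.2
  · convert! (key hf₂ hg₂).mul_left d using 2 with a
    exact h₂ a.1 a.2

theorem theta_term_mul {R : Type*} [CommRing R] (s : R) {u v u' v' w : Rˣ} {a b c d : ℤ} (k : ℕ)
    (ha : 0 ≤ a) (hb : 0 ≤ b) (hc : 0 ≤ c) (hd : 0 ≤ d) (h : a + b = k + 2 * c + 2 * d)
    (huv : u * v = w * (u' * v')) :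
    (s ^ a.toNat * (u : R)) * (s ^ b.toNat * (v : R)) = s ^ k * (w : R) *
      (((s ^ 2) ^ c.toNat * (u' : R)) * ((s ^ 2) ^ d.toNat * (v' : R))) := by
  have e1 : s ^ a.toNat * s ^ b.toNat = s ^ k * ((s ^ 2) ^ c.toNat * (s ^ 2) ^ d.toNat) := by
    rw [← pow_mul, ← pow_mul, ← pow_add, ← pow_add, ← pow_add]; congr 1; omega
  have e2 : (u : R) * v = w * (u' * v') := by exact_mod_cast huv
  linear_combination (u : R) * v * e1 + s ^ k * ((s ^ 2) ^ c.toNat * (s ^ 2) ^ d.toNat) * e2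

theorem units_zpow_split {G : Type*} [CommGroup G] (x y : G) (i j : ℤ) :
    (x * y) ^ i * (x * y⁻¹) ^ j = x ^ (i + j) * y ^ (i - j) := by
  rw [mul_zpow, mul_zpow, inv_zpow', zpow_add, sub_eq_add_neg, zpow_add]
  exact mul_mul_mul_comm _ _ _ _

theorem thetaA_mul_thetaA {s : K⟦X⟧} (hs : PowerSeries.X ∣ s) (x y : K⟦X⟧ˣ) :
    thetaA s x * thetaA s y = thetaA (s ^ 2) (x * y) * thetaA (s ^ 2) (x * y⁻¹) +
      s * (↑x⁻¹ : K⟦X⟧) * (thetaB (s ^ 2) (x * y) * thetaB (s ^ 2) (x * y⁻¹)) := by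
  have hs2 : PowerSeries.X ∣ s ^ 2 := hs.trans (dvd_pow_self _ two_ne_zero)
  -- With c = -1 the odd exponents satisfy (i+j-1)² + (i-j)² = 1 + 2i(i-1) + 2j(j-1), which is where
  -- the prefactor s and the two `thetaB` come from.
  refine tsum_mul_tsum_split (-1) _ (finite_thetaA hs x) (finite_thetaA hs y) (finite_thetaA hs2 _)
    (finite_thetaA hs2 _) (finite_thetaB hs2 _) (finite_thetaB hs2 _) ?_ ?_
  · intro i j
    rw [theta_term_mul s (u' := (x * y) ^ i) (v' := (x * y⁻¹) ^ j) (w := 1) 0 (mul_self_nonneg _) (mul_self_nonneg _) (mul_self_nonneg i)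
      (mul_self_nonneg j) (by push_cast; ring) (by rw [one_mul, units_zpow_split])]
    simp
  · intro i j
    rw [theta_term_mul s (w := x⁻¹) 1 (mul_self_nonneg _) (mul_self_nonneg _) (mul_pred_nonneg i)
      (mul_pred_nonneg j) (by push_cast; ring) ?_, pow_one]
    rw [units_zpow_split, ← zpow_neg_one, ← mul_assoc, ← zpow_add]
    congr 2 <;> ring

theorem thetaB_mul_thetaB {s : K⟦X⟧} (hs : PowerSeries.X ∣ s) (x y : K⟦X⟧ˣ) :
    thetaB s x * thetaB s y = thetaB (s ^ 2) (x * y) * thetaA (s ^ 2) (x * y⁻¹) +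
      (y : K⟦X⟧) * (thetaA (s ^ 2) (x * y) * thetaB (s ^ 2) (x * y⁻¹)) := by
  have hs2 : PowerSeries.X ∣ s ^ 2 := hs.trans (dvd_pow_self _ two_ne_zero)
  -- With c = 0 the odd exponents sum to 2i² + 2j(j-1): one factor becomes `thetaA`, the other
  -- `thetaB`.
  refine tsum_mul_tsum_split 0 _ (finite_thetaB hs x) (finite_thetaB hs y) (finite_thetaB hs2 _)
    (finite_thetaA hs2 _) (finite_thetaA hs2 _) (finite_thetaB hs2 _) ?_ ?_
  · intro i j
    rw [theta_term_mul s (u' := (x * y) ^ i) (v' := (x * y⁻¹) ^ j) (w := 1) 0 (mul_pred_nonneg _) (mul_pred_nonneg _) (mul_pred_nonneg i)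
      (mul_self_nonneg j) (by push_cast; ring) (by rw [one_mul, units_zpow_split])]
    simp
  · intro i j
    rw [theta_term_mul s (w := y) 0 (mul_pred_nonneg _) (mul_pred_nonneg _) (mul_self_nonneg i)
      (mul_pred_nonneg j) (by push_cast; ring) ?_, pow_zero, one_mul]
    rw [units_zpow_split, mul_left_comm, ← zpow_one_add]
    congr 2 <;> ring

omit [DiscreteTopology K] in
theorem thetaA_inv (s : K⟦X⟧) (x : K⟦X⟧ˣ) : thetaA s x⁻¹ = thetaA s x := by
  rw [thetaA, ← (Equiv.neg ℤ).tsum_eq]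
  simp [thetaA]

/-- The exponent n(n-1) is invariant under n ↦ 1 - n. At x = -1 this symmetry forces the series to
equal its own negative. -/
theorem mul_thetaB_inv {s : K⟦X⟧} (hs : PowerSeries.X ∣ s) (x : K⟦X⟧ˣ) :
    (x : K⟦X⟧) * thetaB s x⁻¹ = thetaB s x := by
  rw [thetaB, ← (summable_of_finite (finite_thetaB hs x⁻¹)).tsum_mul_left, thetaB,
    ← (Equiv.subLeft (1 : ℤ)).tsum_eq]
  refine tsum_congr fun n => ?_
  rw [Equiv.subLeft_apply, mul_left_comm, ← Units.val_mul, inv_zpow', ← zpow_one_add]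
  congr 3 <;> ring

theorem thetaB_neg_one {s : K⟦X⟧} (hs : PowerSeries.X ∣ s) [CharZero K] :
    thetaB s (-1 : K⟦X⟧ˣ) = 0 := by
  have h := mul_thetaB_inv hs (-1 : K⟦X⟧ˣ)
  rw [inv_neg_one, Units.val_neg, Units.val_one, neg_one_mul] at h
  ext n
  have := congrArg (PowerSeries.coeff n) h
  rw [map_neg] at this
  rw [self_eq_neg.1 this.symm, map_zero]

/-- The addition formulas at y = -x, where x y⁻¹ = -1 and the second summand vanishes because
`thetaB` does at -1. -/
theorem theta_products {s : K⟦X⟧} [CharZero K] (hs : PowerSeries.X ∣ s) (x : K⟦X⟧ˣ) :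
    thetaA s x * thetaA s (-x) = thetaA (s ^ 2) (-(x * x)) * thetaA (s ^ 2) (-1 : K⟦X⟧ˣ) ∧
    thetaB s x * thetaB s (-x) = thetaB (s ^ 2) (-(x * x)) * thetaA (s ^ 2) (-1 : K⟦X⟧ˣ) := by
  have hs2 : PowerSeries.X ∣ s ^ 2 := hs.trans (dvd_pow_self _ two_ne_zero)
  rw [thetaA_mul_thetaA hs, thetaB_mul_thetaB hs, inv_neg, mul_neg, mul_neg, mul_inv_cancel,
    thetaB_neg_one hs2]
  simp

/-- Every product of thetas in the crossing identities is written through nome-s² thetas at -x²,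
-(xq)² and -q². In the symmetric combinations of the first four formulas only one of the two
summands of the addition formulas survives. -/
theorem theta_products_twist {s : K⟦X⟧} [CharZero K] (hs : PowerSeries.X ∣ s) (x q : K⟦X⟧ˣ) :
    (thetaB s (x * q⁻¹) * thetaB s (-(x * q)) + thetaB s (-(x * q⁻¹)) * thetaB s (x * q) =
      2 * (thetaB (s ^ 2) (-(x * x)) * thetaA (s ^ 2) (-(q * q)))) ∧
    ((q : K⟦X⟧) * (thetaB s (x * q⁻¹) * thetaB s (-(x * q)) - thetaB s (-(x * q⁻¹)) * thetaB s (x * q)) =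
      2 * x * (thetaA (s ^ 2) (-(x * x)) * thetaB (s ^ 2) (-(q * q)))) ∧
    (thetaA s (-(x * q⁻¹)) * thetaA s (x * q) + thetaA s (x * q⁻¹) * thetaA s (-(x * q)) =
      2 * (thetaA (s ^ 2) (-(x * x)) * thetaA (s ^ 2) (-(q * q)))) ∧
    (q * (thetaA s (-(x * q⁻¹)) * thetaA s (x * q) - thetaA s (x * q⁻¹) * thetaA s (-(x * q))) =
      2 * (s * (↑x⁻¹ : K⟦X⟧)) * (thetaB (s ^ 2) (-(x * x)) * thetaB (s ^ 2) (-(q * q)))) ∧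
    ((q * q : K⟦X⟧) * (thetaA s (-x) * thetaA s (x * (q * q))) =
      (q * q : K⟦X⟧) * (thetaA (s ^ 2) (-(x * q * (x * q))) * thetaA (s ^ 2) (-(q * q))) +
      s * (↑x⁻¹ : K⟦X⟧) * (thetaB (s ^ 2) (-(x * q * (x * q))) * thetaB (s ^ 2) (-(q * q)))) ∧
    (thetaB s x * thetaB s (-(x * (q * q))) =
      thetaB (s ^ 2) (-(x * q * (x * q))) * thetaA (s ^ 2) (-(q * q)) +
      x * (thetaA (s ^ 2) (-(x * q * (x * q))) * thetaB (s ^ 2) (-(q * q)))) := by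
  have hs2 : PowerSeries.X ∣ s ^ 2 := hs.trans (dvd_pow_self _ two_ne_zero)
  have e1 : x * q⁻¹ * (x * q) = x * x := by rw [mul_mul_mul_comm, inv_mul_cancel, mul_one]
  have e2 : x * q⁻¹ * (x * q)⁻¹ = (q * q)⁻¹ := by
    rw [mul_inv, mul_mul_mul_comm, mul_inv_cancel, one_mul, mul_inv]
  have e3 : x * (x * (q * q)) = x * q * (x * q) := by rw [mul_mul_mul_comm, mul_assoc]
  have e6 : x * (x * (q * q))⁻¹ = (q * q)⁻¹ := by rw [mul_inv, ← mul_assoc, mul_inv_cancel, one_mul]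
  have hA : thetaA (s ^ 2) (-(q * q)⁻¹) = thetaA (s ^ 2) (-(q * q)) := by
    rw [← thetaA_inv, inv_neg, inv_inv]
  have hB : -(q * q : K⟦X⟧) * thetaB (s ^ 2) (-(q * q)⁻¹) = thetaB (s ^ 2) (-(q * q)) := by
    rw [← mul_thetaB_inv hs2 (-(q * q)), inv_neg]; simp
  have n1 : x * q⁻¹ * (-(x * q)) = -(x * x) := by rw [mul_neg, e1]
  have n2 : x * q⁻¹ * (-(x * q))⁻¹ = -(q * q)⁻¹ := by rw [inv_neg, mul_neg, e2]
  have n3 : -(x * q⁻¹) * (x * q) = -(x * x) := by rw [neg_mul, e1]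
  have n4 : -(x * q⁻¹) * (x * q)⁻¹ = -(q * q)⁻¹ := by rw [neg_mul, e2]
  have n5 : -x * (x * (q * q)) = -(x * q * (x * q)) := by rw [neg_mul, e3]
  have n6 : -x * (x * (q * q))⁻¹ = -(q * q)⁻¹ := by rw [neg_mul, e6]
  have n7 : x * -(x * (q * q)) = -(x * q * (x * q)) := by rw [mul_neg, e3]
  have n8 : x * (-(x * (q * q)))⁻¹ = -(q * q)⁻¹ := by rw [inv_neg, mul_neg, e6]
  have m1 := thetaB_mul_thetaB hs (x * q⁻¹) (-(x * q))
  have m2 := thetaB_mul_thetaB hs (-(x * q⁻¹)) (x * q)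
  have m3 := thetaA_mul_thetaA hs (-(x * q⁻¹)) (x * q)
  have m4 := thetaA_mul_thetaA hs (x * q⁻¹) (-(x * q))
  have m5 := thetaA_mul_thetaA hs (-x) (x * (q * q))
  have m6 := thetaB_mul_thetaB hs x (-(x * (q * q)))
  rw [n1, n2, hA] at m1 m4
  rw [n3, n4, hA] at m2 m3
  rw [n5, n6, hA] at m5
  rw [n7, n8, hA] at m6
  have i1 : (↑(-(x * q⁻¹))⁻¹ : K⟦X⟧) = -(↑x⁻¹ * q) := by simp [mul_comm]
  have i2 : (↑(x * q⁻¹)⁻¹ : K⟦X⟧) = ↑x⁻¹ * q := by simp [mul_comm]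
  have i3 : (↑(-x)⁻¹ : K⟦X⟧) = -↑x⁻¹ := by simp
  rw [i1] at m3
  rw [i2] at m4
  rw [i3] at m5
  rw [Units.val_neg, Units.val_mul] at m1
  rw [Units.val_mul] at m2
  rw [Units.val_neg, Units.val_mul, Units.val_mul] at m6
  rw [m1, m2, m3, m4, m5, m6, ← hB]
  refine ⟨?_, ?_, ?_, ?_, ?_, ?_⟩ <;> ring

/-- First addition formula for the four theta functions. -/
theorem theta_crossing_one {s : K⟦X⟧} [CharZero K] (hs : PowerSeries.X ∣ s) (x q : K⟦X⟧ˣ) :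
    (q : K⟦X⟧) * (thetaB s (x * q⁻¹) * thetaB s (-(x * q)) + thetaB s (-(x * q⁻¹)) * thetaB s (x * q)) *
        (thetaA s (x * q) * thetaA s (-(x * q))) +
      (thetaA s (-(x * q⁻¹)) * thetaA s (x * q) - thetaA s (x * q⁻¹) * thetaA s (-(x * q))) *
        (thetaB s (x * q) * thetaB s (-(x * q))) =
      2 * q * (thetaB s x * thetaB s (-x) * (thetaA s (-x) * thetaA s (x * (q * q)))) := by
  obtain ⟨t1, t2, t3, t4, t5, t6⟩ := theta_products_twist hs x q
  obtain ⟨p1, p2⟩ := theta_products hs x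
  obtain ⟨p3, p4⟩ := theta_products hs (x * q)
  have hq : (q : K⟦X⟧) ≠ 0 := q.ne_zero
  apply mul_left_cancel₀ hq
  rw [mul_add, ← mul_assoc (q : K⟦X⟧) (_ - _), t4, t1, p2, p3, p4]
  -- After the rewriting both sides carry the factor 2 `thetaB`(-x²) `thetaA`(-1), in nome s²; the
  -- cofactors agree by the fifth product formula.
  linear_combination (-2 * (thetaB (s ^ 2) (-(x * x)) * thetaA (s ^ 2) (-1 : K⟦X⟧ˣ))) * t5

/-- Second addition formula for the four theta functions. -/
theorem theta_crossing_two {s : K⟦X⟧} [CharZero K] (hs : PowerSeries.X ∣ s) (x q : K⟦X⟧ˣ) :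
    (thetaA s (-(x * q⁻¹)) * thetaA s (x * q) + thetaA s (x * q⁻¹) * thetaA s (-(x * q))) *
        (thetaB s (x * q) * thetaB s (-(x * q))) +
      q * (thetaB s (x * q⁻¹) * thetaB s (-(x * q)) - thetaB s (-(x * q⁻¹)) * thetaB s (x * q)) *
        (thetaA s (x * q) * thetaA s (-(x * q))) =
      2 * (thetaA s x * thetaA s (-x) * (thetaB s x * thetaB s (-(x * (q * q))))) := by
  obtain ⟨t1, t2, t3, t4, t5, t6⟩ := theta_products_twist hs x q
  obtain ⟨p1, p2⟩ := theta_products hs x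
  obtain ⟨p3, p4⟩ := theta_products hs (x * q)
  rw [t2, t3, t6, p1, p3, p4]
  ring

end Theta

/-! ### Crossing identities for the theta products. -/

section ThetaProducts

variable {K : Type*} [Field K]

/-- The product `(-s x; s²)_∞ (-s x⁻¹; s²)_∞`. -/
def prodA (s : K⟦X⟧) (x : K⟦X⟧ˣ) : K⟦X⟧ :=
  poch (-(s * (↑x : K⟦X⟧))) (s ^ 2) * poch (-(s * (↑x⁻¹ : K⟦X⟧))) (s ^ 2)

/-- The product `(-x; s²)_∞ (-s² x⁻¹; s²)_∞`. -/
def prodB (s : K⟦X⟧) (x : K⟦X⟧ˣ) : K⟦X⟧ :=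
  poch (-(↑x : K⟦X⟧)) (s ^ 2) * poch (-(s ^ 2 * (↑x⁻¹ : K⟦X⟧))) (s ^ 2)

/-- Each theta series is its product times (s²;s²)_∞. The two crossing identities are homogeneous of
degree four in the series, so the fourth power of that nonzero constant cancels. -/
theorem prod_crossing {s : K⟦X⟧} [CharZero K] (hs : PowerSeries.X ∣ s) (hs0 : s ≠ 0)
    (x q : K⟦X⟧ˣ) :
    ((q : K⟦X⟧) * (prodB s (x * q⁻¹) * prodB s (-(x * q)) + prodB s (-(x * q⁻¹)) * prodB s (x * q)) *
        (prodA s (x * q) * prodA s (-(x * q))) +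
      (prodA s (-(x * q⁻¹)) * prodA s (x * q) - prodA s (x * q⁻¹) * prodA s (-(x * q))) *
        (prodB s (x * q) * prodB s (-(x * q))) =
      2 * q * (prodB s x * prodB s (-x) * (prodA s (-x) * prodA s (x * (q * q))))) ∧
    ((prodA s (-(x * q⁻¹)) * prodA s (x * q) + prodA s (x * q⁻¹) * prodA s (-(x * q))) *
        (prodB s (x * q) * prodB s (-(x * q))) +
      q * (prodB s (x * q⁻¹) * prodB s (-(x * q)) - prodB s (-(x * q⁻¹)) * prodB s (x * q)) *
        (prodA s (x * q) * prodA s (-(x * q))) =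
      2 * (prodA s x * prodA s (-x) * (prodB s x * prodB s (-(x * (q * q)))))) := by
  -- The topology serves only to sum the theta series; the statement about products does not mention
  -- it.
  let : TopologicalSpace K := ⊥
  have : DiscreteTopology K := ⟨rfl⟩
  have hp : PowerSeries.X ∣ s ^ 2 := hs.trans (dvd_pow_self _ two_ne_zero)
  have h1 := theta_crossing_one hs x q
  have h2 := theta_crossing_two hs x q
  have hA : ∀ x, thetaA s x = prodA s x * poch (s ^ 2) (s ^ 2) := thetaA_eq hs hs0
  have hB : ∀ x, thetaB s x = prodB s x * poch (s ^ 2) (s ^ 2) := thetaB_eq hs hs0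
  have hD : poch (s ^ 2) (s ^ 2) ≠ 0 := by
    intro h
    have := constantCoeff_poch_of_dvd hp hp
    rw [h, map_zero] at this
    exact zero_ne_one this
  simp only [hA, hB] at h1 h2
  have hD4 := pow_ne_zero 4 hD
  constructor
  · apply mul_right_cancel₀ hD4
    linear_combination h1
  · apply mul_right_cancel₀ hD4
    linear_combination h2

end ThetaProducts

/-! ### Möbius substitutions and the expansion of f in powers of z/(1 - z). -/

section Moebius

variable {R : Type*} [CommRing R]

/-- The geometric series `(1 - c X)⁻¹`. -/
def geom (c : R) : R⟦X⟧ := PowerSeries.mk fun n => c ^ n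

theorem one_sub_mul_geom (c : R) : (1 - PowerSeries.C c * PowerSeries.X) * geom c = 1 := by
  ext1 n
  cases n with
  | zero => simp [sub_mul, mul_assoc, geom]
  | succ n =>
    rw [sub_mul, mul_assoc, map_sub, PowerSeries.coeff_C_mul, PowerSeries.coeff_succ_X_mul]
    simp [PowerSeries.coeff_one, pow_succ, mul_comm, geom]

/-- The fractional linear series `d X / (1 - c X)`. -/
def moebius (d c : R) : R⟦X⟧ := PowerSeries.C d * PowerSeries.X * geom c

theorem constantCoeff_moebius (d c : R) : PowerSeries.constantCoeff (moebius d c) = 0 := by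
  simp [moebius]

theorem hasSubst_moebius (d c : R) : PowerSeries.HasSubst (moebius d c) :=
  PowerSeries.HasSubst.of_constantCoeff_zero' (constantCoeff_moebius d c)

theorem moebius_mul (d c : R) :
    moebius d c * (1 - PowerSeries.C c * PowerSeries.X) = PowerSeries.C d * PowerSeries.X := by
  rw [moebius, mul_assoc, mul_comm (geom c), one_sub_mul_geom, mul_one]

theorem eq_moebius {a : R⟦X⟧} {d c : R}
    (h : a * (1 - PowerSeries.C c * PowerSeries.X) = PowerSeries.C d * PowerSeries.X) :
    a = moebius d c := by
  rw [moebius, ← h, mul_assoc, one_sub_mul_geom, mul_one]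

theorem substC {a : R⟦X⟧} (r : R) :
    (PowerSeries.C r : R⟦X⟧).subst a = (PowerSeries.C r : R⟦X⟧) :=
  PowerSeries.subst_C r

/-- The series dX/(1 - cX) are the Möbius transformations fixing 0, and they compose like triangular
2 × 2 matrices. -/
theorem subst_moebius (d c d' c' : R) :
    (moebius d' c').subst (moebius d c) = moebius (d' * d) (c + c' * d) := by
  have hs := hasSubst_moebius d c
  apply eq_moebius
  have h := congrArg (PowerSeries.substAlgHom hs) (moebius_mul d' c')
  rw [map_mul, map_mul, map_sub, map_one, map_mul] at h
  simp only [PowerSeries.coe_substAlgHom, PowerSeries.subst_X hs, substC] at h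
  have h2 := moebius_mul d c
  simp only [map_mul, map_add]
  generalize (moebius d' c').subst (moebius d c) = a at *
  generalize moebius d c = m at *
  linear_combination (1 - PowerSeries.C c * PowerSeries.X) * h +
    (PowerSeries.C d' + PowerSeries.C c' * a) * h2

end Moebius

/-- The power series `∑ b_k y^k`. -/
def fBSeries : ℂ⟦X⟧⟦X⟧ := PowerSeries.mk fB

/-- The binomial sum defining `fB` is the coefficient extraction from f(y/(1 + y)), with y/(1 + y)
inverse to z/(1 - z). -/
theorem fBSeries_eq : fBSeries = fSeries.subst (moebius (1 : ℂ⟦X⟧) (-1)) := by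
  ext1 k
  rw [PowerSeries.coeff_subst' (hasSubst_moebius _ _)]
  have hp : ∀ d : ℕ, moebius (1 : ℂ⟦X⟧) (-1) ^ d = PowerSeries.X ^ d * geom (-1) ^ d := fun d => by
    rw [moebius, map_one, one_mul, mul_pow]
  have hg : ∀ d n : ℕ, PowerSeries.coeff n (geom (-1 : ℂ⟦X⟧) ^ (d + 1)) =
      (-1) ^ n * ((d + n).choose d : ℂ⟦X⟧) := by
    intro d n
    have : geom (-1 : ℂ⟦X⟧) = PowerSeries.rescale (-1) (PowerSeries.mk 1) := by
      ext1 n; simp [geom]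
    rw [this, ← map_pow, PowerSeries.mk_one_pow_eq_mk_choose_add, PowerSeries.coeff_rescale,
      PowerSeries.coeff_mk]
  cases k with
  | zero =>
    rw [finsum_eq_single _ 0]
    · simp [fBSeries, fB, fSeries, fCoeff]
    · intro d hd
      rw [hp, PowerSeries.coeff_X_pow_mul', if_neg (by omega), smul_zero]
  | succ k =>
    rw [finsum_eq_sum_of_support_subset (s := (Finset.range (k + 1)).map ⟨Nat.succ, Nat.succ_injective⟩)]
    · rw [Finset.sum_map, fBSeries, PowerSeries.coeff_mk, fB]
      refine Finset.sum_congr rfl fun j hj => ?_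
      have hj : j ≤ k := Nat.lt_succ_iff.1 (Finset.mem_range.1 hj)
      rw [hp, PowerSeries.coeff_X_pow_mul']
      simp only [Function.Embedding.coeFn_mk, Nat.succ_eq_add_one, Nat.add_le_add_iff_right, hj,
        if_true, Nat.add_sub_add_right, fSeries, PowerSeries.coeff_mk, smul_eq_mul]
      rw [hg, Nat.add_sub_cancel' hj, mul_comm (fCoeff _)]
      simp
    · intro d hd
      simp only [Finset.coe_map, Set.mem_image, Finset.mem_coe, Finset.mem_range,
        Function.Embedding.coeFn_mk]
      refine ⟨d - 1, ?_, ?_⟩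
      · by_contra hc
        refine hd ?_
        simp only
        rw [hp, PowerSeries.coeff_X_pow_mul', if_neg (by omega), smul_zero]
      · rcases Nat.eq_zero_or_pos d with rfl | h
        · refine absurd ?_ hd
          simp [PowerSeries.coeff_one]
        · omega

/-- Both sides have constant term 1 and the same logarithmic derivative: with c_n = e^{nh}, the
identity (c_n - 1)/(c_n + 1) · (1 + c_n) - c_n = -1 holds in each degree n ≥ 1. -/
theorem fSeries_mul_rescale : fSeries * PowerSeries.rescale (hExp 1) fSeries *
    (1 - PowerSeries.C (hExp 1) * PowerSeries.X) = 1 - PowerSeries.X := by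
  have h0 := fSeries_spec.1
  apply ode_unique _ _ (- fGen 1)
  · rw [← PowerSeries.coeff_zero_eq_constantCoeff_apply]; simp [fGen]
  · have hr : PowerSeries.constantCoeff (PowerSeries.rescale (hExp 1) fSeries) = 1 := by
      rw [← PowerSeries.coeff_zero_eq_constantCoeff_apply, PowerSeries.coeff_rescale]
      simp [h0]
    rw [map_mul, map_mul, hr, h0]; simp
  · have hT : - fGen 1 = PowerSeries.mk fLog +
        PowerSeries.rescale (hExp 1) (PowerSeries.mk fLog) - fGen (hExp 1) := by
      ext1 n
      have h1 : hExp 1 ^ n = hExp n := by rw [← hExp_nat, mul_one]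
      have ht := fLog_mul n
      simp only [map_sub, map_neg, map_add, fGen, PowerSeries.coeff_mk, PowerSeries.coeff_rescale,
        h1, one_pow]
      by_cases hn : n = 0
      · subst hn; simp [PowerSeries.coeff_one, fLog, hExp]
      · simp only [PowerSeries.coeff_one, hn, if_false]; linear_combination -ht
    rw [zDeriv_mul, zDeriv_mul, zDeriv_lin, zDeriv_rescale, zDeriv_f, map_mul, hT]
    ring
  · have h1 := zDeriv_lin 1
    rw [map_one, one_mul] at h1
    rw [h1]; ring

/-- The relation f(z) f(q²z) (1 - q²z) = 1 - z in the coordinate y = z/(1 - z). There z ↦ q²z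
becomes the Möbius map y ↦ q²y/(1 - (q² - 1)y), and (1 - q²z)/(1 - z) becomes 1 - (q² - 1)y. -/
theorem fBSeries_mul_subst : fBSeries * fBSeries.subst (moebius (hExp 1) (hExp 1 - 1)) *
    (1 - PowerSeries.C (hExp 1 - 1) * PowerSeries.X) = 1 := by
  have hs := hasSubst_moebius (1 : ℂ⟦X⟧) (-1)
  have e : fBSeries.subst (moebius (hExp 1) (hExp 1 - 1)) =
      (PowerSeries.rescale (hExp 1) fSeries).subst (moebius (1 : ℂ⟦X⟧) (-1)) := by
    rw [fBSeries_eq, PowerSeries.subst_comp_subst_apply hs (hasSubst_moebius _ _), subst_moebius,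
      PowerSeries.rescale_eq_subst, PowerSeries.subst_comp_subst_apply
      (PowerSeries.HasSubst.smul_X' _) hs]
    congr 1
    rw [PowerSeries.subst_smul hs, PowerSeries.subst_X hs]
    rw [PowerSeries.smul_eq_C_mul, moebius, moebius, show hExp 1 - 1 + -1 * hExp 1 = -1 by ring]
    simp [mul_assoc]
  rw [e, fBSeries_eq]
  have h := congrArg (PowerSeries.substAlgHom hs) fSeries_mul_rescale
  rw [map_mul, map_mul, map_sub, map_one, map_mul, map_sub, map_one] at h
  simp only [PowerSeries.coe_substAlgHom, PowerSeries.subst_X hs, substC] at h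
  have h2 := moebius_mul (1 : ℂ⟦X⟧) (-1)
  simp only [map_neg, map_one, map_sub] at h2 ⊢
  generalize fSeries.subst (moebius (1 : ℂ⟦X⟧) (-1)) = a at *
  generalize (PowerSeries.rescale (hExp 1) fSeries).subst (moebius (1 : ℂ⟦X⟧) (-1)) = a' at *
  generalize moebius (1 : ℂ⟦X⟧) (-1) = m at *
  linear_combination (1 + PowerSeries.X) * h + (a * a' * PowerSeries.C (hExp 1) - 1) * h2

/-! ### Divisibility of the coefficients b_k by h^k. -/

section Graded

variable {R : Type*} [CommRing R]

/-- The series `∑ c_k y^k` with `t^k ∣ c_k`. -/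
def GradedDvd (t : R) (F : R⟦X⟧) : Prop := ∀ k, t ^ k ∣ PowerSeries.coeff k F

theorem GradedDvd.mul {t : R} {F G : R⟦X⟧} (hF : GradedDvd t F) (hG : GradedDvd t G) :
    GradedDvd t (F * G) := by
  intro k
  rw [PowerSeries.coeff_mul]
  refine Finset.dvd_sum fun ij hij => ?_
  rw [← Finset.HasAntidiagonal.mem_antidiagonal.1 hij, pow_add]
  exact mul_dvd_mul (hF _) (hG _)

theorem GradedDvd.sum {t : R} {ι : Type*} {s : Finset ι} {F : ι → R⟦X⟧}
    (hF : ∀ i ∈ s, GradedDvd t (F i)) : GradedDvd t (∑ i ∈ s, F i) := by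
  intro k
  rw [map_sum]
  exact Finset.dvd_sum fun i hi => hF i hi k

theorem gradedDvd_C (t r : R) : GradedDvd t (PowerSeries.C r) := by
  intro k
  rw [PowerSeries.coeff_C]
  split_ifs with h
  · simp [h]
  · exact dvd_zero _

theorem GradedDvd.pow {t : R} {F : R⟦X⟧} (hF : GradedDvd t F) (n : ℕ) : GradedDvd t (F ^ n) := by
  induction n with
  | zero => rw [pow_zero, ← map_one PowerSeries.C]; exact gradedDvd_C t 1
  | succ n ih => rw [pow_succ]; exact ih.mul hF

theorem gradedDvd_monomial {t r : R} {n : ℕ} (h : t ^ n ∣ r) :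
    GradedDvd t (PowerSeries.C r * PowerSeries.X ^ n) := by
  intro k
  rw [PowerSeries.coeff_C_mul_X_pow]
  split_ifs with hk
  · exact hk ▸ h
  · exact dvd_zero _

theorem gradedDvd_geom {t c : R} (h : t ∣ c) : GradedDvd t (geom c) := fun k => by
  rw [geom, PowerSeries.coeff_mk]; exact pow_dvd_pow_of_dvd h k

/-- If `F · F(d y / (1 - c y)) · (1 - c y) = 1` with `t ∣ c`, `F(0) = 1` and all `1 + d^k`
invertible, then `F` is a series in `t y`. -/
theorem gradedDvd_of_functional_equation {t c d : R} {F : R⟦X⟧} (hc : t ∣ c)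
    (hd : ∀ k : ℕ, IsUnit (1 + d ^ k)) (h0 : PowerSeries.constantCoeff F = 1)
    (h : F * F.subst (moebius d c) * (1 - PowerSeries.C c * PowerSeries.X) = 1) :
    GradedDvd t F := by
  have hs := hasSubst_moebius d c
  intro k
  induction k using Nat.strong_induction_on with
  | _ k ih =>
    rcases Nat.eq_zero_or_pos k with rfl | hk
    · simp
    -- Truncate F below degree k. The coefficient of y^k in the functional equation is then that of
    -- P · P' · l, divisible by t^k by induction, plus (1 + d^k) times the unknown coefficient.
    -- Since k > 0 the sum is zero, and 1 + d^k is invertible.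
    set P : R⟦X⟧ := ∑ j ∈ Finset.range k, PowerSeries.C (PowerSeries.coeff j F) * PowerSeries.X ^ j
      with hP
    obtain ⟨G, hG⟩ : ∃ G, F = P + PowerSeries.X ^ k * G := by
      have : PowerSeries.X ^ k ∣ F - P := by
        rw [PowerSeries.X_pow_dvd_iff]
        intro m hm
        rw [map_sub, hP, map_sum, sub_eq_zero]
        simp only [PowerSeries.coeff_C_mul_X_pow]
        rw [Finset.sum_ite_eq, if_pos (Finset.mem_range.2 hm)]
      obtain ⟨G, hG⟩ := this
      exact ⟨G, by rw [← hG]; ring⟩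
    set P' := ∑ j ∈ Finset.range k, PowerSeries.C (PowerSeries.coeff j F) * moebius d c ^ j with hP'
    have hPs : P.subst (moebius d c) = P' := by
      rw [← PowerSeries.coe_substAlgHom hs, hP, map_sum]
      refine Finset.sum_congr rfl fun j _ => ?_
      rw [map_mul, map_pow]
      simp only [PowerSeries.coe_substAlgHom, PowerSeries.subst_X hs, substC]
    have hPg : GradedDvd t P := GradedDvd.sum fun j hj =>
      gradedDvd_monomial (ih j (Finset.mem_range.1 hj))
    have hPg' : GradedDvd t P' := GradedDvd.sum fun j hj => by
      have e : PowerSeries.C (PowerSeries.coeff j F) * moebius d c ^ j = PowerSeries.C d ^ j *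
          (PowerSeries.C (PowerSeries.coeff j F) * PowerSeries.X ^ j) * geom c ^ j := by
        rw [moebius, mul_pow, mul_pow]; ring
      rw [e]
      exact (((gradedDvd_C t d).pow j).mul
        (gradedDvd_monomial (ih j (Finset.mem_range.1 hj)))).mul ((gradedDvd_geom hc).pow j)
    have hl : GradedDvd t (1 - PowerSeries.C c * PowerSeries.X) := by
      intro m
      rw [map_sub]
      refine dvd_sub (by rw [← map_one PowerSeries.C]; exact gradedDvd_C t 1 m) ?_
      have := gradedDvd_monomial (t := t) (r := c) (n := 1) (by simpa using hc) m
      simpa using this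
    set l := 1 - PowerSeries.C c * PowerSeries.X with hld
    have hFs : F.subst (moebius d c) = P' + moebius d c ^ k * G.subst (moebius d c) := by
      rw [← hPs]
      conv_lhs => rw [hG]
      rw [← PowerSeries.coe_substAlgHom hs, map_add, map_mul, map_pow]
      simp only [PowerSeries.coe_substAlgHom, PowerSeries.subst_X hs]
    have hmk : moebius d c ^ k = PowerSeries.X ^ k * (PowerSeries.C (d ^ k) * geom c ^ k) := by
      rw [moebius, mul_pow, mul_pow, map_pow]; ring
    have hGc : PowerSeries.constantCoeff G = PowerSeries.coeff k F := by
      have := congrArg (PowerSeries.coeff k) hG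
      rw [map_add, PowerSeries.coeff_X_pow_mul', if_pos le_rfl, Nat.sub_self, hP, map_sum] at this
      simp only [PowerSeries.coeff_C_mul_X_pow] at this
      rw [Finset.sum_ite_eq, if_neg (by simp), zero_add] at this
      rw [this, PowerSeries.coeff_zero_eq_constantCoeff_apply]
    have hsc : ∀ H : R⟦X⟧, PowerSeries.constantCoeff (H.subst (moebius d c)) =
        PowerSeries.constantCoeff H := by
      intro H
      obtain ⟨H', hH'⟩ : ∃ H', H = PowerSeries.C (PowerSeries.constantCoeff H) +
          PowerSeries.X * H' := by
        have : PowerSeries.X ∣ H - PowerSeries.C (PowerSeries.constantCoeff H) := by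
          rw [PowerSeries.X_dvd_iff]; simp
        obtain ⟨H', h⟩ := this
        exact ⟨H', by rw [← h]; ring⟩
      conv_lhs => rw [hH']
      rw [← PowerSeries.coe_substAlgHom hs, map_add, map_mul]
      simp only [PowerSeries.coe_substAlgHom, PowerSeries.subst_X hs, substC]
      simp [constantCoeff_moebius]
    have hk1 := congrArg (PowerSeries.coeff k) h
    have hexp : F * F.subst (moebius d c) * l = P * P' * l +
        PowerSeries.X ^ k * (G * F.subst (moebius d c) * l +
          P * (PowerSeries.C (d ^ k) * geom c ^ k) * G.subst (moebius d c) * l) := by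
      linear_combination (F.subst (moebius d c) * l) * hG + P * l * hFs +
        P * l * G.subst (moebius d c) * hmk
    have hP0 : PowerSeries.constantCoeff P = 1 := by
      rw [← h0, hG, map_add, map_mul, map_pow, PowerSeries.constantCoeff_X, zero_pow hk.ne', zero_mul,
        add_zero]
    have hg0 : PowerSeries.constantCoeff (geom c) = 1 := by
      rw [← PowerSeries.coeff_zero_eq_constantCoeff_apply]; simp [geom]
    rw [hexp, map_add, PowerSeries.coeff_X_pow_mul', if_pos le_rfl, Nat.sub_self,
      PowerSeries.coeff_one, if_neg hk.ne', PowerSeries.coeff_zero_eq_constantCoeff_apply] at hk1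
    simp only [map_add, map_mul, map_pow, hGc, hsc, h0, hP0, hg0, hld, map_sub, map_one,
      PowerSeries.constantCoeff_C, PowerSeries.constantCoeff_X, mul_zero, sub_zero, mul_one,
      one_mul, one_pow] at hk1
    have hdv := ((hPg.mul hPg').mul hl) k
    rw [← (hd k).dvd_mul_right]
    rw [show PowerSeries.coeff k F * (1 + d ^ k) = -PowerSeries.coeff k (P * P' * l) by
      rw [hld]; linear_combination hk1]
    exact hdv.neg_right

end Graded

/-- Here t = h, d = q² and c = q² - 1, which is divisible by h; each 1 + q^{2k} has constant term 2.
Consequently f can be evaluated wherever 1 - x is invertible, even if x is not small. -/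
theorem X_pow_dvd_fB (k : ℕ) : (PowerSeries.X : ℂ⟦X⟧) ^ k ∣ fB k := by
  have h := gradedDvd_of_functional_equation (t := (PowerSeries.X : ℂ⟦X⟧)) (F := fBSeries)
    (by rw [PowerSeries.X_dvd_iff, map_sub, hExp_const, map_one, sub_self])
    (fun k => by
      refine isUnit_of_constantCoeff ?_
      rw [map_add, map_one, map_pow, hExp_const, one_pow]
      norm_num)
    (by rw [← PowerSeries.coeff_zero_eq_constantCoeff_apply]; simp [fBSeries, fB])
    fBSeries_mul_subst k
  rwa [fBSeries, PowerSeries.coeff_mk] at h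

theorem fSeries_eq_subst : fSeries = fBSeries.subst (moebius (1 : ℂ⟦X⟧) 1) := by
  rw [fBSeries_eq, PowerSeries.subst_comp_subst_apply (hasSubst_moebius _ _) (hasSubst_moebius _ _),
    subst_moebius]
  have : moebius (1 * 1 : ℂ⟦X⟧) (1 + -1 * 1) = PowerSeries.X := by
    symm
    apply eq_moebius
    simp
  rw [this, PowerSeries.X_subst]

theorem fSeries_trunc_dvd (N : ℕ) : PowerSeries.C ((PowerSeries.X : ℂ⟦X⟧) ^ N) ∣
    fSeries - ∑ k ∈ Finset.range N, PowerSeries.C (fB k) * moebius (1 : ℂ⟦X⟧) 1 ^ k := by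
  have hs := hasSubst_moebius (1 : ℂ⟦X⟧) 1
  have h1 : PowerSeries.C ((PowerSeries.X : ℂ⟦X⟧) ^ N) ∣
      fBSeries - ∑ k ∈ Finset.range N, PowerSeries.C (fB k) * PowerSeries.X ^ k := by
    have : ∀ k, ∃ c, PowerSeries.coeff k
        (fBSeries - ∑ k ∈ Finset.range N, PowerSeries.C (fB k) * PowerSeries.X ^ k) =
        PowerSeries.X ^ N * c := by
      intro k
      rw [map_sub, map_sum, fBSeries, PowerSeries.coeff_mk]
      simp only [PowerSeries.coeff_C_mul_X_pow]
      rw [Finset.sum_ite_eq]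
      split_ifs with h
      · exact ⟨0, by simp⟩
      · rw [sub_zero]
        exact (pow_dvd_pow _ (by simpa using h)).trans (X_pow_dvd_fB k)
    choose c hc using this
    refine ⟨PowerSeries.mk c, ?_⟩
    ext1 k
    rw [hc, PowerSeries.coeff_C_mul, PowerSeries.coeff_mk]
  obtain ⟨G, hG⟩ := h1
  refine ⟨G.subst (moebius (1 : ℂ⟦X⟧) 1), ?_⟩
  have h := congrArg (PowerSeries.substAlgHom hs) hG
  rw [map_sub, map_mul, map_sum] at h
  simp only [map_mul, map_pow, PowerSeries.coe_substAlgHom, PowerSeries.subst_X hs, substC,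
    ← fSeries_eq_subst] at h ⊢
  exact h

/-- The polynomial `∑_{k < N} b_k (d Z)^k (1 - d Z)^{N-k}`. -/
def fBPoly (d : ℂ⟦X⟧) (N : ℕ) : Polynomial ℂ⟦X⟧ :=
  ∑ k ∈ Finset.range N, Polynomial.C (fB k) * (Polynomial.C d * Polynomial.X) ^ k *
    (1 - Polynomial.C d * Polynomial.X) ^ (N - k)

/-- Multiplying the truncated expansion by (1 - dZ)^N clears all denominators, so modulo h^N a
polynomial represents f(dZ). -/
theorem fBPoly_dvd (d : ℂ⟦X⟧) (N : ℕ) : PowerSeries.C ((PowerSeries.X : ℂ⟦X⟧) ^ N) ∣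
    (1 - PowerSeries.C d * PowerSeries.X) ^ N * PowerSeries.rescale d fSeries -
      (fBPoly d N : ℂ⟦X⟧⟦X⟧) := by
  obtain ⟨G, hG⟩ := fSeries_trunc_dvd N
  refine ⟨(1 - PowerSeries.C d * PowerSeries.X) ^ N * PowerSeries.rescale d G, ?_⟩
  have hC : ∀ r : ℂ⟦X⟧, PowerSeries.rescale d (PowerSeries.C r) = PowerSeries.C r := by
    intro r; ext1 n; rw [PowerSeries.coeff_rescale, PowerSeries.coeff_C]; split_ifs with h <;> simp [h]
  have h := congrArg (PowerSeries.rescale d) hG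
  rw [map_sub, map_mul, map_sum, hC] at h
  have hm := congrArg (PowerSeries.rescale d) (moebius_mul (1 : ℂ⟦X⟧) 1)
  have hX : PowerSeries.rescale d PowerSeries.X = PowerSeries.C d * PowerSeries.X := by
    rw [PowerSeries.rescale_X]
  simp only [map_mul, map_sub, map_one, one_mul, hX] at hm
  rw [mul_left_comm, ← h, mul_sub, fBPoly, Finset.mul_sum]
  congr 1
  have hcoe : ∀ p : Polynomial ℂ⟦X⟧, (p : ℂ⟦X⟧⟦X⟧) = Polynomial.coeToPowerSeries.ringHom p :=
    fun p => rfl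
  rw [hcoe, map_sum]
  refine Finset.sum_congr rfl fun k hk => ?_
  rw [map_mul, map_mul, map_pow, map_pow, map_sub, map_mul, map_one]
  simp only [Polynomial.coeToPowerSeries.ringHom_apply, Polynomial.coe_C, Polynomial.coe_X]
  rw [map_mul, map_pow, hC]
  have hN : N = k + (N - k) := by have := Finset.mem_range.1 hk; omega
  conv_rhs => rw [hN, pow_add]
  have hmk : (PowerSeries.C d * PowerSeries.X) ^ k =
      PowerSeries.rescale d (moebius (1 : ℂ⟦X⟧) 1) ^ k *
        (1 - PowerSeries.C d * PowerSeries.X) ^ k := by rw [← mul_pow, hm]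
  linear_combination (PowerSeries.C (fB k) * (1 - PowerSeries.C d * PowerSeries.X) ^ (N - k)) * hmk

/-- The functional equation of f modulo h^N as a congruence of polynomials. Unlike a power series in
Z, a polynomial can be evaluated at any element of K[[h]]. -/
theorem fBPoly_mul_dvd (N : ℕ) : Polynomial.C ((PowerSeries.X : ℂ⟦X⟧) ^ N) ∣
    fBPoly 1 N * fBPoly (hExp 1) N * (1 - Polynomial.C (hExp 1) * Polynomial.X) -
      (1 - Polynomial.X) * ((1 - Polynomial.X) ^ N *
        (1 - Polynomial.C (hExp 1) * Polynomial.X) ^ N) := by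
  rw [Polynomial.C_dvd_iff_dvd_coeff]
  intro n
  rw [← Polynomial.coeff_coe]
  have h1 := fBPoly_dvd 1 N
  have h2 := fBPoly_dvd (hExp 1) N
  rw [PowerSeries.rescale_one] at h1
  simp only [map_one, one_mul, RingHom.id_apply] at h1
  have h3 := dvd_mul_sub_mul' (dvd_mul_sub_mul' (dvd_sub_symm h1) (dvd_sub_symm h2))
    (show PowerSeries.C ((PowerSeries.X : ℂ⟦X⟧) ^ N) ∣ (1 - PowerSeries.C (hExp 1) * PowerSeries.X) -
      (1 - PowerSeries.C (hExp 1) * PowerSeries.X) by simp)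
  have h4 := fSeries_mul_rescale
  obtain ⟨G, hG⟩ := h3
  refine ⟨PowerSeries.coeff n G, ?_⟩
  rw [← PowerSeries.coeff_C_mul, ← hG]
  congr 1
  simp only [Polynomial.coe_sub, Polynomial.coe_mul, Polynomial.coe_pow, Polynomial.coe_one,
    Polynomial.coe_C, Polynomial.coe_X]
  linear_combination ((1 - PowerSeries.X) ^ N * (1 - PowerSeries.C (hExp 1) * PowerSeries.X) ^ N) * h4

/-! ### Evaluation of f at elements of K[[h]]. -/

section Evaluation

variable {K : Type*} [Field K] [Algebra ℂ K]

theorem toK_X : toK K PowerSeries.X = PowerSeries.X := by simp [toK]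

theorem X_pow_dvd_toK {n : ℕ} {r : ℂ⟦X⟧} (h : PowerSeries.X ^ n ∣ r) :
    PowerSeries.X ^ n ∣ toK K r := by
  obtain ⟨c, rfl⟩ := h
  exact ⟨toK K c, by rw [map_mul, map_pow, toK_X]⟩

theorem constantCoeff_toK (r : ℂ⟦X⟧) : PowerSeries.constantCoeff (toK K r) =
    algebraMap ℂ K (PowerSeries.constantCoeff r) := by
  simp only [← PowerSeries.coeff_zero_eq_constantCoeff_apply, toK, PowerSeries.coeff_map]

theorem constantCoeff_toK_hExp (α : ℂ) : PowerSeries.constantCoeff (toK K (hExp α)) = 1 := by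
  rw [constantCoeff_toK, hExp_const, map_one]

/-- `f(x) = ∑_k b_k (x / (1 - x))^k`. -/
def fEval (x : K⟦X⟧) : K⟦X⟧ :=
  PowerSeries.mk fun n => PowerSeries.coeff n
    (∑ k ∈ Finset.range (n + 1), toK K (fB k) * (x * (1 - x)⁻¹) ^ k)

theorem fAt_eq_fEval (ζ : K) : fAt ζ = fEval (PowerSeries.C ζ) := by
  ext n
  rw [fAt, fEval, PowerSeries.coeff_mk, PowerSeries.coeff_mk, map_sum]
  refine Finset.sum_congr rfl fun k _ => ?_
  rw [← map_one PowerSeries.C, ← map_sub, PowerSeries.C_inv, ← map_mul, ← map_pow,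
    PowerSeries.coeff_mul_C, ← div_eq_mul_inv, toK, PowerSeries.coeff_map]

theorem fEval_dvd (x : K⟦X⟧) {M N : ℕ} (h : M ≤ N) : PowerSeries.X ^ M ∣
    fEval x - ∑ k ∈ Finset.range N, toK K (fB k) * (x * (1 - x)⁻¹) ^ k := by
  rw [PowerSeries.X_pow_dvd_iff]
  intro m hm
  rw [map_sub, fEval, PowerSeries.coeff_mk, sub_eq_zero,
    ← Finset.sum_range_add_sum_Ico (n := N) (m := m + 1) _ (by omega), map_add, left_eq_add, map_sum]
  refine Finset.sum_eq_zero fun k hk => ?_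
  exact PowerSeries.X_pow_dvd_iff.1 ((X_pow_dvd_toK (X_pow_dvd_fB k)).mul_right _) m
    (by have := Finset.mem_Ico.1 hk; omega)

theorem fBPoly_eval_dvd (x : K⟦X⟧) (d : ℂ⟦X⟧)
    (hx : 1 - PowerSeries.constantCoeff (toK K d * x) ≠ 0) (N : ℕ) :
    PowerSeries.X ^ N ∣ (1 - toK K d * x) ^ N * fEval (toK K d * x) -
      (fBPoly d N).eval₂ (toK K) x := by
  have h := fEval_dvd (toK K d * x) (le_refl N)
  have e : (fBPoly d N).eval₂ (toK K) x = (1 - toK K d * x) ^ N *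
      ∑ k ∈ Finset.range N, toK K (fB k) * (toK K d * x * (1 - toK K d * x)⁻¹) ^ k := by
    rw [fBPoly, Polynomial.eval₂_finsetSum, Finset.mul_sum]
    refine Finset.sum_congr rfl fun k hk => ?_
    simp only [Polynomial.eval₂_mul, Polynomial.eval₂_pow, Polynomial.eval₂_sub, Polynomial.eval₂_one,
      Polynomial.eval₂_C, Polynomial.eval₂_X]
    have hN : N = k + (N - k) := by have := Finset.mem_range.1 hk; omega
    conv_rhs => rw [hN, pow_add]
    have hi : (1 - toK K d * x) ^ k * ((1 - toK K d * x)⁻¹) ^ k = 1 := by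
      rw [← mul_pow, PowerSeries.mul_inv_cancel, one_pow]
      rwa [map_sub, map_one]
    rw [mul_pow _ (_⁻¹)]
    linear_combination (-toK K (fB k) * (toK K d * x) ^ k * (1 - toK K d * x) ^ (N - k)) * hi
  rw [e, ← mul_sub]
  exact h.mul_left _

/-- Modulo h^N this is the polynomial congruence evaluated at x. The cleared denominators (1 - x)^N
(1 - q²x)^N are units, because x has constant term different from 1. -/
theorem fEval_mul (x : K⟦X⟧) (h1 : PowerSeries.constantCoeff x ≠ 1) :
    fEval x * fEval (toK K (hExp 1) * x) * (1 - toK K (hExp 1) * x) = 1 - x := by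
  have hx1 : 1 - PowerSeries.constantCoeff (toK K 1 * x) ≠ 0 := by
    rw [map_one, one_mul]; exact sub_ne_zero.2 h1.symm
  have hx2 : 1 - PowerSeries.constantCoeff (toK K (hExp 1) * x) ≠ 0 := by
    rw [map_mul, constantCoeff_toK_hExp, one_mul]; exact sub_ne_zero.2 h1.symm
  refine eq_of_forall_X_pow_dvd fun N => ?_
  have e1 := fBPoly_eval_dvd x 1 hx1 N
  have e2 := fBPoly_eval_dvd x (hExp 1) hx2 N
  rw [map_one, one_mul] at e1 hx1
  have e3 : PowerSeries.X ^ N ∣ (fBPoly 1 N).eval₂ (toK K) x * (fBPoly (hExp 1) N).eval₂ (toK K) x *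
      (1 - toK K (hExp 1) * x) - (1 - x) * ((1 - x) ^ N * (1 - toK K (hExp 1) * x) ^ N) := by
    obtain ⟨G, hG⟩ := fBPoly_mul_dvd N
    have h := congrArg (Polynomial.eval₂ (toK K) x) hG
    simp only [Polynomial.eval₂_mul, Polynomial.eval₂_pow, Polynomial.eval₂_sub, Polynomial.eval₂_one,
      Polynomial.eval₂_C, Polynomial.eval₂_X, map_pow, toK_X] at h
    exact ⟨_, h⟩
  have e4 := dvd_mul_sub_mul' (dvd_mul_sub_mul' e1 e2)
    (show PowerSeries.X ^ N ∣ (1 - toK K (hExp 1) * x) - (1 - toK K (hExp 1) * x) by simp)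
  have e5 := X_pow_dvd_trans e4 e3
  have hu : IsUnit ((1 - x) ^ N * (1 - toK K (hExp 1) * x) ^ N) :=
    ((isUnit_of_constantCoeff (by rwa [map_sub, map_one])).pow N).mul
      ((isUnit_of_constantCoeff (by rwa [map_sub, map_one])).pow N)
  rw [← hu.dvd_mul_left]
  refine e5.trans (dvd_of_eq ?_)
  ring

theorem fSub_dvd {x : K⟦X⟧} (hx : PowerSeries.X ∣ x) {M N : ℕ} (h : M ≤ N) : PowerSeries.X ^ M ∣
    fSub x - ∑ k ∈ Finset.range N, toK K (fCoeff k) * x ^ k := by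
  rw [PowerSeries.X_pow_dvd_iff]
  intro m hm
  rw [map_sub, fSub, PowerSeries.coeff_mk, sub_eq_zero,
    ← Finset.sum_range_add_sum_Ico (n := N) (m := m + 1) _ (by omega), map_add, left_eq_add, map_sum]
  refine Finset.sum_eq_zero fun k hk => ?_
  exact PowerSeries.X_pow_dvd_iff.1 ((pow_dvd_pow_of_dvd hx k).mul_left _) m
    (by have := Finset.mem_Ico.1 hk; omega)

theorem fSub_sub_one_dvd {x : K⟦X⟧} {k : ℕ} (hx : PowerSeries.X ^ (k + 1) ∣ x) :
    PowerSeries.X ^ k ∣ fSub x - 1 := by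
  have hx1 : PowerSeries.X ∣ x := (dvd_pow_self _ (Nat.succ_ne_zero k)).trans hx
  have h := fSub_dvd hx1 (show k ≤ k + 1 by omega)
  rw [Finset.sum_range_succ'] at h
  refine X_pow_dvd_trans h ?_
  simp only [fCoeff, map_one, pow_zero, mul_one, add_sub_cancel_right]
  refine Finset.dvd_sum fun i _ => ?_
  rw [pow_succ]
  exact (((pow_dvd_pow _ (Nat.le_succ k)).trans hx).mul_left _).mul_left _

/-- For x divisible by h the series f(x) converges directly. Truncation in degree N turns the
functional equation into a polynomial congruence modulo Z^N, which is then evaluated at x. -/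
theorem fSub_mul {x : K⟦X⟧} (hx : PowerSeries.X ∣ x) :
    fSub x * fSub (toK K (hExp 1) * x) * (1 - toK K (hExp 1) * x) = 1 - x := by
  refine eq_of_forall_X_pow_dvd fun N => ?_
  set P : ℂ⟦X⟧ → Polynomial ℂ⟦X⟧ := fun d => ∑ k ∈ Finset.range N, Polynomial.C (fCoeff k) *
    (Polynomial.C d * Polynomial.X) ^ k with hP
  have hcoe : ∀ p : Polynomial ℂ⟦X⟧, (p : ℂ⟦X⟧⟦X⟧) = Polynomial.coeToPowerSeries.ringHom p :=
    fun p => rfl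
  have h1 : ∀ d, PowerSeries.X ^ N ∣ (P d : ℂ⟦X⟧⟦X⟧) - PowerSeries.rescale d fSeries := by
    intro d
    rw [PowerSeries.X_pow_dvd_iff]
    intro m hm
    rw [map_sub, sub_eq_zero, Polynomial.coeff_coe, hP, PowerSeries.coeff_rescale, fSeries,
      PowerSeries.coeff_mk]
    simp only [Polynomial.finsetSum_coeff, mul_pow, ← Polynomial.C_pow, ← mul_assoc,
      ← Polynomial.C_mul, Polynomial.coeff_C_mul_X_pow]
    rw [Finset.sum_ite_eq, if_pos (Finset.mem_range.2 hm), mul_comm]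
  have h2 : Polynomial.X ^ N ∣ P 1 * P (hExp 1) * (1 - Polynomial.C (hExp 1) * Polynomial.X) -
      (1 - Polynomial.X) := by
    rw [Polynomial.X_pow_dvd_iff]
    intro m hm
    rw [← Polynomial.coeff_coe]
    have := dvd_mul_sub_mul' (dvd_mul_sub_mul' (h1 1) (h1 (hExp 1)))
      (show PowerSeries.X ^ N ∣ (1 - PowerSeries.C (hExp 1) * PowerSeries.X) -
        (1 - PowerSeries.C (hExp 1) * PowerSeries.X) by simp)
    rw [PowerSeries.rescale_one, RingHom.id_apply, fSeries_mul_rescale] at this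
    simp only [Polynomial.coe_sub, Polynomial.coe_mul, Polynomial.coe_one,
      Polynomial.coe_C, Polynomial.coe_X]
    exact PowerSeries.X_pow_dvd_iff.1 this m hm
  have h3 : ∀ d, PowerSeries.X ^ N ∣ fSub (toK K d * x) - (P d).eval₂ (toK K) x := by
    intro d
    have := fSub_dvd (hx.mul_left (toK K d)) (le_refl N)
    rw [hP, Polynomial.eval₂_finsetSum]
    simpa only [Polynomial.eval₂_mul, Polynomial.eval₂_pow, Polynomial.eval₂_C,
      Polynomial.eval₂_X] using this
  have h4 := dvd_mul_sub_mul' (dvd_mul_sub_mul' (h3 1) (h3 (hExp 1)))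
    (show PowerSeries.X ^ N ∣ (1 - toK K (hExp 1) * x) - (1 - toK K (hExp 1) * x) by simp)
  rw [map_one, one_mul] at h4
  refine X_pow_dvd_trans h4 ?_
  obtain ⟨G, hG⟩ := h2
  have h := congrArg (Polynomial.eval₂ (toK K) x) hG
  simp only [Polynomial.eval₂_mul, Polynomial.eval₂_pow, Polynomial.eval₂_sub, Polynomial.eval₂_one,
      Polynomial.eval₂_C, Polynomial.eval₂_X] at h
  rw [h]
  exact (pow_dvd_pow_of_dvd hx N).mul_right _

end Evaluation

/-! ### Factorization of (x²; s²)_∞. -/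

section PochSquare

variable {K : Type*} [Field K]

/-- Factor 1 - x² s^{2k} as (1 - x s^k)(1 + x s^k) and separate even and odd k. -/
theorem poch_sq {s : K⟦X⟧} (hs : PowerSeries.X ∣ s) (x : K⟦X⟧) :
    poch (x ^ 2) (s ^ 2) = poch x (s ^ 2) * poch (-x) (s ^ 2) *
      (poch (s * x) (s ^ 2) * poch (-(s * x)) (s ^ 2)) := by
  have hp : PowerSeries.X ∣ s ^ 2 := hs.trans (dvd_pow_self _ two_ne_zero)
  refine eq_of_forall_X_pow_dvd fun M => ?_
  refine X_pow_dvd_trans (poch_dvd hp (show M ≤ 2 * M by omega)) (dvd_sub_symm ?_)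
  have e : ∀ M : ℕ, (∏ k ∈ Finset.range M, (1 - x * (s ^ 2) ^ k)) *
      (∏ k ∈ Finset.range M, (1 - -x * (s ^ 2) ^ k)) *
      ((∏ k ∈ Finset.range M, (1 - s * x * (s ^ 2) ^ k)) *
        ∏ k ∈ Finset.range M, (1 - -(s * x) * (s ^ 2) ^ k)) =
      ∏ k ∈ Finset.range (2 * M), (1 - x ^ 2 * (s ^ 2) ^ k) := by
    intro M
    induction M with
    | zero => simp
    | succ M ih =>
      rw [show 2 * (M + 1) = 2 * M + 1 + 1 by ring]
      simp only [Finset.prod_range_succ]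
      rw [← ih]
      ring
  rw [← e]
  exact dvd_mul_sub_mul' (dvd_mul_sub_mul' (poch_dvd hp le_rfl) (poch_dvd hp le_rfl))
    (dvd_mul_sub_mul' (poch_dvd hp le_rfl) (poch_dvd hp le_rfl))

end PochSquare

/-! ### Crossing symmetry of a + d and b + c. -/

section Crossing

variable {K : Type*} [Field K] [Algebra ℂ K]

/-- The series `∏_{k ≥ 1} f(p^k x²)`, where `p = s²`. -/
def fInf (s : ℂ⟦X⟧) (x : K⟦X⟧) : K⟦X⟧ :=
  infProd fun k => fSub (toK K (s ^ 2) ^ (k + 1) * x ^ 2)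

/-- The series `α(x)` for `x ∈ K[[h]]`. -/
def alphaEval (s : ℂ⟦X⟧) (x : K⟦X⟧) : K⟦X⟧ :=
  poch (toK K (s * hExp (1 / 2)) * x) (toK K (s ^ 2)) *
    (poch (toK K (s * hExp (-1 / 2)) * x) (toK K (s ^ 2)))⁻¹ * fInf s x

/-- The series `β(x)` for `x ∈ K[[h]]`. -/
def betaEval (s : ℂ⟦X⟧) (x : K⟦X⟧) : K⟦X⟧ :=
  poch (-(toK K (s ^ 2 * hExp (1 / 2)) * x)) (toK K (s ^ 2)) *
    (poch (-(toK K (s ^ 2 * hExp (-1 / 2)) * x)) (toK K (s ^ 2)))⁻¹ * fInf s x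

/-- The series `a(x) + d(x)` for a unit `x` of `K[[h]]`. -/
def sumADEval (s : ℂ⟦X⟧) (x : K⟦X⟧ˣ) : K⟦X⟧ :=
  toK K (hExp (-1 / 4)) * (fEval ((x : K⟦X⟧) ^ 2))⁻¹ * alphaEval s (↑x⁻¹ : K⟦X⟧) *
    (alphaEval s (x : K⟦X⟧))⁻¹

/-- The series `b(x) + c(x)` for a unit `x` of `K[[h]]`. -/
def sumBCEval (s : ℂ⟦X⟧) (x : K⟦X⟧ˣ) : K⟦X⟧ :=
  toK K (hExp (1 / 4)) * (fEval ((x : K⟦X⟧) ^ 2))⁻¹ * (1 + toK K (hExp (-1 / 2)) * (x : K⟦X⟧)) *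
    (1 + toK K (hExp (1 / 2)) * (x : K⟦X⟧))⁻¹ * betaEval s (↑x⁻¹ : K⟦X⟧) *
      (betaEval s (x : K⟦X⟧))⁻¹

/-- A nonzero element of `K` as a unit of `K[[h]]`. -/
def constUnit (ζ : K) (hζ : ζ ≠ 0) : K⟦X⟧ˣ := Units.map PowerSeries.C.toMonoidHom (Units.mk0 ζ hζ)

omit [Algebra ℂ K] in
theorem coe_constUnit (ζ : K) (hζ : ζ ≠ 0) : (constUnit ζ hζ : K⟦X⟧) = PowerSeries.C ζ := rfl

omit [Algebra ℂ K] in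
theorem coe_constUnit_inv (ζ : K) (hζ : ζ ≠ 0) :
    (↑(constUnit ζ hζ)⁻¹ : K⟦X⟧) = PowerSeries.C ζ⁻¹ := rfl

theorem alphaAt_eq (s : ℂ⟦X⟧) (ζ : K) : alphaAt s ζ = alphaEval s (PowerSeries.C ζ) := by
  rw [alphaAt, alphaEval, fInf, map_pow PowerSeries.C]

theorem betaAt_eq (s : ℂ⟦X⟧) (ζ : K) : betaAt s ζ = betaEval s (PowerSeries.C ζ) := by
  rw [betaAt, betaEval, fInf, map_pow PowerSeries.C]

/-- Crossing compares the arguments ζ and qζ, and qζ lies in K[[h]] rather than in K. The functions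
are therefore treated at units of K[[h]]. -/
theorem sumAD_eq (s : ℂ⟦X⟧) (ζ : K) (hζ : ζ ≠ 0) : sumAD s ζ = sumADEval s (constUnit ζ hζ) := by
  rw [sumAD, sumADEval, coe_constUnit, coe_constUnit_inv, alphaAt_eq, alphaAt_eq, fAt_eq_fEval,
    map_pow]

theorem sumBC_eq (s : ℂ⟦X⟧) (ζ : K) (hζ : ζ ≠ 0) : sumBC s ζ = sumBCEval s (constUnit ζ hζ) := by
  rw [sumBC, sumBCEval, coe_constUnit, coe_constUnit_inv, betaAt_eq, betaAt_eq, fAt_eq_fEval,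
    map_pow]

/-- `q = e^{h/2}` as a unit of `K[[h]]`. -/
def qUnit (K : Type*) [Field K] [Algebra ℂ K] : K⟦X⟧ˣ where
  val := toK K (hExp (1 / 2))
  inv := toK K (hExp (-1 / 2))
  val_inv := by rw [← map_mul, ← hExp_add, add_comm]; norm_num [hExp]
  inv_val := by rw [← map_mul, ← hExp_add, add_comm]; norm_num [hExp]

theorem coe_qUnit : (qUnit K : K⟦X⟧) = toK K (hExp (1 / 2)) := rfl

theorem coe_qUnit_inv : (↑(qUnit K)⁻¹ : K⟦X⟧) = toK K (hExp (-1 / 2)) := rfl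

theorem qUnit_sq : (qUnit K : K⟦X⟧) ^ 2 = toK K (hExp 1) := by
  rw [coe_qUnit, ← map_pow, pow_two, ← hExp_add]; norm_num

theorem X_dvd_toK {r : ℂ⟦X⟧} (h : PowerSeries.X ∣ r) : PowerSeries.X ∣ toK K r := by
  simpa using X_pow_dvd_toK (K := K) (n := 1) (by simpa using h)

variable {s : ℂ⟦X⟧}

theorem fInf_factor (hs : PowerSeries.X ∣ s) (x : K⟦X⟧) (k : ℕ) :
    PowerSeries.X ^ (k + 1) ∣ toK K (s ^ 2) ^ (k + 1) * x ^ 2 := by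
  have hp : PowerSeries.X ∣ toK K (s ^ 2) := X_dvd_toK (hs.trans (dvd_pow_self _ two_ne_zero))
  exact (pow_dvd_pow_of_dvd hp _).mul_right _

/-- Multiply the functional equations of f at p^k x² over k ≥ 1; the right sides assemble into two
Pochhammer products. -/
theorem fInf_mul (hs : PowerSeries.X ∣ s) (x : K⟦X⟧) :
    fInf s x * fInf s (x * (qUnit K : K⟦X⟧)) * poch (toK K (s ^ 2) * (x * (qUnit K : K⟦X⟧)) ^ 2) (toK K (s ^ 2)) =
      poch (toK K (s ^ 2) * x ^ 2) (toK K (s ^ 2)) := by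
  have hp : PowerSeries.X ∣ toK K (s ^ 2) := X_dvd_toK (hs.trans (dvd_pow_self _ two_ne_zero))
  have h1 : ∀ (x : K⟦X⟧) (k : ℕ), PowerSeries.X ^ k ∣ fSub (toK K (s ^ 2) ^ (k + 1) * x ^ 2) - 1 :=
    fun x k => fSub_sub_one_dvd (fInf_factor hs x k)
  rw [fInf, fInf, poch, poch, ← infProd_mul _ _ (h1 _) (h1 _), ← infProd_mul]
  · congr 1
    funext k
    have := fSub_mul (K := K) (x := toK K (s ^ 2) ^ (k + 1) * x ^ 2)
      ((dvd_pow_self _ (Nat.succ_ne_zero k)).trans (fInf_factor hs x k))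
    rw [← qUnit_sq] at this
    rw [show toK K (s ^ 2) ^ (k + 1) * (x * (qUnit K : K⟦X⟧)) ^ 2 =
      (qUnit K : K⟦X⟧) ^ 2 * (toK K (s ^ 2) ^ (k + 1) * x ^ 2) by ring,
      show toK K (s ^ 2) * (x * (qUnit K : K⟦X⟧)) ^ 2 * toK K (s ^ 2) ^ k =
      (qUnit K : K⟦X⟧) ^ 2 * (toK K (s ^ 2) ^ (k + 1) * x ^ 2) by ring, this]
    ring
  · intro k
    simpa using dvd_mul_sub_mul' (h1 x k) (h1 (x * (qUnit K : K⟦X⟧)) k)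
  · exact X_pow_dvd_poch_factor hp

/-- The scalar factor common to `a + d` and `b + c`. -/
def scalarFactor (s : ℂ⟦X⟧) (x : K⟦X⟧ˣ) : K⟦X⟧ :=
  (fEval ((x : K⟦X⟧) ^ 2))⁻¹ * fInf s (↑x⁻¹ : K⟦X⟧) * (fInf s (x : K⟦X⟧))⁻¹

theorem scalarFactor_neg (x : K⟦X⟧ˣ) : scalarFactor s (-x) = scalarFactor s x := by
  simp [scalarFactor, fInf]

theorem constantCoeff_fInf (hs : PowerSeries.X ∣ s) (x : K⟦X⟧) :
    PowerSeries.constantCoeff (fInf s x) = 1 := by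
  have h1 : ∀ (x : K⟦X⟧) (k : ℕ), PowerSeries.X ^ k ∣ fSub (toK K (s ^ 2) ^ (k + 1) * x ^ 2) - 1 :=
    fun x k => fSub_sub_one_dvd (fInf_factor hs x k)
  have h := X_pow_dvd_infProd_sub _ (h1 x) (le_refl 1)
  rw [Finset.prod_range_one, pow_one] at h
  have h2 := fSub_dvd (show PowerSeries.X ∣ toK K (s ^ 2) ^ (0 + 1) * x ^ 2 by
    simpa using fInf_factor hs x 0) (le_refl 1)
  rw [pow_one] at h2
  have h3 := X_pow_dvd_trans h h2
  rw [PowerSeries.X_dvd_iff, map_sub, sub_eq_zero] at h3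
  rw [fInf, h3]
  simp [fCoeff]

theorem constantCoeff_fEval (x : K⟦X⟧) : PowerSeries.constantCoeff (fEval x) = 1 := by
  have h := fEval_dvd x (le_refl 1)
  rw [pow_one, PowerSeries.X_dvd_iff, map_sub, sub_eq_zero] at h
  rw [h]
  simp [fB]

/-- The product `(x²; p)_∞ (p x⁻²; p)_∞`. -/
def prodTheta (s : K⟦X⟧) (x : K⟦X⟧ˣ) : K⟦X⟧ := prodB s x * prodB s (-x) * (prodA s x * prodA s (-x))

omit [Algebra ℂ K] in
theorem prodTheta_eq {s : K⟦X⟧} (hs : PowerSeries.X ∣ s) (x : K⟦X⟧ˣ) :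
    prodTheta s x = poch ((x : K⟦X⟧) ^ 2) (s ^ 2) * poch (s ^ 2 * (↑x⁻¹ : K⟦X⟧) ^ 2) (s ^ 2) := by
  rw [← mul_pow, poch_sq hs, poch_sq hs, prodTheta, prodB, prodB, prodA, prodA, inv_neg,
    Units.val_neg, Units.val_neg, ← mul_assoc s s, ← pow_two]
  simp only [mul_neg, neg_neg]
  ring

/-- Combine the functional equation of f at x² with that of the product over k ≥ 1 at x and at
(xq)⁻¹. The linear factors 1 - x² and 1 - (xq)² supply the k = 0 terms missing from the Pochhammer
products. The hypothesis on x keeps f(x²) away from its singularity. -/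
theorem scalarFactor_mul (hs : PowerSeries.X ∣ s) (x : K⟦X⟧ˣ)
    (hx : PowerSeries.constantCoeff (x : K⟦X⟧) ^ 2 ≠ 1) :
    scalarFactor s x * scalarFactor s (x * qUnit K) * prodTheta (toK K s) x =
      prodTheta (toK K s) (x * qUnit K) := by
  have hS : PowerSeries.X ∣ toK K s := X_dvd_toK hs
  have hp : PowerSeries.X ∣ toK K s ^ 2 := hS.trans (dvd_pow_self _ two_ne_zero)
  rw [prodTheta_eq hS, prodTheta_eq hS, poch_eq_mul (x := (x : K⟦X⟧) ^ 2) hp,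
    poch_eq_mul (x := ((x * qUnit K : K⟦X⟧ˣ) : K⟦X⟧) ^ 2) hp,
    mul_comm ((x : K⟦X⟧) ^ 2) (toK K s ^ 2),
    mul_comm (((x * qUnit K : K⟦X⟧ˣ) : K⟦X⟧) ^ 2) (toK K s ^ 2)]
  have h1 := fEval_mul (K := K) ((x : K⟦X⟧) ^ 2) (by rwa [map_pow])
  rw [← qUnit_sq, ← mul_pow, mul_comm (qUnit K : K⟦X⟧), ← Units.val_mul] at h1
  have h2 := fInf_mul hs (x : K⟦X⟧)
  have h3 := fInf_mul hs (↑(x * qUnit K)⁻¹ : K⟦X⟧)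
  rw [← Units.val_mul] at h2 h3
  rw [map_pow] at h2 h3
  rw [show (x * qUnit K)⁻¹ * qUnit K = x⁻¹ by rw [mul_inv_rev, mul_comm, ← mul_assoc,
    mul_inv_cancel, one_mul]] at h3
  have i1 := PowerSeries.inv_mul_cancel (fEval ((x : K⟦X⟧) ^ 2))
    (by rw [constantCoeff_fEval]; exact one_ne_zero)
  have i2 := PowerSeries.inv_mul_cancel (fEval (((x * qUnit K : K⟦X⟧ˣ) : K⟦X⟧) ^ 2))
    (by rw [constantCoeff_fEval]; exact one_ne_zero)
  have i3 := PowerSeries.inv_mul_cancel (fInf s (x : K⟦X⟧))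
    (by rw [constantCoeff_fInf hs]; exact one_ne_zero)
  have i4 := PowerSeries.inv_mul_cancel (fInf s ((x * qUnit K : K⟦X⟧ˣ) : K⟦X⟧))
    (by rw [constantCoeff_fInf hs]; exact one_ne_zero)
  rw [scalarFactor, scalarFactor]
  generalize (fEval ((x : K⟦X⟧) ^ 2))⁻¹ = a1 at *
  generalize (fEval (((x * qUnit K : K⟦X⟧ˣ) : K⟦X⟧) ^ 2))⁻¹ = a2 at *
  generalize (fInf s (x : K⟦X⟧))⁻¹ = a3 at *
  generalize (fInf s ((x * qUnit K : K⟦X⟧ˣ) : K⟦X⟧))⁻¹ = a4 at *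
  rw [← h1, ← h2, ← h3]
  generalize fEval ((x : K⟦X⟧) ^ 2) = b1 at *
  generalize fEval (((x * qUnit K : K⟦X⟧ˣ) : K⟦X⟧) ^ 2) = b2 at *
  generalize fInf s (x : K⟦X⟧) = b3 at *
  generalize fInf s ((x * qUnit K : K⟦X⟧ˣ) : K⟦X⟧) = b4 at *
  generalize poch (toK K s ^ 2 * ((x * qUnit K : K⟦X⟧ˣ) : K⟦X⟧) ^ 2) (toK K s ^ 2) = P at *
  generalize poch (toK K s ^ 2 * (↑x⁻¹ : K⟦X⟧) ^ 2) (toK K s ^ 2) = P' at *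
  generalize fInf s (↑x⁻¹ : K⟦X⟧) = c1 at *
  generalize fInf s (↑(x * qUnit K)⁻¹ : K⟦X⟧) = c2 at *
  generalize ((x * qUnit K : K⟦X⟧ˣ) : K⟦X⟧) ^ 2 = y at *
  have : a1 * c1 * a3 * (a2 * c2 * a4) * (b1 * b2 * (1 - y) * (b3 * b4 * P) * P') =
    (a1 * b1) * (a2 * b2) * (a3 * b3) * (a4 * b4) * ((1 - y) * P * (c2 * c1 * P')) := by ring
  rw [this, i1, i2, i3, i4]
  ring

omit [Algebra ℂ K] in
theorem constantCoeff_prodA {s : K⟦X⟧} (hs : PowerSeries.X ∣ s) (x : K⟦X⟧ˣ) :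
    PowerSeries.constantCoeff (prodA s x) = 1 := by
  have hp : PowerSeries.X ∣ s ^ 2 := hs.trans (dvd_pow_self _ two_ne_zero)
  rw [prodA, map_mul, constantCoeff_poch_of_dvd (dvd_neg.2 (hs.mul_right _)) hp,
    constantCoeff_poch_of_dvd (dvd_neg.2 (hs.mul_right _)) hp, one_mul]

omit [Algebra ℂ K] in
theorem constantCoeff_prodB {s : K⟦X⟧} (hs : PowerSeries.X ∣ s) (x : K⟦X⟧ˣ) :
    PowerSeries.constantCoeff (prodB s x) = 1 + PowerSeries.constantCoeff (x : K⟦X⟧) := by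
  have hp : PowerSeries.X ∣ s ^ 2 := hs.trans (dvd_pow_self _ two_ne_zero)
  rw [prodB, map_mul, constantCoeff_poch hp, constantCoeff_poch_of_dvd (dvd_neg.2 (hp.mul_right _)) hp,
    map_neg, mul_one, sub_neg_eq_add]

omit [Algebra ℂ K] in
theorem inv_mul_inv_mul {a b c : K⟦X⟧} (ha : PowerSeries.constantCoeff a ≠ 0)
    (hb : PowerSeries.constantCoeff b ≠ 0) (hc : PowerSeries.constantCoeff c ≠ 0) :
    (a * b⁻¹ * c)⁻¹ * a = b * c⁻¹ := by
  have h1 := PowerSeries.inv_mul_cancel (a * b⁻¹ * c) (by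
    rw [map_mul, map_mul, PowerSeries.constantCoeff_inv]
    exact mul_ne_zero (mul_ne_zero ha (inv_ne_zero hb)) hc)
  have h2 := PowerSeries.mul_inv_cancel b hb
  have h3 := PowerSeries.mul_inv_cancel c hc
  generalize (a * b⁻¹ * c)⁻¹ = J at *
  linear_combination (b * c⁻¹) * h1 - J * a * c * c⁻¹ * h2 - J * a * h3

/-- In α(x⁻¹)/α(x) the four Pochhammer factors pair up into the quotient of `prodA` at -x q⁻¹ by
`prodA` at -xq. -/
theorem sumADEval_mul (hs : PowerSeries.X ∣ s) (x : K⟦X⟧ˣ) :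
    sumADEval s x * prodA (toK K s) (-(x * qUnit K)) =
      toK K (hExp (-1 / 4)) * scalarFactor s x * prodA (toK K s) (-(x * (qUnit K)⁻¹)) := by
  have hS : PowerSeries.X ∣ toK K s := X_dvd_toK hs
  have hp : PowerSeries.X ∣ toK K s ^ 2 := hS.trans (dvd_pow_self _ two_ne_zero)
  have hc : ∀ (r : ℂ⟦X⟧) (y : K⟦X⟧),
      PowerSeries.constantCoeff (poch (toK K (s * r) * y) (toK K s ^ 2)) ≠ 0 := fun r y => by
    rw [constantCoeff_poch_of_dvd ((X_dvd_toK (hs.mul_right _)).mul_right _) hp]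
    exact one_ne_zero
  have e1 : prodA (toK K s) (-(x * qUnit K)) =
      poch (toK K (s * hExp (1 / 2)) * (x : K⟦X⟧)) (toK K s ^ 2) *
      poch (toK K (s * hExp (-1 / 2)) * (↑x⁻¹ : K⟦X⟧)) (toK K s ^ 2) := by
    rw [prodA, map_mul, map_mul, ← coe_qUnit, ← coe_qUnit_inv, inv_neg, mul_inv_rev]
    push_cast
    congr 2 <;> ring
  have e2 : prodA (toK K s) (-(x * (qUnit K)⁻¹)) =
      poch (toK K (s * hExp (-1 / 2)) * (x : K⟦X⟧)) (toK K s ^ 2) *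
      poch (toK K (s * hExp (1 / 2)) * (↑x⁻¹ : K⟦X⟧)) (toK K s ^ 2) := by
    rw [prodA, map_mul, map_mul, ← coe_qUnit, ← coe_qUnit_inv, inv_neg, mul_inv_rev, inv_inv]
    push_cast
    congr 2 <;> ring
  rw [e1, e2, sumADEval, alphaEval, alphaEval, scalarFactor, map_pow]
  have h1 := inv_mul_inv_mul (hc (hExp (1 / 2)) x) (hc (hExp (-1 / 2)) x)
    (c := fInf s (x : K⟦X⟧)) (by rw [constantCoeff_fInf hs]; exact one_ne_zero)
  have h2 := PowerSeries.mul_inv_cancel _ (hc (hExp (-1 / 2)) (↑x⁻¹ : K⟦X⟧))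
  generalize (poch (toK K (s * hExp (1 / 2)) * (x : K⟦X⟧)) (toK K s ^ 2) *
    (poch (toK K (s * hExp (-1 / 2)) * (x : K⟦X⟧)) (toK K s ^ 2))⁻¹ * fInf s (x : K⟦X⟧))⁻¹ = J at *
  generalize poch (toK K (s * hExp (1 / 2)) * (x : K⟦X⟧)) (toK K s ^ 2) = P3 at *
  generalize poch (toK K (s * hExp (-1 / 2)) * (x : K⟦X⟧)) (toK K s ^ 2) = P4 at *
  generalize poch (toK K (s * hExp (1 / 2)) * (↑x⁻¹ : K⟦X⟧)) (toK K s ^ 2) = P1 at *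
  generalize poch (toK K (s * hExp (-1 / 2)) * (↑x⁻¹ : K⟦X⟧)) (toK K s ^ 2) = P2 at *
  generalize (fEval ((x : K⟦X⟧) ^ 2))⁻¹ = E at *
  generalize toK K (hExp (-1 / 4)) = r at *
  linear_combination (r * E * P1 * fInf s (↑x⁻¹ : K⟦X⟧) * P2 * P2⁻¹) * h1 +
    (r * E * P1 * fInf s (↑x⁻¹ : K⟦X⟧) * (P4 * (fInf s (x : K⟦X⟧))⁻¹)) * h2

/-- The rational prefactor (1 + q⁻¹x)/(1 + qx) supplies the k = 0 terms that β lacks, so that the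
Pochhammer factors form the quotient of `prodB` at x q⁻¹ by `prodB` at xq. -/
theorem sumBCEval_mul (hs : PowerSeries.X ∣ s) (x : K⟦X⟧ˣ)
    (hx : PowerSeries.constantCoeff (x : K⟦X⟧) ≠ -1) :
    sumBCEval s x * prodB (toK K s) (x * qUnit K) =
      toK K (hExp (1 / 4)) * scalarFactor s x * prodB (toK K s) (x * (qUnit K)⁻¹) := by
  have hS : PowerSeries.X ∣ toK K s := X_dvd_toK hs
  have hp : PowerSeries.X ∣ toK K s ^ 2 := hS.trans (dvd_pow_self _ two_ne_zero)
  have hp' : PowerSeries.X ∣ s ^ 2 := hs.trans (dvd_pow_self _ two_ne_zero)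
  have hc : ∀ (r : ℂ⟦X⟧) (y : K⟦X⟧),
      PowerSeries.constantCoeff (poch (-(toK K (s ^ 2 * r) * y)) (toK K s ^ 2)) ≠ 0 := fun r y => by
    rw [constantCoeff_poch_of_dvd (dvd_neg.2 ((X_dvd_toK (hp'.mul_right _)).mul_right _)) hp]
    exact one_ne_zero
  have e1 : prodB (toK K s) (x * qUnit K) =
      (1 + toK K (hExp (1 / 2)) * (x : K⟦X⟧)) * poch (-(toK K (s ^ 2 * hExp (1 / 2)) * (x : K⟦X⟧))) (toK K s ^ 2) *
      poch (-(toK K (s ^ 2 * hExp (-1 / 2)) * (↑x⁻¹ : K⟦X⟧))) (toK K s ^ 2) := by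
    rw [prodB, poch_eq_mul hp, map_mul, map_mul, ← coe_qUnit, ← coe_qUnit_inv, mul_inv_rev, map_pow]
    push_cast
    congr 2
    · ring
    · congr 1; ring
    · ring
  have e2 : prodB (toK K s) (x * (qUnit K)⁻¹) =
      (1 + toK K (hExp (-1 / 2)) * (x : K⟦X⟧)) * poch (-(toK K (s ^ 2 * hExp (-1 / 2)) * (x : K⟦X⟧))) (toK K s ^ 2) *
      poch (-(toK K (s ^ 2 * hExp (1 / 2)) * (↑x⁻¹ : K⟦X⟧))) (toK K s ^ 2) := by
    rw [prodB, poch_eq_mul hp, map_mul, map_mul, ← coe_qUnit, ← coe_qUnit_inv, mul_inv_rev, inv_inv,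
      map_pow]
    push_cast
    congr 2
    · ring
    · congr 1; ring
    · ring
  rw [e1, e2, sumBCEval, betaEval, betaEval, scalarFactor, map_pow]
  have h1 := inv_mul_inv_mul (hc (hExp (1 / 2)) x) (hc (hExp (-1 / 2)) x)
    (c := fInf s (x : K⟦X⟧)) (by rw [constantCoeff_fInf hs]; exact one_ne_zero)
  have h2 := PowerSeries.mul_inv_cancel _ (hc (hExp (-1 / 2)) (↑x⁻¹ : K⟦X⟧))
  have h3 := PowerSeries.inv_mul_cancel (1 + toK K (hExp (1 / 2)) * (x : K⟦X⟧)) (by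
    rw [map_add, map_one, map_mul, constantCoeff_toK_hExp, one_mul]
    intro h
    exact hx (eq_neg_of_add_eq_zero_right h))
  generalize (poch (-(toK K (s ^ 2 * hExp (1 / 2)) * (x : K⟦X⟧))) (toK K s ^ 2) *
    (poch (-(toK K (s ^ 2 * hExp (-1 / 2)) * (x : K⟦X⟧))) (toK K s ^ 2))⁻¹ *
      fInf s (x : K⟦X⟧))⁻¹ = J at *
  generalize poch (-(toK K (s ^ 2 * hExp (1 / 2)) * (x : K⟦X⟧))) (toK K s ^ 2) = P3 at *
  generalize poch (-(toK K (s ^ 2 * hExp (-1 / 2)) * (x : K⟦X⟧))) (toK K s ^ 2) = P4 at *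
  generalize poch (-(toK K (s ^ 2 * hExp (1 / 2)) * (↑x⁻¹ : K⟦X⟧))) (toK K s ^ 2) = P1 at *
  generalize poch (-(toK K (s ^ 2 * hExp (-1 / 2)) * (↑x⁻¹ : K⟦X⟧))) (toK K s ^ 2) = P2 at *
  generalize (fEval ((x : K⟦X⟧) ^ 2))⁻¹ = E at *
  generalize toK K (hExp (1 / 4)) = r at *
  generalize (1 + toK K (hExp (1 / 2)) * (x : K⟦X⟧))⁻¹ = u at *
  generalize 1 + toK K (hExp (1 / 2)) * (x : K⟦X⟧) = v at *
  generalize 1 + toK K (hExp (-1 / 2)) * (x : K⟦X⟧) = v' at *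
  linear_combination (r * E * v' * P1 * fInf s (↑x⁻¹ : K⟦X⟧) * P2 * P2⁻¹ * u * v) * h1 +
    (r * E * v' * P1 * fInf s (↑x⁻¹ : K⟦X⟧) * (P4 * (fInf s (x : K⟦X⟧))⁻¹) * u * v) * h2 +
    (r * E * v' * P1 * fInf s (↑x⁻¹ : K⟦X⟧) * (P4 * (fInf s (x : K⟦X⟧))⁻¹)) * h3

/-- In terms of even and odd parts these are (b + d)(x) (a - d)(qx) = 1 and (a + c)(x) (b - c)(qx) =
1, up to the factor 2. After inserting the theta quotients, `prod_crossing` evaluates the first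
factor, and the scalar factors cancel by `scalarFactor_mul`. -/
theorem crossing (hs : PowerSeries.X ∣ s) (hs0 : s ≠ 0) (x : K⟦X⟧ˣ)
    (hx : PowerSeries.constantCoeff (x : K⟦X⟧) ^ 2 ≠ 1) :
    (sumBCEval s x + sumBCEval s (-x) + sumADEval s x - sumADEval s (-x)) *
      sumADEval s (-(x * qUnit K)) = 2 ∧
    (sumADEval s x + sumADEval s (-x) + sumBCEval s x - sumBCEval s (-x)) *
      sumBCEval s (-(x * qUnit K)) = 2 := by
  have : CharZero K := charZero_of_injective_algebraMap (algebraMap ℂ K).injective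
  have hS : PowerSeries.X ∣ toK K s := X_dvd_toK hs
  have hS0 : toK K s ≠ 0 := by
    intro h
    apply hs0
    ext n
    have := congrArg (PowerSeries.coeff n) h
    rw [toK, PowerSeries.coeff_map, map_zero, map_eq_zero] at this
    rw [this, map_zero]
  have hxn : PowerSeries.constantCoeff (x : K⟦X⟧) ≠ -1 := fun h => hx (by rw [h]; norm_num)
  have hxp : PowerSeries.constantCoeff (x : K⟦X⟧) ≠ 1 := fun h => hx (by rw [h]; norm_num)
  have hxn' : PowerSeries.constantCoeff ((-x : K⟦X⟧ˣ) : K⟦X⟧) ≠ -1 := by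
    rw [Units.val_neg, map_neg]; exact fun h => hxp (neg_injective h)
  have hq1 : PowerSeries.constantCoeff (qUnit K : K⟦X⟧) = 1 := by
    rw [coe_qUnit, constantCoeff_toK_hExp]
  have hxq : PowerSeries.constantCoeff ((x * qUnit K : K⟦X⟧ˣ) : K⟦X⟧) =
      PowerSeries.constantCoeff (x : K⟦X⟧) := by
    rw [Units.val_mul, map_mul, hq1, mul_one]
  have hxqn : PowerSeries.constantCoeff ((-(x * qUnit K) : K⟦X⟧ˣ) : K⟦X⟧) ≠ -1 := by
    rw [Units.val_neg, map_neg, hxq]; exact fun h => hxp (neg_injective h)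
  have ne : ∀ {y : K⟦X⟧}, PowerSeries.constantCoeff y ≠ 0 → y ≠ 0 := fun h h' => h (by simp [h'])
  have hA : ∀ y, prodA (toK K s) y ≠ 0 := fun y => ne (by
    rw [constantCoeff_prodA hS]; exact one_ne_zero)
  have hB : ∀ y : K⟦X⟧ˣ, PowerSeries.constantCoeff (y : K⟦X⟧) ≠ -1 → prodB (toK K s) y ≠ 0 :=
    fun y hy => ne (by
      rw [constantCoeff_prodB hS]
      intro h
      exact hy (eq_neg_of_add_eq_zero_right h))
  obtain ⟨c1, c2⟩ := prod_crossing hS hS0 x (qUnit K)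
  have d1 := sumADEval_mul hs x
  have d2 := sumADEval_mul hs (-x)
  have d3 := sumBCEval_mul hs x hxn
  have d4 := sumBCEval_mul hs (-x) hxn'
  have d5 := sumADEval_mul hs (-(x * qUnit K))
  have d6 := sumBCEval_mul hs (-(x * qUnit K)) hxqn
  have d7 := scalarFactor_mul hs x hx
  rw [neg_mul, neg_mul, neg_neg, neg_neg, scalarFactor_neg] at d2 d5
  rw [neg_mul, neg_mul, scalarFactor_neg] at d4 d6
  rw [mul_assoc x, mul_assoc x, mul_inv_cancel, mul_one] at d5 d6
  rw [prodTheta, prodTheta] at d7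
  have hr : toK K (hExp (-1 / 4)) * toK K (hExp (1 / 4)) = 1 := by
    rw [← map_mul, ← hExp_add]; norm_num [hExp]
  have hr2 : toK K (hExp (1 / 4)) ^ 2 = qUnit K := by
    rw [coe_qUnit, ← map_pow, pow_two, ← hExp_add]; norm_num
  have n1 := hB x hxn
  have n2 := hB (-x) hxn'
  have n3 := hA x
  have n4 := hA (-x)
  have n5 := hB (x * qUnit K) (by rwa [hxq])
  have n6 := hB (-(x * qUnit K)) hxqn
  have n7 := hA (x * qUnit K)
  have n8 := hA (-(x * qUnit K))
  have n9 := hA (x * (qUnit K * qUnit K))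
  have n10 := hB (-(x * (qUnit K * qUnit K))) (by
    rw [← mul_assoc, Units.val_neg, map_neg, Units.val_mul, map_mul, hxq, hq1, mul_one]
    exact fun h => hxp (neg_injective h))
  have hq := (qUnit K).ne_zero
  -- The prefactors q^{1/2} of b + c and q^{-1/2} of a + d differ by the q that weights the `prodB`
  -- terms in the addition formulas.
  have hrq : toK K (hExp (1 / 4)) = toK K (hExp (-1 / 4)) * qUnit K := by
    linear_combination -toK K (hExp (1 / 4)) * hr + toK K (hExp (-1 / 4)) * hr2
  generalize (qUnit K : K⟦X⟧) = Q at *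
  generalize toK K (hExp (-1 / 4)) = r' at *
  generalize toK K (hExp (1 / 4)) = r at *
  generalize prodB (toK K s) x = B at *
  generalize prodB (toK K s) (-x) = B' at *
  generalize prodA (toK K s) x = A at *
  generalize prodA (toK K s) (-x) = A' at *
  generalize prodB (toK K s) (x * qUnit K) = Bq at *
  generalize prodB (toK K s) (-(x * qUnit K)) = Bq' at *
  generalize prodA (toK K s) (x * qUnit K) = Aq at *
  generalize prodA (toK K s) (-(x * qUnit K)) = Aq' at *
  generalize prodB (toK K s) (x * (qUnit K)⁻¹) = Bi at *
  generalize prodB (toK K s) (-(x * (qUnit K)⁻¹)) = Bi' at *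
  generalize prodA (toK K s) (x * (qUnit K)⁻¹) = Ai at *
  generalize prodA (toK K s) (-(x * (qUnit K)⁻¹)) = Ai' at *
  generalize prodA (toK K s) (x * (qUnit K * qUnit K)) = A3 at *
  generalize prodB (toK K s) (-(x * (qUnit K * qUnit K))) = B3 at *
  generalize scalarFactor s x = F at *
  generalize scalarFactor s (x * qUnit K) = F' at *
  generalize sumADEval s x = s1 at *
  generalize sumADEval s (-x) = s2 at *
  generalize sumBCEval s x = t1 at *
  generalize sumBCEval s (-x) = t2 at *
  generalize sumADEval s (-(x * qUnit K)) = s3 at *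
  generalize sumBCEval s (-(x * qUnit K)) = t3 at *
  -- The multiplier is `prodTheta` at xq, a common denominator of the four quotients on the left.
  have E1 : (t1 + t2 + s1 - s2) * (Bq * Bq' * (Aq * Aq')) =
      F * r' * (2 * Q * (B * B' * (A' * A3))) := by
    linear_combination (Bq' * Aq * Aq') * d3 + (Bq * Aq * Aq') * d4 + (Bq * Bq' * Aq) * d1 -
      (Bq * Bq' * Aq') * d2 + F * (Bi * Bq' + Bi' * Bq) * Aq * Aq' * hrq + F * r' * c1
  have E2 : (s1 + s2 + t1 - t2) * (Bq * Bq' * (Aq * Aq')) =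
      F * r' * (2 * (A * A' * (B * B3))) := by
    linear_combination (Bq' * Aq * Aq') * d3 - (Bq * Aq * Aq') * d4 + (Bq * Bq' * Aq) * d1 +
      (Bq * Bq' * Aq') * d2 + F * (Bi * Bq' - Bi' * Bq) * Aq * Aq' * hrq + F * r' * c2
  have hθ1 := mul_ne_zero (mul_ne_zero n5 n6) (mul_ne_zero n7 n8)
  have hθ0 := mul_ne_zero (mul_ne_zero n1 n2) (mul_ne_zero n3 n4)
  constructor
  · apply mul_right_cancel₀ (mul_ne_zero (mul_ne_zero hθ1 n9) hθ0)
    generalize Bq * Bq' * (Aq * Aq') = θ1 at *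
    linear_combination (s3 * A3 * (B * B' * (A * A'))) * E1 +
      (F * r' * (2 * Q * (B * B' * (A' * A3))) * (B * B' * (A * A'))) * d5 +
      (2 * Q * r' ^ 2 * A3 * (B * B' * (A * A'))) * d7 +
      (2 * A3 * (B * B' * (A * A')) * θ1) * (hr - r' * hrq)
  · apply mul_right_cancel₀ (mul_ne_zero (mul_ne_zero hθ1 n10) hθ0)
    generalize Bq * Bq' * (Aq * Aq') = θ1 at *
    linear_combination (t3 * B3 * (B * B' * (A * A'))) * E2 +
      (F * r' * (2 * (A * A' * (B * B3))) * (B * B' * (A * A'))) * d6 +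
      (2 * r' * r * B3 * (B * B' * (A * A'))) * d7 +
      (2 * B3 * (B * B' * (A * A')) * θ1) * hr

end Crossing

/-! ### Coefficients in ℂ((t))[[h]] and the shift t ↦ t e^{-h/2}. -/

theorem laurent_coeff_mul (x y : LaurentSeries ℂ) (m : ℤ) (F : Finset ℤ)
    (hF : ∀ r, x.coeff r ≠ 0 → y.coeff (m - r) ≠ 0 → r ∈ F) :
    (x * y).coeff m = ∑ r ∈ F, x.coeff r * y.coeff (m - r) := by
  rw [HahnSeries.coeff_mul, ← Finset.sum_filter_of_ne (s := F)
    (p := fun r => x.coeff r ≠ 0 ∧ y.coeff (m - r) ≠ 0)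
    (fun r _ h => ⟨left_ne_zero_of_mul h, right_ne_zero_of_mul h⟩)]
  refine Finset.sum_bij (fun ij _ => ij.1) ?_ ?_ ?_ ?_
  · rintro ⟨i, j⟩ hij
    have h : x.coeff i ≠ 0 ∧ y.coeff j ≠ 0 ∧ i + j = m := by simpa using hij
    obtain ⟨h1, h2, rfl⟩ := h
    have h3 : i + j - i = j := by ring
    rw [Finset.mem_filter]
    exact ⟨hF i h1 (by rwa [h3]), h1, by rwa [h3]⟩
  · rintro ⟨i, j⟩ hij ⟨i', j'⟩ hij' (h : i = i')
    have h1 : x.coeff i ≠ 0 ∧ y.coeff j ≠ 0 ∧ i + j = m := by simpa using hij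
    have h2 : x.coeff i' ≠ 0 ∧ y.coeff j' ≠ 0 ∧ i' + j' = m := by simpa using hij'
    rw [Prod.mk.injEq]
    exact ⟨h, by omega⟩
  · intro r hr
    obtain ⟨_, h1, h2⟩ := Finset.mem_filter.1 hr
    exact ⟨(r, m - r), by simpa using ⟨h1, h2⟩, rfl⟩
  · rintro ⟨i, j⟩ hij
    have h : x.coeff i ≠ 0 ∧ y.coeff j ≠ 0 ∧ i + j = m := by simpa using hij
    have h3 : m - i = j := by omega
    simp only [h3]

/-- The lower bound of the t-exponents may depend on the power of h, so the convolution over r is an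
infinite, h-adically convergent sum. Modulo h^M only finitely many r contribute. -/
theorem lcoeff_mul (x y : (LaurentSeries ℂ)⟦X⟧) (m : ℤ) (M : ℕ) : ∃ F : Finset ℤ, ∀ F', F ⊆ F' →
    PowerSeries.X ^ M ∣ lcoeff m (x * y) - ∑ r ∈ F', lcoeff r x * lcoeff (m - r) y := by
  classical
  refine ⟨(Finset.range M ×ˢ Finset.range M).biUnion fun ij =>
    (Finset.antidiagonal (PowerSeries.coeff ij.1 x).isPWO_support
      (PowerSeries.coeff ij.2 y).isPWO_support m).image Prod.fst, fun F' hF' => ?_⟩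
  rw [PowerSeries.X_pow_dvd_iff]
  intro n hn
  rw [map_sub, map_sum, sub_eq_zero, lcoeff, PowerSeries.coeff_mk, PowerSeries.coeff_mul,
    HahnSeries.coeff_sum]
  simp_rw [PowerSeries.coeff_mul]
  rw [Finset.sum_comm]
  refine Finset.sum_congr rfl fun ij hij => ?_
  have hij := Finset.HasAntidiagonal.mem_antidiagonal.1 hij
  simp only [lcoeff, PowerSeries.coeff_mk]
  refine laurent_coeff_mul _ _ _ _ fun r h1 h2 => hF' ?_
  rw [Finset.mem_biUnion]
  refine ⟨ij, Finset.mem_product.2 ⟨Finset.mem_range.2 (by omega), Finset.mem_range.2 (by omega)⟩, ?_⟩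
  rw [Finset.mem_image]
  exact ⟨(r, m - r), by simpa using ⟨h1, h2⟩, rfl⟩

theorem lcoeff_ext {x y : (LaurentSeries ℂ)⟦X⟧} (h : ∀ m, lcoeff m x = lcoeff m y) : x = y := by
  ext n m
  simpa [lcoeff] using congrArg (PowerSeries.coeff n) (h m)

theorem lcoeff_add (m : ℤ) (x y : (LaurentSeries ℂ)⟦X⟧) :
    lcoeff m (x + y) = lcoeff m x + lcoeff m y := by
  ext n; simp [lcoeff]

theorem lcoeff_zero (m : ℤ) : lcoeff m 0 = 0 := by
  ext n; simp [lcoeff]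

theorem algebraMap_laurentSeries (c : ℂ) : algebraMap ℂ (LaurentSeries ℂ) c = HahnSeries.C c := by
  rw [HahnSeries.algebraMap_apply']
  exact HahnSeries.ofPowerSeries_C c

theorem lcoeff_toK_mul (m : ℤ) (r : ℂ⟦X⟧) (x : (LaurentSeries ℂ)⟦X⟧) :
    lcoeff m (toK (LaurentSeries ℂ) r * x) = r * lcoeff m x := by
  ext n
  rw [lcoeff, PowerSeries.coeff_mk, PowerSeries.coeff_mul, PowerSeries.coeff_mul,
    HahnSeries.coeff_sum]
  refine Finset.sum_congr rfl fun ij _ => ?_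
  rw [toK, PowerSeries.coeff_map, lcoeff, PowerSeries.coeff_mk, algebraMap_laurentSeries,
    HahnSeries.C_mul_eq_smul]
  rfl

theorem lcoeff_C_single (m k : ℤ) : lcoeff m (PowerSeries.C (HahnSeries.single k (1 : ℂ))) =
    if m = k then 1 else 0 := by
  ext n
  rw [lcoeff, PowerSeries.coeff_mk, PowerSeries.coeff_C]
  split_ifs with h1 h2 h2
  · subst h1 h2; simp
  · simp [HahnSeries.coeff_single_of_ne h2]
  · simp [PowerSeries.coeff_one, h1]
  · simp

/-- The automorphism `t ↦ t e^{-h/2}` of `ℂ((t))[[h]]`, as a function. -/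
def twistFun (x : (LaurentSeries ℂ)⟦X⟧) : (LaurentSeries ℂ)⟦X⟧ :=
  PowerSeries.mk fun n =>
    { coeff := fun m => PowerSeries.coeff n (hExp (-(m : ℂ) / 2) * lcoeff m x)
      isPWO_support' := by
        have : Set.IsPWO (⋃ i ∈ Finset.range (n + 1), (PowerSeries.coeff i x).support) :=
          (Finset.isPWO_bUnion _).2 fun i _ => (PowerSeries.coeff i x).isPWO_support
        refine this.mono fun m hm => ?_
        by_contra hc
        refine hm ?_
        show PowerSeries.coeff n (hExp (-(m : ℂ) / 2) * lcoeff m x) = 0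
        rw [PowerSeries.coeff_mul]
        refine Finset.sum_eq_zero fun ij hij => ?_
        have hij := Finset.HasAntidiagonal.mem_antidiagonal.1 hij
        have : (PowerSeries.coeff ij.2 x).coeff m = 0 := by
          by_contra h
          exact hc (Set.mem_biUnion (x := ij.2) (by simp; omega) h)
        simp [lcoeff, this] }

theorem lcoeff_twistFun (m : ℤ) (x : (LaurentSeries ℂ)⟦X⟧) :
    lcoeff m (twistFun x) = hExp (-(m : ℂ) / 2) * lcoeff m x := by
  ext n; simp [lcoeff, twistFun]

theorem single_zero_eq_one : (PowerSeries.C (HahnSeries.single (0 : ℤ) (1 : ℂ))) =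
    (1 : (LaurentSeries ℂ)⟦X⟧) := by
  rw [← map_one PowerSeries.C]; rfl

theorem hExp_zero : hExp 0 = 1 := by simp [hExp]

/-- The automorphism `t ↦ t e^{-h/2}` of `ℂ((t))[[h]]`. -/
def twist : (LaurentSeries ℂ)⟦X⟧ →+* (LaurentSeries ℂ)⟦X⟧ where
  toFun := twistFun
  map_zero' := lcoeff_ext fun m => by rw [lcoeff_twistFun, lcoeff_zero, mul_zero]
  map_add' x y := lcoeff_ext fun m => by
    rw [lcoeff_twistFun, lcoeff_add, lcoeff_add, mul_add, lcoeff_twistFun, lcoeff_twistFun]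
  map_one' := lcoeff_ext fun m => by
    rw [lcoeff_twistFun, ← single_zero_eq_one, lcoeff_C_single]
    split_ifs with h
    · subst h; simp [hExp_zero]
    · rw [mul_zero]
  -- The weight e^{-mh/2} is multiplicative along m = r + (m - r); the convolution is compared
  -- modulo each h^M.
  map_mul' x y := lcoeff_ext fun m => by
    refine eq_of_forall_X_pow_dvd fun M => ?_
    obtain ⟨F, hF⟩ := lcoeff_mul x y m M
    obtain ⟨G, hG⟩ := lcoeff_mul (twistFun x) (twistFun y) m M
    have h1 := hF (F ∪ G) Finset.subset_union_left
    have h2 := hG (F ∪ G) Finset.subset_union_right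
    have e : ∑ r ∈ F ∪ G, lcoeff r (twistFun x) * lcoeff (m - r) (twistFun y) =
        hExp (-(m : ℂ) / 2) * ∑ r ∈ F ∪ G, lcoeff r x * lcoeff (m - r) y := by
      rw [Finset.mul_sum]
      refine Finset.sum_congr rfl fun r _ => ?_
      rw [lcoeff_twistFun, lcoeff_twistFun, show -(m : ℂ) / 2 = -(r : ℂ) / 2 + -((m - r : ℤ) : ℂ) / 2
        by push_cast; ring, hExp_add]
      ring
    rw [lcoeff_twistFun]
    rw [e] at h2
    refine X_pow_dvd_trans ?_ (dvd_sub_symm h2)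
    rw [← mul_sub]
    exact h1.mul_left _

theorem lcoeff_twist (m : ℤ) (x : (LaurentSeries ℂ)⟦X⟧) :
    lcoeff m (twist x) = hExp (-(m : ℂ) / 2) * lcoeff m x := lcoeff_twistFun m x

theorem twist_toK (r : ℂ⟦X⟧) : twist (toK (LaurentSeries ℂ) r) = toK (LaurentSeries ℂ) r := by
  refine lcoeff_ext fun m => ?_
  rw [lcoeff_twist, ← mul_one (toK _ r), lcoeff_toK_mul, ← single_zero_eq_one, lcoeff_C_single]
  split_ifs with h
  · subst h; simp [hExp_zero]
  · simp

theorem lvar_inv : lvar⁻¹ = HahnSeries.single (-1) 1 := by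
  rw [lvar, HahnSeries.inv_single, inv_one]

/-- With z = t⁻¹ the automorphism is z ↦ qz, so it carries out the crossing shift inside the
expansion at z = ∞. -/
theorem twist_C_lvar_inv : twist (PowerSeries.C lvar⁻¹) =
    toK (LaurentSeries ℂ) (hExp (1 / 2)) * PowerSeries.C lvar⁻¹ := by
  refine lcoeff_ext fun m => ?_
  rw [lcoeff_twist, lcoeff_toK_mul, lvar_inv, lcoeff_C_single]
  split_ifs with h
  · subst h; norm_num
  · simp

theorem X_pow_dvd_twist {M : ℕ} {x y : (LaurentSeries ℂ)⟦X⟧} (h : PowerSeries.X ^ M ∣ x - y) :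
    PowerSeries.X ^ M ∣ twist x - twist y := by
  obtain ⟨c, hc⟩ := h
  refine ⟨twist c, ?_⟩
  rw [← map_sub, hc, map_mul, map_pow, ← toK_X, twist_toK]

theorem X_dvd_twist {x : (LaurentSeries ℂ)⟦X⟧} (h : PowerSeries.X ∣ x) :
    PowerSeries.X ∣ twist x := by
  simpa using X_pow_dvd_twist (M := 1) (x := x) (y := 0) (by simpa using h)

theorem twist_inv {x : (LaurentSeries ℂ)⟦X⟧} (h : PowerSeries.constantCoeff x ≠ 0) :
    twist x⁻¹ = (twist x)⁻¹ := by
  have h1 : twist x⁻¹ * twist x = 1 := by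
    rw [← map_mul, PowerSeries.inv_mul_cancel _ h, map_one]
  rw [PowerSeries.eq_inv_iff_mul_eq_one _ , h1]
  intro h2
  have := congrArg PowerSeries.constantCoeff h1
  rw [map_mul, h2, mul_zero, map_one] at this
  exact zero_ne_one this

/-- The automorphism fixes h, hence preserves congruences modulo h^M and passes through h-adic
limits. The compatibility with `fSub` and `fEval` has the same reason. -/
theorem twist_infProd (u : ℕ → (LaurentSeries ℂ)⟦X⟧) (hu : ∀ k, PowerSeries.X ^ k ∣ u k - 1) :
    twist (infProd u) = infProd fun k => twist (u k) := by
  have hu' : ∀ k, PowerSeries.X ^ k ∣ twist (u k) - 1 := fun k => by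
    simpa using X_pow_dvd_twist (hu k)
  refine eq_of_forall_X_pow_dvd fun M => ?_
  refine X_pow_dvd_trans (X_pow_dvd_twist (X_pow_dvd_infProd_sub _ hu (le_refl M))) ?_
  rw [map_prod]
  exact dvd_sub_symm (X_pow_dvd_infProd_sub _ hu' le_rfl)

theorem twist_poch {p : (LaurentSeries ℂ)⟦X⟧} (x : (LaurentSeries ℂ)⟦X⟧) (hp : PowerSeries.X ∣ p) :
    twist (poch x p) = poch (twist x) (twist p) := by
  rw [poch, twist_infProd _ (X_pow_dvd_poch_factor hp), poch]
  simp

theorem twist_fSub {x : (LaurentSeries ℂ)⟦X⟧} (hx : PowerSeries.X ∣ x) :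
    twist (fSub x) = fSub (twist x) := by
  refine eq_of_forall_X_pow_dvd fun M => ?_
  refine X_pow_dvd_trans (X_pow_dvd_twist (fSub_dvd hx (le_refl M))) ?_
  simp only [map_sum, map_mul, map_pow, twist_toK]
  exact dvd_sub_symm (fSub_dvd (X_dvd_twist hx) le_rfl)

theorem twist_fEval {x : (LaurentSeries ℂ)⟦X⟧} (hx : PowerSeries.constantCoeff x ≠ 1) :
    twist (fEval x) = fEval (twist x) := by
  refine eq_of_forall_X_pow_dvd fun M => ?_
  refine X_pow_dvd_trans (X_pow_dvd_twist (fEval_dvd x (le_refl M))) ?_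
  have h := twist_inv (x := 1 - x) (by rw [map_sub, map_one]; exact sub_ne_zero.2 hx.symm)
  rw [map_sub, map_one] at h
  simp only [map_sum, map_mul, map_pow, twist_toK, h]
  exact dvd_sub_symm (fEval_dvd _ le_rfl)

/-! ### Crossing symmetry of the R-matrix. -/

section

variable {s : ℂ⟦X⟧}

theorem twist_fInf (hs : PowerSeries.X ∣ s) (x : (LaurentSeries ℂ)⟦X⟧) :
    twist (fInf s x) = fInf s (twist x) := by
  rw [fInf, twist_infProd _ fun k => fSub_sub_one_dvd (fInf_factor hs x k), fInf]
  congr 1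
  funext k
  rw [twist_fSub ((dvd_pow_self _ (Nat.succ_ne_zero k)).trans (fInf_factor hs x k)), map_mul twist,
    map_pow twist, map_pow twist, twist_toK]

theorem twist_alphaEval (hs : PowerSeries.X ∣ s) (x : (LaurentSeries ℂ)⟦X⟧) :
    PowerSeries.constantCoeff (alphaEval s x) ≠ 0 ∧
      twist (alphaEval s x) = alphaEval s (twist x) := by
  have hp : PowerSeries.X ∣ toK (LaurentSeries ℂ) (s ^ 2) :=
    X_dvd_toK (hs.trans (dvd_pow_self _ two_ne_zero))
  have hc : ∀ (r : ℂ⟦X⟧), PowerSeries.constantCoeff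
      (poch (toK (LaurentSeries ℂ) (s * r) * x) (toK (LaurentSeries ℂ) (s ^ 2))) = 1 := fun r =>
    constantCoeff_poch_of_dvd ((X_dvd_toK (hs.mul_right _)).mul_right _) hp
  constructor
  · rw [alphaEval, map_mul, map_mul, PowerSeries.constantCoeff_inv, hc, hc, constantCoeff_fInf hs]
    simp
  · rw [alphaEval, map_mul, map_mul, twist_inv (by rw [hc]; exact one_ne_zero), twist_poch _ hp,
      twist_poch _ hp, twist_fInf hs, map_mul twist, map_mul twist, twist_toK, twist_toK, twist_toK,
      alphaEval]

theorem twist_betaEval (hs : PowerSeries.X ∣ s) (x : (LaurentSeries ℂ)⟦X⟧) :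
    PowerSeries.constantCoeff (betaEval s x) ≠ 0 ∧
      twist (betaEval s x) = betaEval s (twist x) := by
  have hp' : PowerSeries.X ∣ s ^ 2 := hs.trans (dvd_pow_self _ two_ne_zero)
  have hp : PowerSeries.X ∣ toK (LaurentSeries ℂ) (s ^ 2) := X_dvd_toK hp'
  have hc : ∀ (r : ℂ⟦X⟧), PowerSeries.constantCoeff
      (poch (-(toK (LaurentSeries ℂ) (s ^ 2 * r) * x)) (toK (LaurentSeries ℂ) (s ^ 2))) = 1 := fun r =>
    constantCoeff_poch_of_dvd (dvd_neg.2 ((X_dvd_toK (hp'.mul_right _)).mul_right _)) hp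
  constructor
  · rw [betaEval, map_mul, map_mul, PowerSeries.constantCoeff_inv, hc, hc, constantCoeff_fInf hs]
    simp
  · rw [betaEval, map_mul, map_mul, twist_inv (by rw [hc]; exact one_ne_zero), twist_poch _ hp,
      twist_poch _ hp, twist_fInf hs, map_neg twist, map_neg twist, map_mul twist, map_mul twist,
      twist_toK, twist_toK, twist_toK, betaEval]

theorem twist_sumADEval (hs : PowerSeries.X ∣ s) (x : (LaurentSeries ℂ)⟦X⟧ˣ)
    (hx : PowerSeries.constantCoeff (x : (LaurentSeries ℂ)⟦X⟧) ^ 2 ≠ 1) :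
    twist (sumADEval s x) = sumADEval s (Units.map twist.toMonoidHom x) := by
  rw [sumADEval, map_mul, map_mul, map_mul, twist_inv (by rw [constantCoeff_fEval]; exact one_ne_zero),
    twist_fEval (by rwa [map_pow]), twist_inv (twist_alphaEval hs _).1, (twist_alphaEval hs _).2,
    (twist_alphaEval hs _).2, twist_toK, map_pow]
  rfl

theorem twist_sumBCEval (hs : PowerSeries.X ∣ s) (x : (LaurentSeries ℂ)⟦X⟧ˣ)
    (hx : PowerSeries.constantCoeff (x : (LaurentSeries ℂ)⟦X⟧) ^ 2 ≠ 1) :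
    twist (sumBCEval s x) = sumBCEval s (Units.map twist.toMonoidHom x) := by
  have h1 : PowerSeries.constantCoeff
      (1 + toK (LaurentSeries ℂ) (hExp (1 / 2)) * (x : (LaurentSeries ℂ)⟦X⟧)) ≠ 0 := by
    rw [map_add, map_one, map_mul, constantCoeff_toK_hExp, one_mul]
    intro h
    exact hx (by rw [eq_neg_of_add_eq_zero_right h]; norm_num)
  rw [sumBCEval, map_mul, map_mul, map_mul, map_mul, map_mul,
    twist_inv (by rw [constantCoeff_fEval]; exact one_ne_zero),
    twist_fEval (by rwa [map_pow]), twist_inv (twist_betaEval hs _).1, (twist_betaEval hs _).2,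
    (twist_betaEval hs _).2, twist_toK, map_pow, twist_inv h1, map_add, map_add, map_mul, map_mul,
    twist_toK, twist_toK, map_one]
  rfl

/-- The matrix of the eight-vertex model. -/
def eightVertex {A : Type*} [Zero A] (a b c d : A) : Fin 2 → Fin 2 → Fin 2 → Fin 2 → A :=
  fun i j k l =>
    if i = k then (if j = l then (if i = j then a else b) else 0)
    else (if j = l then 0 else (if i = j then d else c))

theorem ellR_apply (ζ : LaurentSeries ℂ) : ∃ a b c d : (LaurentSeries ℂ)⟦X⟧,
    (∀ i j k l, ellR s ζ (i, j) (k, l) = eightVertex a b c d i j k l) ∧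
    a + d = sumAD s ζ ∧ a - d = sumAD s (-ζ) ∧ b + c = sumBC s ζ ∧ b - c = sumBC s (-ζ) := by
  have h2 : 2 * toK (LaurentSeries ℂ) (PowerSeries.C (1 / 2)) = 1 := by
    rw [← map_ofNat (toK (LaurentSeries ℂ)) 2, ← map_ofNat PowerSeries.C 2, ← map_mul, ← map_mul]
    norm_num
  refine ⟨toK (LaurentSeries ℂ) (PowerSeries.C (1 / 2)) * (sumAD s ζ + sumAD s (-ζ)),
    toK (LaurentSeries ℂ) (PowerSeries.C (1 / 2)) * (sumBC s ζ + sumBC s (-ζ)),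
    toK (LaurentSeries ℂ) (PowerSeries.C (1 / 2)) * (sumBC s ζ - sumBC s (-ζ)),
    toK (LaurentSeries ℂ) (PowerSeries.C (1 / 2)) * (sumAD s ζ - sumAD s (-ζ)),
    fun i j k l => ?_, ?_, ?_, ?_, ?_⟩
  · fin_cases i <;> fin_cases j <;> fin_cases k <;> fin_cases l <;> rfl
  · linear_combination (sumAD s ζ) * h2
  · linear_combination (sumAD s (-ζ)) * h2
  · linear_combination (sumBC s ζ) * h2
  · linear_combination (sumBC s (-ζ)) * h2

theorem two_mul_cancel {K : Type*} [Field K] [Algebra ℂ K] {x y : K⟦X⟧} (h : 2 * x = 2 * y) :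
    x = y := by
  have : CharZero K := charZero_of_injective_algebraMap (algebraMap ℂ K).injective
  have h2 : (2 : K⟦X⟧) ≠ 0 := by
    rw [← map_ofNat PowerSeries.C 2, Ne, map_eq_zero_iff _ PowerSeries.C_injective]
    exact two_ne_zero
  exact mul_left_cancel₀ h2 h

/-- The sign change of x exchanges a + d with a - d and b + c with b - c, giving the companion
relations (b - d)(x) (a + d)(qx) = 1 and (a - c)(x) (b + c)(qx) = 1. -/
theorem crossing_neg {K : Type*} [Field K] [Algebra ℂ K] (hs : PowerSeries.X ∣ s) (hs0 : s ≠ 0)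
    (x : K⟦X⟧ˣ) (hx : PowerSeries.constantCoeff (x : K⟦X⟧) ^ 2 ≠ 1) :
    PowerSeries.constantCoeff ((-x : K⟦X⟧ˣ) : K⟦X⟧) ^ 2 ≠ 1 ∧
    (sumBCEval s (-x) + sumBCEval s x + sumADEval s (-x) - sumADEval s x) *
      sumADEval s (x * qUnit K) = 2 ∧
    (sumADEval s (-x) + sumADEval s x + sumBCEval s (-x) - sumBCEval s x) *
      sumBCEval s (x * qUnit K) = 2 := by
  have hx' : PowerSeries.constantCoeff ((-x : K⟦X⟧ˣ) : K⟦X⟧) ^ 2 ≠ 1 := by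
    rwa [Units.val_neg, map_neg, neg_sq]
  refine ⟨hx', ?_⟩
  have := crossing hs hs0 (-x) hx'
  rwa [neg_neg, neg_mul, neg_neg] at this

/-- The crossing relations for the entries of `R(t⁻¹)`. -/
theorem ellR_crossing (hs : PowerSeries.X ∣ s) (hs0 : s ≠ 0) :
    ∃ a b c d : (LaurentSeries ℂ)⟦X⟧,
    (∀ i j k l, ellR s lvar⁻¹ (i, j) (k, l) = eightVertex a b c d i j k l) ∧
    b * twist a - d * twist d = 1 ∧ b * twist d = d * twist a ∧
    a * twist b - c * twist c = 1 ∧ a * twist c = c * twist b := by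
  obtain ⟨a, b, c, d, h, h1, h2, h3, h4⟩ := ellR_apply (s := s) lvar⁻¹
  refine ⟨a, b, c, d, h, ?_⟩
  have hζ : (lvar⁻¹ : LaurentSeries ℂ) ≠ 0 := by
    rw [lvar_inv]; exact HahnSeries.single_ne_zero one_ne_zero
  set x := constUnit lvar⁻¹ hζ
  have hneg : constUnit (-lvar⁻¹) (neg_ne_zero.2 hζ) = -x := by
    ext1; rw [Units.val_neg, coe_constUnit, coe_constUnit, map_neg]
  have hc : PowerSeries.constantCoeff (x : (LaurentSeries ℂ)⟦X⟧) ^ 2 ≠ 1 := by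
    rw [coe_constUnit, PowerSeries.constantCoeff_C, lvar_inv, pow_two, HahnSeries.single_mul_single]
    intro h
    have := congrArg (fun y : LaurentSeries ℂ => y.coeff 0) h
    simp [HahnSeries.coeff_single_of_ne] at this
  obtain ⟨hc', c3, c4⟩ := crossing_neg hs hs0 x hc
  have htw : Units.map twist.toMonoidHom x = x * qUnit (LaurentSeries ℂ) := by
    ext1
    rw [Units.val_mul, coe_qUnit, mul_comm, coe_constUnit]
    exact twist_C_lvar_inv
  have htw' : Units.map twist.toMonoidHom (-x) = -(x * qUnit (LaurentSeries ℂ)) := by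
    rw [← htw]
    ext1
    exact map_neg twist _
  rw [sumAD_eq s _ hζ] at h1
  rw [sumAD_eq s _ (neg_ne_zero.2 hζ), hneg] at h2
  rw [sumBC_eq s _ hζ] at h3
  rw [sumBC_eq s _ (neg_ne_zero.2 hζ), hneg] at h4
  have t1 := congrArg twist h1
  have t2 := congrArg twist h2
  have t3 := congrArg twist h3
  have t4 := congrArg twist h4
  rw [map_add, twist_sumADEval hs x hc, htw] at t1
  rw [map_sub, twist_sumADEval hs (-x) hc', htw'] at t2
  rw [map_add, twist_sumBCEval hs x hc, htw] at t3
  rw [map_sub, twist_sumBCEval hs (-x) hc', htw'] at t4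
  obtain ⟨c1, c2⟩ := crossing hs hs0 x hc
  rw [← h1, ← h2, ← h3, ← h4] at c1 c2 c3 c4
  rw [← t2] at c1
  rw [← t4] at c2
  rw [← t1] at c3
  rw [← t3] at c4
  have e1 : (b + d) * (twist a - twist d) = 1 := two_mul_cancel (by linear_combination c1)
  have e2 : (a + c) * (twist b - twist c) = 1 := two_mul_cancel (by linear_combination c2)
  have e3 : (b - d) * (twist a + twist d) = 1 := two_mul_cancel (by linear_combination c3)
  have e4 : (a - c) * (twist b + twist c) = 1 := two_mul_cancel (by linear_combination c4)
  -- Sums and differences of the factored relations give the four relations without mixed terms.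
  exact ⟨two_mul_cancel (by linear_combination e1 + e3), two_mul_cancel (by linear_combination e3 - e1),
    two_mul_cancel (by linear_combination e2 + e4), two_mul_cancel (by linear_combination e4 - e2)⟩

theorem sum_fin_two_fun {A : Type*} [AddCommMonoid A] (F : (Fin 2 → Fin 2) → A) :
    ∑ J, F J = F ![0, 0] + F ![0, 1] + (F ![1, 0] + F ![1, 1]) := by
  rw [Fintype.sum_equiv (finTwoArrowEquiv (Fin 2)) F (fun p => F ![p.1, p.2])
    (fun J => congrArg F (List.ofFn_injective rfl)), Fintype.sum_prod_type, Fin.sum_univ_two,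
    Fin.sum_univ_two, Fin.sum_univ_two]

theorem antisym_apply (I J : Fin 2 → Fin 2) : antisym I J = PowerSeries.C (1 / 2) *
    ((if I 0 = J 0 ∧ I 1 = J 1 then 1 else 0) - (if I 0 = J 1 ∧ I 1 = J 0 then 1 else 0)) := rfl

/-- The relation A_{12} R_{01}(x) R_{02}(qx) = A_{12} in components: K and k' are the indices of the
auxiliary factor 0, and every case reduces to one of the four scalar relations or is trivial. -/
theorem eightVertex_crossing {A : Type*} [CommRing A] {a b c d a' b' c' d' : A}
    (h1 : b * a' - d * d' = 1) (h2 : b * d' = d * a') (h3 : a * b' - c * c' = 1)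
    (h4 : a * c' = c * b') (φ : ℂ⟦X⟧ →+* A) (I j : Fin 2 → Fin 2) (K k' : Fin 2) :
    ∑ J : Fin 2 → Fin 2, ∑ k : Fin 2, φ (antisym I J) *
      (eightVertex a b c d K (J 0) k (j 0) * eightVertex a' b' c' d' k (J 1) k' (j 1)) =
    if K = k' then φ (antisym I j) else 0 := by
  simp only [antisym_apply, map_mul φ]
  generalize φ (PowerSeries.C (1 / 2)) = u
  obtain ⟨i0, i1, rfl⟩ : ∃ x y, I = ![x, y] := ⟨I 0, I 1, List.ofFn_injective rfl⟩
  obtain ⟨j0, j1, rfl⟩ : ∃ x y, j = ![x, y] := ⟨j 0, j 1, List.ofFn_injective rfl⟩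
  rw [sum_fin_two_fun]
  simp only [Fin.sum_univ_two, Matrix.cons_val_zero, Matrix.cons_val_one, eightVertex]
  fin_cases i0 <;> fin_cases i1 <;> fin_cases j0 <;> fin_cases j1 <;> fin_cases K <;>
    fin_cases k' <;> simp <;> first
      | linear_combination u * h1
      | linear_combination -u * h1
      | linear_combination u * h2
      | linear_combination -u * h2
      | linear_combination u * h3
      | linear_combination -u * h3
      | linear_combination u * h4
      | linear_combination -u * h4

end

/-! ### Crossing symmetry for the coefficients of R at z = ∞. -/

theorem X_dvd_nome (a : ℝ) {b : ℕ} (hb : 0 < b) : PowerSeries.X ∣ nome a b :=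
  (dvd_pow_self _ hb.ne').mul_left _

theorem nome_ne_zero {a : ℝ} (ha : 0 < a) (b : ℕ) : nome a b ≠ 0 := by
  refine mul_ne_zero ?_ (pow_ne_zero _ PowerSeries.X_ne_zero)
  rw [Ne, map_eq_zero_iff _ PowerSeries.C_injective]
  exact_mod_cast (Real.sqrt_pos.2 ha).ne'

theorem lcoeff_sum {ι : Type*} (m : ℤ) (F : Finset ι) (x : ι → (LaurentSeries ℂ)⟦X⟧) :
    lcoeff m (∑ i ∈ F, x i) = ∑ i ∈ F, lcoeff m (x i) :=
  map_sum (AddMonoidHom.mk' (lcoeff m) (lcoeff_add m)) _ _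

/-- The coefficients of `R(z)` at `z = ∞` vanish `h`-adically in high degree. -/
theorem Rinfty_eventually (s : ℂ⟦X⟧) (k : ℕ) : ∃ N : ℤ, ∀ r, N < r → ∀ I J,
    PowerSeries.X ^ k ∣ Rinfty s r I J := by
  have key : ∀ x : (LaurentSeries ℂ)⟦X⟧, ∃ N : ℤ, ∀ r, N < r → PowerSeries.X ^ k ∣ lcoeff (-r) x := by
    intro x
    obtain ⟨N, hN⟩ : BddBelow (⋃ i ∈ Finset.range k, (PowerSeries.coeff i x).support) :=
      (Set.Finite.bddBelow_biUnion (Finset.range k).finite_toSet).2 fun i _ => by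
        by_cases h : PowerSeries.coeff i x = 0
        · rw [h]; simp
        · exact ⟨_, fun m hm => HahnSeries.order_le_of_coeff_ne_zero hm⟩
    refine ⟨-N, fun r hr => PowerSeries.X_pow_dvd_iff.2 fun n hn => ?_⟩
    rw [lcoeff, PowerSeries.coeff_mk]
    by_contra hc
    have := hN (Set.mem_biUnion (x := n) (by simpa using hn) hc)
    omega
  choose N hN using fun p : (Fin 2 × Fin 2) × (Fin 2 × Fin 2) => key (ellR s lvar⁻¹ p.1 p.2)
  obtain ⟨B, hB⟩ := (Set.finite_range N).bddAbove
  exact ⟨B, fun r hr I J => hN (I, J) r (lt_of_le_of_lt (hB ⟨_, rfl⟩) hr)⟩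

/-- The `h`-adic form of the crossing relation
`∑ A_{I J} R_{K J_1, k j_1}(z) R_{k J_2, k' j_2}(z e^{-h/2}) = δ_{K k'} A_{I j}` at `z = ∞`. -/
theorem Rinfty_crossing {s : ℂ⟦X⟧} (hs : PowerSeries.X ∣ s) (hs0 : s ≠ 0) (I j : Fin 2 → Fin 2)
    (K k' : Fin 2) (R : ℤ) (M : ℕ) : ∃ F : Finset ℤ, ∀ F', F ⊆ F' →
    PowerSeries.X ^ M ∣ (if R = 0 then if K = k' then antisym I j else 0 else 0) -
      ∑ J : Fin 2 → Fin 2, ∑ k : Fin 2, antisym I J * ∑ r ∈ F', Rinfty s r (K, J 0) (k, j 0) *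
        (hExp (((R - r : ℤ) : ℂ) / 2) * Rinfty s (R - r) (k, J 1) (k', j 1)) := by
  classical
  obtain ⟨a, b, c, d, h, h1, h2, h3, h4⟩ := ellR_crossing hs hs0
  have key := congrArg (lcoeff (-R))
    (eightVertex_crossing h1 h2 h3 h4 (toK (LaurentSeries ℂ)) I j K k')
  simp only [lcoeff_sum, lcoeff_toK_mul] at key
  have hr : lcoeff (-R) (if K = k' then toK (LaurentSeries ℂ) (antisym I j) else 0) =
      if R = 0 then if K = k' then antisym I j else 0 else 0 := by
    split_ifs with h1 h2 h2
    · rw [← mul_one (toK _ _), lcoeff_toK_mul, ← single_zero_eq_one, lcoeff_C_single]; simp [h2]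
    · rw [← mul_one (toK _ _), lcoeff_toK_mul, ← single_zero_eq_one, lcoeff_C_single]; simp [h2]
    · exact lcoeff_zero _
    · exact lcoeff_zero _
  rw [hr] at key
  choose F hF using fun p : (Fin 2 → Fin 2) × Fin 2 =>
    lcoeff_mul (eightVertex a b c d K (p.1 0) p.2 (j 0))
      (eightVertex (twist a) (twist b) (twist c) (twist d) p.2 (p.1 1) k' (j 1)) (-R) M
  have ht : ∀ i j k l, eightVertex (twist a) (twist b) (twist c) (twist d) i j k l =
      twist (ellR s lvar⁻¹ (i, j) (k, l)) := by
    intro i j k l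
    rw [h, eightVertex, eightVertex]
    split_ifs <;> simp
  -- The coefficients `Rinfty` are indexed by powers of z = t⁻¹, the Laurent coefficients by powers
  -- of t; hence the sign change.
  refine ⟨(Finset.univ.biUnion F).map (Equiv.neg ℤ).toEmbedding, fun F' hF' => ?_⟩
  rw [← key, ← Finset.sum_sub_distrib]
  refine Finset.dvd_sum fun J _ => ?_
  rw [← Finset.sum_sub_distrib]
  refine Finset.dvd_sum fun k _ => ?_
  rw [← mul_sub]
  refine Dvd.dvd.mul_left ?_ _
  have := hF (J, k) (F'.map (Equiv.neg ℤ).toEmbedding) (fun r hr => by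
    have : -r ∈ F' := hF' (Finset.mem_map.2 ⟨r, Finset.mem_biUnion.2 ⟨_, Finset.mem_univ _, hr⟩, rfl⟩)
    exact Finset.mem_map.2 ⟨-r, this, neg_neg r⟩)
  rw [Finset.sum_map] at this
  convert this using 3 with r
  rw [ht, lcoeff_twist, ← h]
  simp only [Equiv.coe_toEmbedding, Equiv.neg_apply, Rinfty, Matrix.map_apply]
  rw [show -R - -r = -(R - r) by ring]
  congr 3
  push_cast; ring

/-- The submodule `h^k W` of `W`. -/
def hPow (W : Type*) [AddCommGroup W] [Module ℂ⟦X⟧ W] (k : ℕ) : Submodule ℂ⟦X⟧ W :=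
  LinearMap.range (LinearMap.lsmul ℂ⟦X⟧ W (PowerSeries.X ^ k))

/-- A family is null if it tends to zero `h`-adically along the cofinite filter. -/
def IsNull {ι W : Type*} [AddCommGroup W] [Module ℂ⟦X⟧ W] (g : ι → W) : Prop :=
  ∀ k, {i | g i ∉ hPow W k}.Finite

/-! ### Sums of h-adically null families. -/

section HSum

variable {ι κ W W' : Type*} [AddCommGroup W] [Module ℂ⟦X⟧ W] [AddCommGroup W'] [Module ℂ⟦X⟧ W']

theorem mem_hPow {k : ℕ} {w : W} : w ∈ hPow W k ↔ ∃ v : W, w = (PowerSeries.X : ℂ⟦X⟧) ^ k • v :=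
  ⟨fun ⟨v, hv⟩ => ⟨v, hv.symm⟩, fun ⟨v, hv⟩ => ⟨v, hv.symm⟩⟩

theorem hPow_antitone {k l : ℕ} (h : k ≤ l) : hPow W l ≤ hPow W k := by
  intro w hw
  obtain ⟨v, rfl⟩ := mem_hPow.1 hw
  exact mem_hPow.2 ⟨(PowerSeries.X : ℂ⟦X⟧) ^ (l - k) • v, by
    rw [smul_smul, ← pow_add, Nat.add_sub_cancel' h]⟩

theorem smul_mem_hPow {k : ℕ} {r : ℂ⟦X⟧} (h : PowerSeries.X ^ k ∣ r) (w : W) : r • w ∈ hPow W k := by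
  obtain ⟨c, rfl⟩ := h
  exact mem_hPow.2 ⟨c • w, mul_smul _ _ _⟩

theorem map_mem_hPow (T : W →ₗ[ℂ⟦X⟧] W') {k : ℕ} {w : W} (h : w ∈ hPow W k) : T w ∈ hPow W' k := by
  obtain ⟨v, rfl⟩ := mem_hPow.1 h
  exact mem_hPow.2 ⟨T v, map_smul _ _ _⟩

theorem hPow_eq (k : ℕ) :
    hPow W k = Ideal.span {(PowerSeries.X : ℂ⟦X⟧)} ^ k • (⊤ : Submodule ℂ⟦X⟧ W) := by
  ext w
  rw [mem_hPow, Ideal.span_singleton_pow, Submodule.ideal_span_singleton_smul,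
    Submodule.mem_smul_pointwise_iff_exists]
  exact ⟨fun ⟨v, hv⟩ => ⟨v, trivial, hv.symm⟩, fun ⟨v, _, hv⟩ => ⟨v, hv.symm⟩⟩

theorem IsNull.mono {g : ι → W} {f : ι → W'} (hg : IsNull g)
    (h : ∀ k i, g i ∈ hPow W k → f i ∈ hPow W' k) : IsNull f := fun k =>
  (hg k).subset fun i hi hi' => hi (h k i hi')

theorem IsNull.map {g : ι → W} (hg : IsNull g) (T : W →ₗ[ℂ⟦X⟧] W') : IsNull fun i => T (g i) :=
  hg.mono fun _ _ => map_mem_hPow T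

theorem IsNull.smul {g : ι → W} (hg : IsNull g) (c : ι → ℂ⟦X⟧) : IsNull fun i => c i • g i :=
  hg.mono fun _ _ => Submodule.smul_mem _ _

theorem IsNull.comp_injective {g : ι → W} (hg : IsNull g) {e : κ → ι} (he : Function.Injective e) :
    IsNull (g ∘ e) := fun k => (hg k).preimage he.injOn

theorem IsNull.sum {α : Type*} {F : Finset α} {g : α → ι → W} (hg : ∀ a ∈ F, IsNull (g a)) :
    IsNull fun i => ∑ a ∈ F, g a i := fun k => by
  refine (F.finite_toSet.biUnion fun a ha => hg a ha k).subset fun i hi => ?_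
  by_contra hc
  refine hi (Submodule.sum_mem _ fun a ha => ?_)
  by_contra h
  exact hc (Set.mem_biUnion (x := a) ha h)

variable (hW : TopologicallyFree W)
include hW

theorem TopologicallyFree.eq_of_forall {x y : W} (h : ∀ k, x - y ∈ hPow W k) : x = y := by
  rw [← sub_eq_zero]
  refine hW.1.toIsHausdorff.haus _ fun k => ?_
  rw [SModEq.zero, ← hPow_eq]
  exact h k

/-- The submodules h^k W form a basis at 0 of the adic topology, and separatedness makes it
Hausdorff, so the `tsum` behind `hSum` is determined by congruences modulo all h^k W. -/
theorem hSum_eq_of_forall {g : ι → W} {s : W}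
    (h : ∀ k, ∃ F : Finset ι, ∀ F', F ⊆ F' → s - ∑ i ∈ F', g i ∈ hPow W k) : hSum g = s := by
  let I := Ideal.span {(PowerSeries.X : ℂ⟦X⟧)}
  let _ : TopologicalSpace ℂ⟦X⟧ := I.adic_basis.topology
  let _ : TopologicalSpace W := I.adicModuleTopology W
  let B := I.ringFilterBasis.moduleFilterBasis (I.adic_module_basis W)
  have hadd : IsTopologicalAddGroup W := B.toAddGroupFilterBasis.isTopologicalAddGroup
  have hb : (nhds (0 : W)).HasBasis (fun _ : ℕ => True) fun k => (hPow W k : Set W) := by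
    refine ⟨fun U => ?_⟩
    rw [B.toAddGroupFilterBasis.nhds_zero_hasBasis.mem_iff]
    constructor
    · rintro ⟨_, ⟨k, rfl⟩, hU⟩
      exact ⟨k, trivial, by rw [hPow_eq]; exact hU⟩
    · rintro ⟨k, _, hU⟩
      exact ⟨_, ⟨k, rfl⟩, by rw [hPow_eq] at hU; exact hU⟩
  have hT2 : T2Space W := by
    refine IsTopologicalAddGroup.t2Space_of_zero_sep fun w hw => ?_
    by_contra hc
    refine hw (hW.eq_of_forall fun k => ?_)
    by_contra hk
    exact hc ⟨_, hb.mem_of_mem (i := k) trivial, by rwa [sub_zero] at hk⟩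
  have hs : HasSum g s := by
    rw [HasSum, ← tendsto_sub_nhds_zero_iff, hb.tendsto_right_iff]
    intro k _
    obtain ⟨F, hF⟩ := h k
    filter_upwards [Filter.eventually_ge_atTop F] with F' hF'
    have := Submodule.neg_mem _ (hF F' hF')
    rwa [neg_sub] at this
  exact hs.tsum_eq

/-- Completeness enters here: the partial sums over the finite exceptional sets of a null family
form a Cauchy sequence, and its limit is the sum. -/
theorem hSum_sub_sum_mem {g : ι → W} (hg : IsNull g) (k : ℕ) {F : Finset ι}
    (hF : ∀ i ∉ F, g i ∈ hPow W k) : hSum g - ∑ i ∈ F, g i ∈ hPow W k := by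
  classical
  have key : ∀ {k : ℕ} {F G : Finset ι}, (∀ i ∉ F, g i ∈ hPow W k) → (∀ i ∉ G, g i ∈ hPow W k) →
      ∑ i ∈ F, g i - ∑ i ∈ G, g i ∈ hPow W k := by
    intro k F G hF hG
    rw [← Finset.sum_sdiff_sub_sum_sdiff]
    exact Submodule.sub_mem _
      (Submodule.sum_mem _ fun i hi => hG i (Finset.mem_sdiff.1 hi).2)
      (Submodule.sum_mem _ fun i hi => hF i (Finset.mem_sdiff.1 hi).2)
  have hS : ∀ k, ∀ i ∉ (hg k).toFinset, g i ∈ hPow W k := fun k i hi => by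
    by_contra h
    exact hi ((hg k).mem_toFinset.2 h)
  obtain ⟨s, hs⟩ := hW.1.toIsPrecomplete.prec' (fun k => ∑ i ∈ (hg k).toFinset, g i) (by
    intro m n hmn
    rw [SModEq.sub_mem, ← hPow_eq]
    exact key (hS m) fun i hi => hPow_antitone hmn (hS n i hi))
  have hs' : ∀ k, ∀ F : Finset ι, (∀ i ∉ F, g i ∈ hPow W k) → s - ∑ i ∈ F, g i ∈ hPow W k := by
    intro k F hF
    have h1 := hs k
    rw [SModEq.sub_mem, ← hPow_eq] at h1
    have h2 := Submodule.sub_mem _ (key (hS k) hF) h1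
    rwa [sub_sub_sub_cancel_left] at h2
  rw [hSum_eq_of_forall hW (s := s) fun k => ⟨(hg k).toFinset, fun F' hF' => hs' k F' fun i hi =>
    hS k i fun h => hi (hF' h)⟩]
  exact hs' k F hF

theorem hSum_mem_hPow {g : ι → W} (hg : IsNull g) {k : ℕ} (h : ∀ i, g i ∈ hPow W k) :
    hSum g ∈ hPow W k := by
  simpa using hSum_sub_sum_mem hW hg k (F := ∅) fun i _ => h i

/-- An `h`-adically convergent sum is characterised by its finite truncations. -/
theorem IsNull.hSum_eq {g : ι → W} (hg : IsNull g) {s : W}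
    (h : ∀ k, ∃ F : Finset ι, (∀ i ∉ F, g i ∈ hPow W k) ∧ s - ∑ i ∈ F, g i ∈ hPow W k) :
    hSum g = s :=
  hW.eq_of_forall fun k => by
    obtain ⟨F, hF, h1⟩ := h k
    have := Submodule.sub_mem _ (hSum_sub_sum_mem hW hg k hF) h1
    rwa [sub_sub_sub_cancel_right] at this

theorem hSum_zero : hSum (fun _ : ι => (0 : W)) = 0 :=
  hSum_eq_of_forall hW fun k => ⟨∅, fun F' _ => by simp⟩

omit hW in
theorem hSum_equiv (e : κ ≃ ι) (g : ι → W) : hSum (fun i => g (e i)) = hSum g :=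
  @Equiv.tsum_eq W ι κ _ ((Ideal.span {(PowerSeries.X : ℂ⟦X⟧)}).adicModuleTopology W) e g

/-- Terms off the range of an injection may be dropped if they vanish. -/
theorem hSum_injective {g : ι → W} (hg : IsNull g) {e : κ → ι} (he : Function.Injective e)
    (h0 : ∀ i, i ∉ Set.range e → g i = 0) : hSum (fun i => g (e i)) = hSum g := by
  classical
  have hn : IsNull fun i => g (e i) := hg.comp_injective he
  refine hn.hSum_eq hW fun k => ⟨((hg k).preimage he.injOn).toFinset, fun i hi => ?_, ?_⟩
  · by_contra h
    exact hi (by simpa using h)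
  · have h1 := hSum_sub_sum_mem hW hg k (F := (((hg k).preimage he.injOn).toFinset.image e)) (by
      intro i hi
      by_contra hc
      apply hi
      by_cases hr : i ∈ Set.range e
      · obtain ⟨j, rfl⟩ := hr
        exact Finset.mem_image_of_mem _ (by simpa using hc)
      · rw [h0 i hr] at hc
        exact absurd (Submodule.zero_mem _) hc)
    rwa [Finset.sum_image he.injOn] at h1

theorem hSum_sum {α : Type*} {F : Finset α} {g : α → ι → W} (hg : ∀ a ∈ F, IsNull (g a)) :
    hSum (fun i => ∑ a ∈ F, g a i) = ∑ a ∈ F, hSum (g a) := by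
  refine (IsNull.sum hg).hSum_eq hW fun k => ?_
  classical
  have hfin : (⋃ a ∈ F, {i | g a i ∉ hPow W k}).Finite :=
    F.finite_toSet.biUnion fun a ha => hg a ha k
  have h1 : ∀ a ∈ F, ∀ i ∉ hfin.toFinset, g a i ∈ hPow W k := fun a ha i hi => by
    by_contra h
    exact hi (hfin.mem_toFinset.2 (Set.mem_biUnion (x := a) ha h))
  refine ⟨hfin.toFinset, fun i hi => Submodule.sum_mem _ fun a ha => h1 a ha i hi, ?_⟩
  rw [Finset.sum_comm, ← Finset.sum_sub_distrib]
  exact Submodule.sum_mem _ fun a ha => hSum_sub_sum_mem hW (hg a ha) k (h1 a ha)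

/-- Fubini for a jointly null family: modulo h^k all terms outside one finite box vanish, and in the
box the sums are finite. -/
theorem hSum_prod {f : ι × κ → W} (hf : IsNull f) :
    (hSum fun i => hSum fun j => f (i, j)) = hSum f := by
  classical
  have hin : ∀ i, IsNull fun j => f (i, j) := fun i => hf.comp_injective (Prod.mk_right_injective i)
  have hout : ∀ k, ∀ i ∉ (hf k).toFinset.image Prod.fst, ∀ j, f (i, j) ∈ hPow W k := by
    intro k i hi j
    by_contra h
    exact hi (Finset.mem_image.2 ⟨(i, j), (hf k).mem_toFinset.2 h, rfl⟩)
  have hn : IsNull fun i => hSum fun j => f (i, j) := fun k =>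
    (Finset.finite_toSet ((hf k).toFinset.image Prod.fst)).subset fun i hi => by
      by_contra h
      exact hi (hSum_mem_hPow hW (hin i) (hout k i h))
  refine hn.hSum_eq hW fun k => ⟨_, fun i hi => hSum_mem_hPow hW (hin i) (hout k i hi), ?_⟩
  have h1 := hSum_sub_sum_mem hW hf k
    (F := (hf k).toFinset.image Prod.fst ×ˢ (hf k).toFinset.image Prod.snd) (by
      rintro ⟨i, j⟩ hij
      by_contra h
      have h := (hf k).mem_toFinset.2 h
      exact hij (Finset.mem_product.2 ⟨Finset.mem_image_of_mem _ h, Finset.mem_image_of_mem _ h⟩))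
  rw [Finset.sum_product] at h1
  have h2 : ∑ i ∈ (hf k).toFinset.image Prod.fst, (hSum fun j => f (i, j)) -
      ∑ i ∈ (hf k).toFinset.image Prod.fst, ∑ j ∈ (hf k).toFinset.image Prod.snd, f (i, j)
        ∈ hPow W k := by
    rw [← Finset.sum_sub_distrib]
    refine Submodule.sum_mem _ fun i _ => hSum_sub_sum_mem hW (hin i) k fun j hj => ?_
    by_contra h
    exact hj (Finset.mem_image.2 ⟨(i, j), (hf k).mem_toFinset.2 h, rfl⟩)
  have h3 := Submodule.sub_mem _ h1 h2
  rwa [sub_sub_sub_cancel_right] at h3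

theorem hSum_comm {f : ι → κ → W} (hf : IsNull fun p : ι × κ => f p.1 p.2) :
    (hSum fun i => hSum fun j => f i j) = hSum fun j => hSum fun i => f i j := by
  rw [hSum_prod hW hf, ← hSum_equiv (Equiv.prodComm κ ι)]
  exact (hSum_prod hW (hf.comp_injective (Equiv.prodComm κ ι).injective)).symm

/-- A ℂ[[h]]-linear map sends h^k W into h^k W', so it is automatically continuous. -/
theorem map_hSum (hW' : TopologicallyFree W') (T : W →ₗ[ℂ⟦X⟧] W') {g : ι → W} (hg : IsNull g) :
    T (hSum g) = hSum fun i => T (g i) := by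
  refine ((hg.map T).hSum_eq hW' fun k => ⟨(hg k).toFinset, fun i hi => ?_, ?_⟩).symm
  · refine map_mem_hPow T ?_
    by_contra h
    exact hi ((hg k).mem_toFinset.2 h)
  · rw [← map_sum, ← map_sub]
    refine map_mem_hPow T (hSum_sub_sum_mem hW hg k fun i hi => ?_)
    by_contra h
    exact hi ((hg k).mem_toFinset.2 h)

theorem smul_hSum (c : ℂ⟦X⟧) {g : ι → W} (hg : IsNull g) :
    c • hSum g = hSum fun i => c • g i :=
  map_hSum hW hW (LinearMap.lsmul ℂ⟦X⟧ W c) hg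

end HSum

/-! ### Support conditions and their stability under R-matrix multiplication. -/

section Support

variable {W : Type*} [AddCommGroup W] [Module ℂ⟦X⟧ W] {n : ℕ}

/-- The coefficients of `S` vanish `h`-adically for very negative exponents of `x_j`. -/
def SuppBdd (j : Fin n) (S : Dist n W) : Prop :=
  ∀ k, ∃ N : ℤ, ∀ m : Fin n → ℤ, m j < N → ∀ I J, S m I J ∈ hPow W k

/-- The coefficients of `S` vanish `h`-adically for very negative exponents of `x_j` once the
exponents of all `x_i` with `i > j` are fixed. -/
def LowerFinite (S : Dist n W) : Prop :=
  ∀ (k : ℕ) (j : Fin n) (v : Fin n → ℤ), ∃ N : ℤ, ∀ m : Fin n → ℤ, (∀ i, j < i → m i = v i) →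
    m j < N → ∀ I J, S m I J ∈ hPow W k

/-- A matrix-valued series whose coefficients vanish `h`-adically in high degree. -/
def UpperNull (ρ : ℤ → Matrix (Fin 2 × Fin 2) (Fin 2 × Fin 2) ℂ⟦X⟧) : Prop :=
  ∀ k : ℕ, ∃ N : ℤ, ∀ r, N < r → ∀ I J, PowerSeries.X ^ k ∣ ρ r I J

/-- The exponent `m - r e_i + r e_j`. -/
def shift (m : Fin n → ℤ) (i j : Fin n) (r : ℤ) : Fin n → ℤ := m - Pi.single i r + Pi.single j r

theorem shift_apply (m : Fin n → ℤ) (i j : Fin n) (r : ℤ) (x : Fin n) :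
    shift m i j r x = m x - (if x = i then r else 0) + (if x = j then r else 0) := by
  simp [shift, Pi.single_apply]

theorem shift_apply_right (m : Fin n → ℤ) {i j : Fin n} (h : i ≠ j) (r : ℤ) :
    shift m i j r j = m j + r := by
  rw [shift_apply, if_neg h.symm, if_pos rfl, sub_zero]

theorem shift_apply_of_ne (m : Fin n → ℤ) {i j x : Fin n} (h : x ≠ i) (h' : x ≠ j) (r : ℤ) :
    shift m i j r x = m x := by
  rw [shift_apply, if_neg h, if_neg h', sub_zero, add_zero]

theorem mulLeft_apply (ρ : ℤ → Matrix (Fin 2 × Fin 2) (Fin 2 × Fin 2) ℂ⟦X⟧) (i j : Fin n)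
    (S : Dist n W) (m : Fin n → ℤ) (I J : Fin n → Fin 2) :
    mulLeft ρ i j S m I J = ∑ p : Fin 2 × Fin 2, hSum fun r : ℤ =>
      ρ r (I i, I j) p • S (shift m i j r)
        (Function.update (Function.update I i p.1) j p.2) J := by
  rw [Fintype.sum_prod_type]
  rfl

variable {ρ : ℤ → Matrix (Fin 2 × Fin 2) (Fin 2 × Fin 2) ℂ⟦X⟧} (hρ : UpperNull ρ)
include hρ

theorem UpperNull.isNull_smul {x : ℤ → W} (A B : Fin 2 × Fin 2)
    (hx : ∀ k, ∃ N : ℤ, ∀ r < N, x r ∈ hPow W k) : IsNull fun r => ρ r A B • x r := by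
  intro k
  obtain ⟨N, hN⟩ := hρ k
  obtain ⟨N', hN'⟩ := hx k
  refine (Set.finite_Icc N' N).subset fun r hr => ?_
  by_contra hc
  apply hr
  rw [Set.mem_Icc, not_and_or, not_le, not_le] at hc
  rcases hc with hc | hc
  · exact Submodule.smul_mem _ _ (hN' r hc)
  · exact smul_mem_hPow (hN r hc A B) _

theorem LowerFinite.isNull {i j : Fin n} (hij : i < j) {S : Dist n W} (hS : LowerFinite S)
    (m : Fin n → ℤ) (A B : Fin 2 × Fin 2) (I J : Fin n → Fin 2) :
    IsNull fun r => ρ r A B • S (shift m i j r) I J := by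
  refine hρ.isNull_smul A B fun k => ?_
  obtain ⟨N, hN⟩ := hS k j m
  refine ⟨N - m j, fun r hr => hN _ (fun x hx => ?_) ?_ I J⟩
  · exact shift_apply_of_ne m (hij.trans hx).ne' hx.ne' r
  · rw [shift_apply_right m hij.ne]
    omega

variable (hW : TopologicallyFree W)
include hW

theorem LowerFinite.mulLeft_mem {i j : Fin n} (hij : i < j) {S : Dist n W} (hS : LowerFinite S)
    {k : ℕ} {N : ℤ} (hN : ∀ r, N < r → ∀ I J, PowerSeries.X ^ k ∣ ρ r I J) {m : Fin n → ℤ}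
    (h : ∀ r ≤ N, ∀ I J, S (shift m i j r) I J ∈ hPow W k) (I J : Fin n → Fin 2) :
    mulLeft ρ i j S m I J ∈ hPow W k := by
  rw [mulLeft_apply]
  refine Submodule.sum_mem _ fun p _ => hSum_mem_hPow hW (hS.isNull hρ hij m _ _ _ _) fun r => ?_
  rcases le_or_gt r N with hr | hr
  · exact Submodule.smul_mem _ _ (h r hr _ _)
  · exact smul_mem_hPow (hN r hr _ _) _

theorem LowerFinite.mulLeft {i j : Fin n} (hij : i < j) {S : Dist n W} (hS : LowerFinite S) :
    LowerFinite (mulLeft ρ i j S) := by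
  intro k j₀ v
  obtain ⟨N, hN⟩ := hρ k
  -- If j₀ < j, the exponent of x_j is prescribed, so modulo h^k the shift r is bounded below as
  -- well as above, and the finitely many bounds N₂ r can be combined. If j₀ ≥ j, the exponent of
  -- x_{j₀} grows by at most |N|.
  rcases lt_or_ge j₀ j with h0 | h0
  · obtain ⟨N₁, hN₁⟩ := hS k j v
    choose N₂ hN₂ using fun r : ℤ => hS k j₀ (shift v i j r)
    obtain ⟨B, hB⟩ := ((Set.finite_Icc (N₁ - v j) N).image fun r => N₂ r - |r|).bddBelow
    refine ⟨B, fun m hm hmB => hS.mulLeft_mem hρ hW hij hN fun r hr => ?_⟩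
    rcases lt_or_ge r (N₁ - v j) with hr' | hr'
    · refine hN₁ _ (fun x hx => ?_) ?_
      · rw [shift_apply_of_ne m (hij.trans hx).ne' hx.ne', hm x (h0.trans hx)]
      · rw [shift_apply_right m hij.ne, hm j h0]; omega
    · have h1 := hB (Set.mem_image_of_mem _ (Set.mem_Icc.2 ⟨hr', hr⟩))
      refine hN₂ r _ (fun x hx => ?_) ?_
      · rw [shift_apply, shift_apply, hm x hx]
      · have h2 := le_abs_self r
        have h3 := neg_abs_le r
        rw [shift_apply, if_neg h0.ne]
        split_ifs <;> omega
  · obtain ⟨N₁, hN₁⟩ := hS k j₀ v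
    refine ⟨N₁ - |N|, fun m hm hmB => hS.mulLeft_mem hρ hW hij hN fun r hr => ?_⟩
    have h3 := le_abs_self N
    have h4 := abs_nonneg N
    refine hN₁ _ (fun x hx => ?_) ?_
    · rw [shift_apply_of_ne m (hij.trans_le (h0.trans hx.le)).ne' (h0.trans_lt hx).ne', hm x hx]
    · rw [shift_apply, if_neg (hij.trans_le h0).ne']
      split_ifs <;> omega

/-- Modulo h^k only r ≤ N matters, so exponents other than that of x_i rise by at most |N|. The
exponent of x_i itself changes by -r, which has no upper bound; hence the restriction x ≠ i. -/
theorem SuppBdd.mulLeft {i j x : Fin n} (hij : i < j) (hx : x ≠ i) {S : Dist n W}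
    (hS : LowerFinite S) (hS' : SuppBdd x S) : SuppBdd x (mulLeft ρ i j S) := by
  intro k
  obtain ⟨N, hN⟩ := hρ k
  obtain ⟨N₁, hN₁⟩ := hS' k
  refine ⟨N₁ - |N|, fun m hm => hS.mulLeft_mem hρ hW hij hN fun r hr => hN₁ _ ?_⟩
  have h3 := le_abs_self N
  have h4 := abs_nonneg N
  rw [shift_apply, if_neg hx]
  split_ifs <;> omega

end Support

/-! ### Products of the operators 𝓛(x_i). -/

section OpProd

variable {W : Type*} [AddCommGroup W] [Module ℂ⟦X⟧ W]

/-- The coefficients of `𝓛_1(x_1) ⋯ 𝓛_n(x_n)`, as operators. -/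
def opCoeff (𝓛 : OpSeries W) {n : ℕ} (m : Fin n → ℤ) (I J : Fin n → Fin 2) : Module.End ℂ⟦X⟧ W :=
  (List.ofFn fun k => 𝓛 (m k) (I k) (J k)).prod

theorem opProd_apply (𝓛 : OpSeries W) {n : ℕ} (w : W) (m : Fin n → ℤ) (I J : Fin n → Fin 2) :
    opProd 𝓛 n w m I J = opCoeff 𝓛 m I J w := rfl

theorem opCoeff_append (𝓛 : OpSeries W) {n l : ℕ} (m : Fin n → ℤ) (m' : Fin l → ℤ)
    (I J : Fin n → Fin 2) (I' J' : Fin l → Fin 2) :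
    opCoeff 𝓛 (Fin.append m m') (Fin.append I I') (Fin.append J J') =
      opCoeff 𝓛 m I J * opCoeff 𝓛 m' I' J' := by
  rw [opCoeff, List.ofFn_add, List.prod_append]
  have h1 : (List.ofFn fun k : Fin n => 𝓛 (Fin.append m m' (Fin.castAdd l k))
      (Fin.append I I' (Fin.castAdd l k)) (Fin.append J J' (Fin.castAdd l k))) =
      List.ofFn fun k => 𝓛 (m k) (I k) (J k) := by simp only [Fin.append_left]
  have h2 : (List.ofFn fun k : Fin l => 𝓛 (Fin.append m m' (Fin.natAdd n k))
      (Fin.append I I' (Fin.natAdd n k)) (Fin.append J J' (Fin.natAdd n k))) =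
      List.ofFn fun k => 𝓛 (m' k) (I' k) (J' k) := by simp only [Fin.append_right]
  exact congrArg₂ (fun x y : List (Module.End ℂ⟦X⟧ W) => x.prod * y.prod) h1 h2

/-- Peel off the leftmost operator. For x_1 the truncation axiom applies to the vector produced by
the remaining operators at fixed exponents; for the other variables the leftmost operator preserves
h^k W. -/
theorem opProd_lowerFinite {a : ℝ} {b : ℕ} {c : ℂ} {𝓛 : OpSeries W} (h𝓛 : IsFRTOperator a b c 𝓛)
    (n : ℕ) (w : W) : LowerFinite (opProd 𝓛 n w) := by
  induction n with
  | zero => exact fun k j => j.elim0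
  | succ n ih =>
    have hsucc : ∀ (m : Fin (n + 1) → ℤ) I J, opProd 𝓛 (n + 1) w m I J =
        𝓛 (m 0) (I 0) (J 0) (opProd 𝓛 n w (fun x => m x.succ) (fun x => I x.succ)
          (fun x => J x.succ)) := by
      intro m I J
      rw [opProd_apply, opCoeff, List.ofFn_succ, List.prod_cons]
      rfl
    intro k j v
    induction j using Fin.cases with
    | zero =>
      choose N hN using fun q : (Fin (n + 1) → Fin 2) × (Fin (n + 1) → Fin 2) =>
        h𝓛.truncation (opProd 𝓛 n w (fun x => v x.succ) (fun x => q.1 x.succ)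
          (fun x => q.2 x.succ)) (q.1 0) (q.2 0) k
      obtain ⟨B, hB⟩ := (Set.finite_range N).bddBelow
      refine ⟨B, fun m hm hmB I J => ?_⟩
      rw [hsucc, show (fun x : Fin n => m x.succ) = fun x => v x.succ from
        funext fun x => hm _ (Fin.succ_pos x)]
      exact mem_hPow.2 (hN (I, J) (m 0) (hmB.trans_le (hB ⟨_, rfl⟩)))
    | succ j =>
      obtain ⟨N, hN⟩ := ih k j fun x => v x.succ
      refine ⟨N, fun m hm hmB I J => ?_⟩
      rw [hsucc]
      exact map_mem_hPow _ (hN _ (fun x hx => hm _ (Fin.succ_lt_succ_iff.2 hx)) hmB _ _)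

end OpProd

/-! ### Interchange of h-adic sums. -/

section Interchange

variable {ι κ α W : Type*} [AddCommGroup W] [Module ℂ⟦X⟧ W] (hW : TopologicallyFree W)
include hW

theorem IsNull.hSum {f : ι × κ → W} (hf : IsNull f) : IsNull fun i => hSum fun j => f (i, j) :=
  fun k => ((hf k).image Prod.fst).subset fun i hi => by
    by_contra hc
    refine hi (hSum_mem_hPow hW (hf.comp_injective (Prod.mk_right_injective i)) fun j => ?_)
    by_contra h
    exact hc ⟨(i, j), h, rfl⟩

theorem hSum_smul_sum_smul [Fintype α] (c : ι → ℂ⟦X⟧) (d : α → ℂ⟦X⟧) {g : α → ι → W}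
    (hg : ∀ a, IsNull fun i => c i • g a i) :
    (hSum fun i => c i • ∑ a, d a • g a i) = ∑ a, d a • hSum fun i => c i • g a i := by
  simp only [Finset.smul_sum, smul_comm (c _) (d _)]
  rw [hSum_sum hW fun a _ => (hg a).smul fun _ => d a]
  exact Finset.sum_congr rfl fun a _ => (smul_hSum hW _ (hg a)).symm

theorem hSum_smul_sum [Fintype α] (c : ι → ℂ⟦X⟧) {g : α → ι → W}
    (hg : ∀ a, IsNull fun i => c i • g a i) :
    (hSum fun i => c i • ∑ a, g a i) = ∑ a, hSum fun i => c i • g a i := by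
  simpa using hSum_smul_sum_smul hW c (fun _ : α => 1) hg

theorem hSum_smul_comm (c : ι → ℂ⟦X⟧) (d : κ → ℂ⟦X⟧) {x : ι → κ → W}
    (h1 : ∀ i, IsNull fun j => d j • x i j) (h2 : ∀ j, IsNull fun i => c i • x i j)
    (h : IsNull fun p : ι × κ => c p.1 • d p.2 • x p.1 p.2) :
    (hSum fun i => c i • hSum fun j => d j • x i j) =
      hSum fun j => d j • hSum fun i => c i • x i j := by
  simp only [smul_hSum hW _ (h1 _), smul_hSum hW _ (h2 _)]
  rw [hSum_comm hW h]
  exact congrArg hSum (funext fun j => congrArg hSum (funext fun i => smul_comm _ _ _))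

theorem hSum_smul_const {c : ι → ℂ⟦X⟧} {s : ℂ⟦X⟧} (x : W)
    (h : ∀ k : ℕ, ∃ F : Finset ι, ∀ F', F ⊆ F' → PowerSeries.X ^ k ∣ s - ∑ i ∈ F', c i) :
    (hSum fun i => c i • x) = s • x :=
  hSum_eq_of_forall hW fun k => by
    obtain ⟨F, hF⟩ := h k
    refine ⟨F, fun F' hF' => ?_⟩
    rw [← Finset.sum_smul, ← sub_smul]
    exact smul_mem_hPow (hF F' hF') x

end Interchange

/-! ### Crossing symmetry inside a convergent triple sum. -/

section Absorb

variable {W : Type*} [AddCommGroup W] [Module ℂ⟦X⟧ W] (hW : TopologicallyFree W)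
  {ρ : ℤ → Matrix (Fin 2 × Fin 2) (Fin 2 × Fin 2) ℂ⟦X⟧} (hρ : UpperNull ρ) (M : ℤ)

-- Modulo h^k both r and r' are bounded above by N. The supports bound l + r' and M + (r + r') - (l
-- + r') = M + r - l from below. Together these confine (l, r, r') to a finite box.
include hρ in
theorem isNull_triple {x : ℤ → ℤ → W} (A B A' B' : Fin 2 × Fin 2)
    (hx : ∀ k, ∃ N N' : ℤ, ∀ R l : ℤ, l < N ∨ M + R - l < N' → x R l ∈ hPow W k) :
    IsNull fun t : ℤ × ℤ × ℤ => ρ t.2.1 A B • ρ t.2.2 A' B' • x (t.2.1 + t.2.2) (t.1 + t.2.2) := by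
  intro k
  obtain ⟨N, hN⟩ := hρ k
  obtain ⟨Nb, Na, h⟩ := hx k
  refine ((Set.finite_Icc (Nb - N) (M + N - Na)).prod
    ((Set.finite_Icc (Na - M + Nb - N) N).prod (Set.finite_Icc (Nb - M - N + Na) N))).subset ?_
  rintro ⟨l, r, r'⟩ ht
  have h1 : r ≤ N := by
    by_contra hc
    exact ht (smul_mem_hPow (hN r (not_le.1 hc) A B) _)
  have h2 : r' ≤ N := by
    by_contra hc
    exact ht (Submodule.smul_mem _ _ (smul_mem_hPow (hN r' (not_le.1 hc) A' B') _))
  have h3 : ¬ (l + r' < Nb ∨ M + (r + r') - (l + r') < Na) := fun hc =>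
    ht (Submodule.smul_mem _ _ (Submodule.smul_mem _ _ (h _ _ hc)))
  simp only [Set.mem_prod, Set.mem_Icc]
  omega

/-- The bijection `(l, r, r') ↦ ((r + r', l + r'), r)`. -/
def tripleEquiv : ℤ × ℤ × ℤ ≃ (ℤ × ℤ) × ℤ where
  toFun t := ((t.2.1 + t.2.2, t.1 + t.2.2), t.2.1)
  invFun u := (u.1.2 - (u.1.1 - u.2), u.2, u.1.1 - u.2)
  left_inv t := by ext <;> simp
  right_inv u := by ext <;> simp

-- The change of variables (l, r, r') ↦ (r + r', l + r', r). Splitting e(l) = e(l + r') g(r') moves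
-- the weight of the specialization x_{n+2} = z e^{-h/2} onto the second R-matrix, where it becomes
-- the shift of the argument.
include hW in
theorem hSum_triple {x : ℤ → ℤ → W} {a b e g : ℤ → ℂ⟦X⟧} (heg : ∀ l r', e l = e (l + r') * g r')
    (h1 : IsNull fun t : ℤ × ℤ × ℤ => a t.2.1 • b t.2.2 • x (t.2.1 + t.2.2) (t.1 + t.2.2))
    (h3 : ∀ l r, IsNull fun r' => b r' • x (r + r') (l + r')) :
    IsNull (fun u : (ℤ × ℤ) × ℤ => (a u.2 * (g (u.1.1 - u.2) * b (u.1.1 - u.2))) • x u.1.1 u.1.2) ∧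
    (hSum fun l : ℤ => e l • hSum fun r => a r • hSum fun r' => b r' • x (r + r') (l + r')) =
    hSum fun u : ℤ × ℤ => e u.2 • hSum fun r => (a r * (g (u.1 - r) * b (u.1 - r))) • x u.1 u.2 := by
  have h1' : IsNull (fun u : (ℤ × ℤ) × ℤ =>
      (a u.2 * (g (u.1.1 - u.2) * b (u.1.1 - u.2))) • x u.1.1 u.1.2) := by
    have := (h1.comp_injective tripleEquiv.symm.injective).smul fun u => g (u.1.1 - u.2)
    refine this.mono fun k u hu => ?_
    convert hu using 1
    rw [Function.comp_apply, smul_smul, smul_smul]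
    simp only [tripleEquiv, Equiv.coe_fn_symm_mk]
    rw [show u.2 + (u.1.1 - u.2) = u.1.1 by ring,
      show u.1.2 - (u.1.1 - u.2) + (u.1.1 - u.2) = u.1.2 by ring]
    congr 1
    ring
  refine ⟨h1', ?_⟩
  have h2 : ∀ l, IsNull fun r => a r • hSum fun r' => b r' • x (r + r') (l + r') := by
    intro l
    simp only [smul_hSum hW _ (h3 l _)]
    exact IsNull.hSum hW (h1.comp_injective (Prod.mk_right_injective l))
  have h4 : ∀ u : ℤ × ℤ, IsNull fun r => (a r * (g (u.1 - r) * b (u.1 - r))) • x u.1 u.2 := fun u => by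
    have := h1'.comp_injective (Prod.mk_right_injective u)
    exact this
  simp only [smul_hSum hW _ (h2 _), smul_hSum hW _ (h4 _)]
  simp only [smul_hSum hW _ (h3 _ _)]
  have h5 : ∀ l r, IsNull fun r' => a r • b r' • x (r + r') (l + r') := fun l r =>
    (h3 l r).smul _
  simp only [smul_hSum hW _ (h5 _ _)]
  rw [hSum_prod hW (h1'.smul fun u => e u.1.2), ← hSum_equiv tripleEquiv]
  have h6 := h1.smul fun t => e t.1
  have h7 : ∀ l : ℤ, (hSum fun r => hSum fun r' => e l • a r • b r' • x (r + r') (l + r')) =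
      hSum fun t : ℤ × ℤ => e l • a t.1 • b t.2 • x (t.1 + t.2) (l + t.2) := fun l =>
    hSum_prod hW (h6.comp_injective (Prod.mk_right_injective l))
  simp only [h7]
  rw [hSum_prod hW h6]
  refine congrArg hSum (funext fun t => ?_)
  simp only [tripleEquiv, Equiv.coe_fn_mk, smul_smul]
  rw [show t.2.1 + t.2.2 - t.2.1 = t.2.2 by ring, heg t.1 t.2.2]
  congr 1
  ring

-- For a fixed total degree R, the sum over r and over the matrix indices is a coefficient of a
-- constant, so only the slice R = 0 survives.
include hW in
theorem sum_hSum_of_delta {β : Type*} [Fintype β] {A : β → ℂ⟦X⟧} {c : β → ℤ → ℤ → ℂ⟦X⟧}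
    {x : ℤ → ℤ → W} {e : ℤ → ℂ⟦X⟧} {δ : ℂ⟦X⟧} (hx : IsNull fun l => x 0 l)
    (hn : ∀ q, IsNull fun u : (ℤ × ℤ) × ℤ => c q u.1.1 u.2 • x u.1.1 u.1.2)
    (hδ : ∀ (R : ℤ) (k : ℕ), ∃ F : Finset ℤ, ∀ F', F ⊆ F' →
      PowerSeries.X ^ k ∣ (if R = 0 then δ else 0) - ∑ r ∈ F', ∑ q, A q * c q R r) :
    ∑ q, A q • (hSum fun u : ℤ × ℤ => e u.2 • hSum fun r => c q u.1 r • x u.1 u.2) =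
      δ • hSum fun l : ℤ => e l • x 0 l := by
  have hn1 : ∀ q, IsNull fun u : ℤ × ℤ => e u.2 • hSum fun r => c q u.1 r • x u.1 u.2 := fun q =>
    (IsNull.hSum hW (hn q)).smul _
  have e1 : ∀ u : ℤ × ℤ, (∑ q, A q • hSum fun r => c q u.1 r • x u.1 u.2) =
      (if u.1 = 0 then δ else 0) • x u.1 u.2 := by
    intro u
    have hn2 : ∀ q, IsNull fun r => c q u.1 r • x u.1 u.2 := fun q =>
      (hn q).comp_injective (Prod.mk_right_injective u)
    rw [← hSum_smul_const hW _ (hδ u.1)]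
    simp only [Finset.sum_smul, mul_smul]
    rw [hSum_sum hW fun q _ => (hn2 q).smul _]
    exact Finset.sum_congr rfl fun q _ => smul_hSum hW _ (hn2 q)
  have hn4 : IsNull fun u : ℤ × ℤ => e u.2 • (if u.1 = 0 then δ else 0) • x u.1 u.2 := by
    have := IsNull.sum (F := Finset.univ) fun q _ => (hn1 q).smul fun _ => A q
    refine this.mono fun k u hu => ?_
    convert hu using 1
    rw [← e1, Finset.smul_sum]
    exact Finset.sum_congr rfl fun q _ => smul_comm _ _ _
  rw [← hSum_smul_sum_smul hW _ _ hn1]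
  simp only [e1]
  rw [← hSum_injective hW hn4 (e := fun l : ℤ => ((0 : ℤ), l)) (Prod.mk_right_injective 0),
    smul_hSum hW _ (hx.smul _)]
  · exact congrArg hSum (funext fun l => by rw [if_pos rfl, smul_comm])
  · rintro ⟨R, l⟩ hl
    have : R ≠ 0 := fun h => hl ⟨l, by rw [h]⟩
    rw [if_neg this, zero_smul, smul_zero]

-- For fixed R and final exponent l, the sum over r and the intermediate indices is the coefficient
-- of z^R in the crossing relation. This collapses two R-matrix factors to a Kronecker delta in the
-- auxiliary index.
include hW in
theorem crossing_sum {s : ℂ⟦X⟧} (hs : PowerSeries.X ∣ s) (hs0 : s ≠ 0) (K : Fin 2)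
    {x : (Fin 2 → Fin 2) → Fin 2 → (Fin 2 → Fin 2) → ℤ → ℤ → W}
    (hx : ∀ I k' j k, ∃ N N' : ℤ, ∀ R l : ℤ, l < N ∨ M + R - l < N' → x I k' j R l ∈ hPow W k) :
    (∑ q : (Fin 2 → Fin 2) × (Fin 2 → Fin 2), antisym q.1 q.2 • ∑ p : Fin 2 × Fin 2,
      ∑ p' : Fin 2 × Fin 2, hSum fun l : ℤ => hExp (-(l : ℂ) / 2) • hSum fun r =>
        Rinfty s r (K, q.2 0) p • hSum fun r' => Rinfty s r' (p.1, q.2 1) p' •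
          x q.1 p'.1 ![p.2, p'.2] (r + r') (l + r')) =
    ∑ q : (Fin 2 → Fin 2) × (Fin 2 → Fin 2), antisym q.1 q.2 •
      hSum fun l : ℤ => hExp (-(l : ℂ) / 2) • x q.1 K q.2 0 l := by
  have hρ : UpperNull (Rinfty s) := Rinfty_eventually s
  have h3 : ∀ I k' j A' B' l r, IsNull fun r' =>
      Rinfty s r' A' B' • x I k' j (r + r') (l + r') := by
    intro I k' j A' B' l r
    refine hρ.isNull_smul A' B' fun k => ?_
    obtain ⟨N, N', h⟩ := hx I k' j k
    exact ⟨N - l, fun r' hr' => h _ _ (Or.inl (by omega))⟩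
  have htr := fun I k' j A B A' B' => hSum_triple hW (x := x I k' j) (a := fun r => Rinfty s r A B)
    (b := fun r => Rinfty s r A' B') (e := fun l => hExp (-(l : ℂ) / 2))
    (g := fun r => hExp ((r : ℂ) / 2)) (fun l r' => by
      rw [← hExp_add]; congr 1; push_cast; ring) (isNull_triple hρ M A B A' B' (hx I k' j))
      (h3 I k' j A' B')
  obtain ⟨c, hc⟩ : ∃ c : (Fin 2 → Fin 2) → (Fin 2 → Fin 2) → Fin 2 → Fin 2 → ℤ → ℤ → ℂ⟦X⟧,
      ∀ j J k k' R r, Rinfty s r (K, J 0) (k, j 0) * (hExp (((R - r : ℤ) : ℂ) / 2) *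
        Rinfty s (R - r) (k, J 1) (k', j 1)) = c j J k k' R r := ⟨_, fun _ _ _ _ _ _ => rfl⟩
  have step : ∀ I k' j, (∑ q : (Fin 2 → Fin 2) × Fin 2, antisym I q.1 • hSum fun u : ℤ × ℤ =>
      hExp (-(u.2 : ℂ) / 2) • hSum fun r => c j q.1 q.2 k' u.1 r • x I k' j u.1 u.2) =
      (if K = k' then antisym I j else 0) •
        hSum fun l : ℤ => hExp (-(l : ℂ) / 2) • x I k' j 0 l := by
    intro I k' j
    refine sum_hSum_of_delta hW (A := fun q : (Fin 2 → Fin 2) × Fin 2 => antisym I q.1)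
      (c := fun q => c j q.1 q.2 k') (e := fun l => hExp (-(l : ℂ) / 2)) ?_ (fun q => ?_) ?_
    · intro k
      obtain ⟨N, N', h⟩ := hx I k' j k
      refine (Set.finite_Icc N (M - N')).subset fun l hl => ?_
      by_contra hc
      rw [Set.mem_Icc, not_and_or] at hc
      exact hl (h 0 l (by omega))
    · have := (htr I k' j (K, q.1 0) (q.2, j 0) (q.2, q.1 1) (k', j 1)).1
      simp only [hc] at this
      exact this
    · intro R k
      obtain ⟨F, hF⟩ := Rinfty_crossing hs hs0 I j K k' R k
      refine ⟨F, fun F' hF' => ?_⟩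
      have := hF F' hF'
      simp only [hc, Finset.mul_sum] at this
      rw [Finset.sum_comm, Fintype.sum_prod_type]
      exact this
  have key : ∀ q : (Fin 2 → Fin 2) × (Fin 2 → Fin 2), ∀ p p' : Fin 2 × Fin 2,
      (hSum fun l : ℤ => hExp (-(l : ℂ) / 2) • hSum fun r =>
        Rinfty s r (K, q.2 0) p • hSum fun r' => Rinfty s r' (p.1, q.2 1) p' •
          x q.1 p'.1 ![p.2, p'.2] (r + r') (l + r')) =
      hSum fun u : ℤ × ℤ => hExp (-(u.2 : ℂ) / 2) •
        hSum fun r => c ![p.2, p'.2] q.2 p.1 p'.1 u.1 r • x q.1 p'.1 ![p.2, p'.2] u.1 u.2 := by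
    intro q p p'
    have := (htr q.1 p'.1 ![p.2, p'.2] (K, q.2 0) p (p.1, q.2 1) p').2
    rw [this]
    simp only [← hc]
    rfl
  simp only [key, Finset.smul_sum, Fintype.sum_prod_type]
  simp only [Fintype.sum_prod_type] at step
  refine Finset.sum_congr rfl fun I _ => ?_
  obtain ⟨y, hy'⟩ : ∃ y : (Fin 2 → Fin 2) → (Fin 2 → Fin 2) → Fin 2 → Fin 2 → W, ∀ j J k k',
      (antisym I J • hSum fun u : ℤ × ℤ => hExp (-(u.2 : ℂ) / 2) • hSum fun r =>
        c j J k k' u.1 r • x I k' j u.1 u.2) = y j J k k' := ⟨_, fun _ _ _ _ => rfl⟩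
  simp only [hy']
  have step' := step I
  simp only [hy'] at step'
  -- Regroup the index pairs (k, j0) and (k', j1) so that J and k are summed innermost, where the
  -- crossing relation applies.
  calc _ = ∑ k', ∑ j0, ∑ j1, ∑ J, ∑ k, y ![j0, j1] J k k' := by
        simp only [Fin.sum_univ_two, Finset.sum_add_distrib]
        abel
    _ = ∑ k', ∑ j : Fin 2 → Fin 2, ∑ J, ∑ k, y j J k k' := by
        refine Finset.sum_congr rfl fun k' _ => ?_
        rw [sum_fin_two_fun]
        simp only [Fin.sum_univ_two]
    _ = _ := by
        simp only [step', ite_smul, zero_smul]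
        rw [Finset.sum_comm]
        simp

end Absorb

/-! ### Index tuples split into the first n and the last two places. -/

section Append

variable {α : Type*} {n l : ℕ}

theorem update_append_left (f : Fin n → α) (g : Fin l → α) (i : Fin n) (x : α) :
    Function.update (Fin.append f g) (Fin.castAdd l i) x = Fin.append (Function.update f i x) g := by
  funext y
  refine Fin.addCases (fun j => ?_) (fun j => ?_) y
  · by_cases h : j = i
    · subst h; simp
    · rw [Function.update_of_ne (fun h' => h (Fin.castAdd_injective n l h')), Fin.append_left,
        Fin.append_left, Function.update_of_ne h]
  · rw [Function.update_of_ne (by simp [Fin.ext_iff]; omega), Fin.append_right, Fin.append_right]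

theorem update_append_right (f : Fin n → α) (g : Fin l → α) (i : Fin l) (x : α) :
    Function.update (Fin.append f g) (Fin.natAdd n i) x = Fin.append f (Function.update g i x) := by
  funext y
  refine Fin.addCases (fun j => ?_) (fun j => ?_) y
  · rw [Function.update_of_ne (by simp [Fin.ext_iff]; omega), Fin.append_left, Fin.append_left]
  · by_cases h : j = i
    · subst h; simp
    · rw [Function.update_of_ne (fun h' => h (Fin.natAdd_injective l n h')), Fin.append_right,
        Fin.append_right, Function.update_of_ne h]

theorem shift_append_left (m : Fin n → ℤ) (m' : Fin l → ℤ) (i j : Fin n) (r : ℤ) :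
    shift (Fin.append m m') (Fin.castAdd l i) (Fin.castAdd l j) r =
      Fin.append (shift m i j r) m' := by
  funext y
  refine Fin.addCases (fun x => ?_) (fun x => ?_) y
  · rw [shift_apply, Fin.append_left, Fin.append_left, shift_apply]
    simp only [(Fin.castAdd_injective n l).eq_iff]
  · rw [shift_apply_of_ne _ (by simp [Fin.ext_iff]; omega) (by simp [Fin.ext_iff]; omega),
      Fin.append_right, Fin.append_right]

theorem shift_append_right (m : Fin n → ℤ) (m' : Fin l → ℤ) (i : Fin n) (j : Fin l) (r : ℤ) :
    shift (Fin.append m m') (Fin.castAdd l i) (Fin.natAdd n j) r =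
      Fin.append (m - Pi.single i r) (m' + Pi.single j r) := by
  funext y
  refine Fin.addCases (fun x => ?_) (fun x => ?_) y
  · have h : Fin.castAdd l x ≠ Fin.natAdd n j := by simp [Fin.ext_iff]; omega
    rw [shift_apply, Fin.append_left, Fin.append_left, if_neg h, add_zero, Pi.sub_apply,
      Pi.single_apply]
    simp only [(Fin.castAdd_injective n l).eq_iff]
  · have h : Fin.natAdd n x ≠ Fin.castAdd l i := by simp [Fin.ext_iff]; omega
    rw [shift_apply, Fin.append_right, Fin.append_right, if_neg h, sub_zero, Pi.add_apply,
      Pi.single_apply]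
    simp only [(Fin.natAdd_injective l n).eq_iff]

end Append

/-! ### The trace over the last two factors at (z, z e^{-h/2}). -/

section Trace

variable {W : Type*} [AddCommGroup W] [Module ℂ⟦X⟧ W] {n : ℕ}

/-- The coefficient of `z^M` in `tr_{n+1,n+2} A_{n+1,n+2} S(x_1, …, x_n, z, z e^{-h/2})`. -/
def qTrace (M : ℤ) (S : Dist (n + 2) W) : Dist n W := fun m => Matrix.of fun K K' =>
  ∑ q : (Fin 2 → Fin 2) × (Fin 2 → Fin 2), antisym q.1 q.2 • hSum fun l : ℤ =>
    hExp (-(l : ℂ) / 2) • S (Fin.append m ![M - l, l]) (Fin.append K q.2) (Fin.append K' q.1)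

theorem qTrace_apply (M : ℤ) (S : Dist (n + 2) W) (m : Fin n → ℤ) (K K' : Fin n → Fin 2) :
    qTrace M S m K K' = ∑ q : (Fin 2 → Fin 2) × (Fin 2 → Fin 2), antisym q.1 q.2 • hSum fun l : ℤ =>
      hExp (-(l : ℂ) / 2) •
        S (Fin.append m ![M - l, l]) (Fin.append K q.2) (Fin.append K' q.1) := rfl

/-- The distributions for which the trace is well behaved. -/
structure Tame (S : Dist (n + 2) W) : Prop where
  lowerFinite : LowerFinite S
  suppBdd : SuppBdd (Fin.natAdd n 0) S

/-- No variable follows the last one, so `LowerFinite` there gives a bound with nothing held fixed.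
-/
theorem Tame.suppBdd' {S : Dist (n + 2) W} (hS : Tame S) : SuppBdd (Fin.natAdd n 1) S := by
  intro k
  obtain ⟨N, hN⟩ := hS.lowerFinite k (Fin.natAdd n 1) 0
  refine ⟨N, fun m hm => hN m (fun i hi => ?_) hm⟩
  have := i.isLt
  rw [Fin.lt_def, Fin.val_natAdd] at hi
  simp at hi
  omega

theorem Tame.bounds {S : Dist (n + 2) W} (hS : Tame S) (k : ℕ) : ∃ N N' : ℤ,
    ∀ (m : Fin n → ℤ) (x y : ℤ), y < N ∨ x < N' → ∀ I J, S (Fin.append m ![x, y]) I J ∈ hPow W k := by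
  obtain ⟨N', h'⟩ := hS.suppBdd k
  obtain ⟨N, h⟩ := hS.suppBdd' k
  refine ⟨N, N', fun m x y hxy => ?_⟩
  rcases hxy with hy | hx
  · exact h _ (by rw [Fin.append_right]; exact hy)
  · exact h' _ (by rw [Fin.append_right]; exact hx)

theorem Tame.isNull {S : Dist (n + 2) W} (hS : Tame S) (M : ℤ) (m : Fin n → ℤ)
    (I J : Fin (n + 2) → Fin 2) : IsNull fun l : ℤ => S (Fin.append m ![M - l, l]) I J := by
  intro k
  obtain ⟨N, N', h⟩ := hS.bounds k
  refine (Set.finite_Icc N (M - N')).subset fun l hl => ?_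
  by_contra hc
  rw [Set.mem_Icc, not_and_or] at hc
  exact hl (h m _ _ (by omega) I J)

variable {ρ : ℤ → Matrix (Fin 2 × Fin 2) (Fin 2 × Fin 2) ℂ⟦X⟧} (hρ : UpperNull ρ)
include hρ

/-- Modulo h^k the exponent l is confined to a finite interval by the bounds on the last two
variables. For each such l, r is bounded above by ρ and below by `LowerFinite` at x_j. -/
theorem Tame.isNull_shift {S : Dist (n + 2) W} (hS : Tame S) (M : ℤ) (m : Fin n → ℤ)
    {i j : Fin n} (hij : i < j) (A B : Fin 2 × Fin 2) (I J : Fin (n + 2) → Fin 2) :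
    IsNull fun p : ℤ × ℤ => ρ p.2 A B • S (Fin.append (shift m i j p.2) ![M - p.1, p.1]) I J := by
  intro k
  obtain ⟨N, N', h⟩ := hS.bounds k
  obtain ⟨N₁, h₁⟩ := hρ k
  choose N₂ h₂ using fun l : ℤ =>
    hS.lowerFinite k (Fin.castAdd 2 j) (Fin.append m ![M - l, l])
  refine ((Set.finite_Icc N (M - N')).biUnion fun l _ =>
    (Set.finite_singleton l).prod (Set.finite_Icc (N₂ l - m j) N₁)).subset ?_
  rintro ⟨l, r⟩ hlr
  have hl : l ∈ Set.Icc N (M - N') := by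
    by_contra hc
    rw [Set.mem_Icc, not_and_or] at hc
    exact hlr (Submodule.smul_mem _ _ (h _ _ _ (by omega) I J))
  refine Set.mem_biUnion hl ⟨rfl, ?_⟩
  by_contra hc
  simp only [Set.mem_Icc, not_and_or, not_le] at hc
  rcases hc with hc | hc
  · refine hlr (Submodule.smul_mem _ _ (h₂ l _ (fun x hx => ?_) ?_ I J))
    · rw [← shift_append_left]
      exact shift_apply_of_ne _ ((show Fin.castAdd 2 i < Fin.castAdd 2 j from hij).trans hx).ne'
        hx.ne' _
    · rw [Fin.append_left, shift_apply_right _ hij.ne]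
      omega
  · exact hlr (smul_mem_hPow (h₁ r hc A B) _)

variable (hW : TopologicallyFree W)
include hW

theorem Tame.mulLeft {S : Dist (n + 2) W} (hS : Tame S) (i : Fin n) {j : Fin (n + 2)}
    (hij : Fin.castAdd 2 i < j) : Tame (mulLeft ρ (Fin.castAdd 2 i) j S) :=
  ⟨hS.lowerFinite.mulLeft hρ hW hij, hS.suppBdd.mulLeft hρ hW hij
    (by have := i.isLt; simp [Fin.ext_iff]; omega) hS.lowerFinite⟩

/-- R_{ij} with i, j ≤ n involves neither the tensor factors nor the variables of the trace. The
content is the exchange of the two h-adic sums, justified by joint nullity. -/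
theorem qTrace_mulLeft {S : Dist (n + 2) W} (hS : Tame S) (M : ℤ) {i j : Fin n} (hij : i < j) :
    qTrace M (EllipticFRT.mulLeft ρ (Fin.castAdd 2 i) (Fin.castAdd 2 j) S) =
      EllipticFRT.mulLeft ρ i j (qTrace M S) := by
  funext m
  ext K K'
  rw [qTrace_apply, mulLeft_apply]
  simp only [mulLeft_apply, qTrace_apply, Fin.append_left, update_append_left, shift_append_left]
  have hr : ∀ l A B I J, IsNull fun r =>
      ρ r A B • S (Fin.append (shift m i j r) ![M - l, l]) I J := fun l A B I J => by
    have := (hS.isNull_shift hρ M m hij A B I J).comp_injective (Prod.mk_right_injective l)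
    exact this
  have hjoint : ∀ A B I J, IsNull fun p : ℤ × ℤ =>
      hExp (-(p.1 : ℂ) / 2) • ρ p.2 A B • S (Fin.append (shift m i j p.2) ![M - p.1, p.1]) I J :=
    fun A B I J => (hS.isNull_shift hρ M m hij A B I J).smul _
  have hl : ∀ r I J, IsNull fun l : ℤ =>
      hExp (-(l : ℂ) / 2) • S (Fin.append (shift m i j r) ![M - l, l]) I J := fun r I J =>
    (hS.isNull M _ I J).smul _
  have hout : ∀ A B I J, IsNull fun l : ℤ => hExp (-(l : ℂ) / 2) • hSum fun r =>
      ρ r A B • S (Fin.append (shift m i j r) ![M - l, l]) I J := fun A B I J =>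
    (IsNull.hSum hW (hS.isNull_shift hρ M m hij A B I J)).smul _
  have hout' : ∀ A B I J, IsNull fun r : ℤ => ρ r A B • hSum fun l : ℤ =>
      hExp (-(l : ℂ) / 2) • S (Fin.append (shift m i j r) ![M - l, l]) I J := fun A B I J => by
    have h1 := (hjoint A B I J).comp_injective (Equiv.prodComm ℤ ℤ).injective
    have h2 := IsNull.hSum hW h1
    convert h2 using 2 with r
    rw [smul_hSum hW _ (hl r I J)]
    exact congrArg hSum (funext fun l => smul_comm _ _ _)
  have e1 : ∀ q : (Fin 2 → Fin 2) × (Fin 2 → Fin 2), _ := fun q =>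
    hSum_smul_sum hW (fun l : ℤ => hExp (-(l : ℂ) / 2)) (g := fun (p : Fin 2 × Fin 2) l =>
      hSum fun r => ρ r (K i, K j) p • S (Fin.append (shift m i j r) ![M - l, l])
        (Fin.append (Function.update (Function.update K i p.1) j p.2) q.2) (Fin.append K' q.1))
      fun p => hout _ _ _ _
  have e2 : ∀ p : Fin 2 × Fin 2, _ := fun p =>
    hSum_smul_sum_smul hW (fun r => ρ r (K i, K j) p)
      (fun q : (Fin 2 → Fin 2) × (Fin 2 → Fin 2) => antisym q.1 q.2)
      (g := fun (q : (Fin 2 → Fin 2) × (Fin 2 → Fin 2)) r => hSum fun l : ℤ =>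
        hExp (-(l : ℂ) / 2) • S (Fin.append (shift m i j r) ![M - l, l])
          (Fin.append (Function.update (Function.update K i p.1) j p.2) q.2) (Fin.append K' q.1))
      fun q => hout' _ _ _ _
  simp only [e1, e2]
  simp only [Finset.smul_sum]
  rw [Finset.sum_comm]
  refine Finset.sum_congr rfl fun p _ => Finset.sum_congr rfl fun q _ => ?_
  rw [hSum_smul_comm hW _ _ (fun l => hr l _ _ _ _) (fun r => hl r _ _) (hjoint _ _ _ _)]

end Trace

/-! ### Absorption of R_{i,n+1} R_{i,n+2} by the antisymmetrizer. -/

section Absorption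

variable {W : Type*} [AddCommGroup W] [Module ℂ⟦X⟧ W] {n : ℕ} (hW : TopologicallyFree W)
include hW

theorem isNull_hSum_triple {x : ℤ → ℤ → W} {a b : ℤ → ℂ⟦X⟧}
    (h1 : IsNull fun t : ℤ × ℤ × ℤ => a t.2.1 • b t.2.2 • x (t.2.1 + t.2.2) (t.1 + t.2.2))
    (h3 : ∀ l r, IsNull fun r' => b r' • x (r + r') (l + r')) :
    (∀ l, IsNull fun r => a r • hSum fun r' => b r' • x (r + r') (l + r')) ∧
      IsNull fun l => hSum fun r => a r • hSum fun r' => b r' • x (r + r') (l + r') := by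
  simp only [smul_hSum hW _ (h3 _ _)]
  refine ⟨fun l => IsNull.hSum hW (h1.comp_injective (Prod.mk_right_injective l)), ?_⟩
  have h7 : ∀ l : ℤ, (hSum fun r => hSum fun r' => a r • b r' • x (r + r') (l + r')) =
      hSum fun t : ℤ × ℤ => a t.1 • b t.2 • x (t.1 + t.2) (l + t.2) := fun l =>
    hSum_prod hW (h1.comp_injective (Prod.mk_right_injective l))
  simp only [h7]
  exact IsNull.hSum hW h1

/-- Under the trace the two factors have arguments x_i/z and q x_i/z, the arguments of the crossing
relation. Tameness makes the specialization converge jointly with the two R-matrix expansions. -/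
theorem qTrace_absorb {s : ℂ⟦X⟧} (hs : PowerSeries.X ∣ s) (hs0 : s ≠ 0) {S : Dist (n + 2) W}
    (hS : Tame S) (M : ℤ) (i : Fin n) :
    qTrace M (mulLeft (Rinfty s) (Fin.castAdd 2 i) (Fin.natAdd n 0)
      (mulLeft (Rinfty s) (Fin.castAdd 2 i) (Fin.natAdd n 1) S)) = qTrace M S := by
  have hρ : UpperNull (Rinfty s) := Rinfty_eventually s
  have hlt : ∀ j : Fin 2, Fin.castAdd 2 i < Fin.natAdd n j := fun j => by
    have := i.isLt
    rw [Fin.lt_def, Fin.val_castAdd, Fin.val_natAdd]; omega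
  have hS' := hS.mulLeft hρ hW i (hlt 1)
  funext m
  ext K K'
  -- The two factors lower the exponent of x_i by R = r + r' and raise the total degree of the last
  -- two variables to M + R. A coefficient of S therefore depends on the shifts only through R and
  -- the final exponent l.
  let x : (Fin 2 → Fin 2) → Fin 2 → (Fin 2 → Fin 2) → ℤ → ℤ → W := fun I k' j R l =>
    S (Fin.append (m - Pi.single i R) ![M + R - l, l]) (Fin.append (Function.update K i k') j)
      (Fin.append K' I)
  have hx : ∀ I k' j k, ∃ N N' : ℤ, ∀ R l : ℤ, l < N ∨ M + R - l < N' →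
      x I k' j R l ∈ hPow W k := by
    intro I k' j k
    obtain ⟨N, N', h⟩ := hS.bounds k
    exact ⟨N, N', fun R l hRl => h _ _ _ hRl _ _⟩
  have key := crossing_sum hW M hs hs0 (K i) hx
  have inner : ∀ (q : (Fin 2 → Fin 2) × (Fin 2 → Fin 2)) (p : Fin 2 × Fin 2) (l r : ℤ),
      mulLeft (Rinfty s) (Fin.castAdd 2 i) (Fin.natAdd n 1) S
        (shift (Fin.append m ![M - l, l]) (Fin.castAdd 2 i) (Fin.natAdd n 0) r)
        (Function.update (Function.update (Fin.append K q.2) (Fin.castAdd 2 i) p.1)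
          (Fin.natAdd n 0) p.2) (Fin.append K' q.1) =
      ∑ p' : Fin 2 × Fin 2, hSum fun r' => Rinfty s r' (p.1, q.2 1) p' •
        x q.1 p'.1 ![p.2, p'.2] (r + r') (l + r') := by
    intro q p l r
    rw [mulLeft_apply, update_append_left, update_append_right, Fin.append_left, Fin.append_right,
      Function.update_self, Function.update_of_ne (show (1 : Fin 2) ≠ 0 by decide)]
    refine Finset.sum_congr rfl fun p' _ => congrArg hSum (funext fun r' => ?_)
    rw [shift_append_right, shift_append_right, update_append_left, update_append_right,
      Function.update_idem]
    have h1 : (![M - l, l] : Fin 2 → ℤ) + Pi.single 0 r + Pi.single 1 r' =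
        ![M + (r + r') - (l + r'), l + r'] := by
      refine funext (Fin.forall_fin_two.2 ⟨?_, ?_⟩)
      · rw [Pi.add_apply, Pi.add_apply, Pi.single_eq_same, Pi.single_eq_of_ne (by decide)]
        show M - l + r + 0 = M + (r + r') - (l + r')
        ring
      · rw [Pi.add_apply, Pi.add_apply, Pi.single_eq_same, Pi.single_eq_of_ne (by decide)]
        show l + 0 + r' = l + r'
        ring
    have h2 : Function.update (Function.update q.2 0 p.2) 1 p'.2 = ![p.2, p'.2] := by
      funext y
      fin_cases y <;> rfl
    have h3 : m - Pi.single i r - Pi.single i r' = m - Pi.single i (r + r') := by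
      rw [Pi.single_add, sub_sub]
    rw [h1, h2, h3]
  have hn : ∀ (q : (Fin 2 → Fin 2) × (Fin 2 → Fin 2)) (p p' : Fin 2 × Fin 2), _ := fun q p p' =>
    isNull_hSum_triple hW (x := x q.1 p'.1 ![p.2, p'.2])
      (a := fun r => Rinfty s r (K i, q.2 0) p) (b := fun r => Rinfty s r (p.1, q.2 1) p')
      (isNull_triple hρ M (K i, q.2 0) p (p.1, q.2 1) p' (hx q.1 p'.1 ![p.2, p'.2])) fun l r => by
        refine hρ.isNull_smul (p.1, q.2 1) p' fun k => ?_
        obtain ⟨N, N', h⟩ := hx q.1 p'.1 ![p.2, p'.2] k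
        exact ⟨N - l, fun r' hr' => h _ _ (Or.inl (by omega))⟩
  have outer : ∀ (q : (Fin 2 → Fin 2) × (Fin 2 → Fin 2)) (l : ℤ),
      mulLeft (Rinfty s) (Fin.castAdd 2 i) (Fin.natAdd n 0)
        (mulLeft (Rinfty s) (Fin.castAdd 2 i) (Fin.natAdd n 1) S) (Fin.append m ![M - l, l])
        (Fin.append K q.2) (Fin.append K' q.1) =
      ∑ u : (Fin 2 × Fin 2) × (Fin 2 × Fin 2), hSum fun r => Rinfty s r (K i, q.2 0) u.1 •
        hSum fun r' => Rinfty s r' (u.1.1, q.2 1) u.2 •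
          x q.1 u.2.1 ![u.1.2, u.2.2] (r + r') (l + r') := by
    intro q l
    rw [mulLeft_apply, Fintype.sum_prod_type (α₁ := Fin 2 × Fin 2)]
    refine Finset.sum_congr rfl fun p _ => ?_
    rw [← hSum_smul_sum hW _ fun p' => (hn q p p').1 l, Fin.append_left, Fin.append_right]
    simp only [inner]
  have hq : ∀ q : (Fin 2 → Fin 2) × (Fin 2 → Fin 2), _ := fun q =>
    hSum_smul_sum hW (fun l : ℤ => hExp (-(l : ℂ) / 2)) (g := fun
      (u : (Fin 2 × Fin 2) × (Fin 2 × Fin 2)) l => hSum fun r => Rinfty s r (K i, q.2 0) u.1 •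
        hSum fun r' => Rinfty s r' (u.1.1, q.2 1) u.2 •
          x q.1 u.2.1 ![u.1.2, u.2.2] (r + r') (l + r')) fun u => ((hn q u.1 u.2).2).smul _
  rw [qTrace_apply, qTrace_apply]
  simp only [outer, hq]
  simp only [Fintype.sum_prod_type (α₁ := Fin 2 × Fin 2)]
  rw [key]
  simp only [x, Function.update_eq_self, Pi.single_zero, sub_zero, add_zero]

end Absorption

/-! ### Lexicographic ordering of the pairs i < j. -/

section Pairs

theorem finRange_add_two (n : ℕ) : List.finRange (n + 2) =
    (List.finRange n).map (Fin.castAdd 2) ++ [Fin.natAdd n 0, Fin.natAdd n 1] := by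
  rw [List.finRange_succ_last, List.finRange_succ_last, List.map_append, List.map_map,
    List.append_assoc]
  rfl

theorem orderedPairs_two : orderedPairs 2 = [(0, 1)] := by decide

/-- Row i of the lexicographic order ends with the adjacent pairs (i, n+1), (i, n+2), as absorption
requires, and the whole list ends with (n+1, n+2). -/
theorem orderedPairs_add_two (n : ℕ) : orderedPairs (n + 2) =
    ((List.finRange n).flatMap fun i =>
      (((List.finRange n).filter fun j => i < j).map fun j => (i, j)).map
        (fun p => (Fin.castAdd 2 p.1, Fin.castAdd 2 p.2)) ++
      [(Fin.castAdd 2 i, Fin.natAdd n 0), (Fin.castAdd 2 i, Fin.natAdd n 1)]) ++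
    [(Fin.natAdd n 0, Fin.natAdd n 1)] := by
  rw [orderedPairs, finRange_add_two, List.flatMap_append, List.flatMap_map]
  congr 1
  · congr 1
    funext i
    have h : ∀ j : Fin 2, Fin.castAdd 2 i < Fin.natAdd n j := fun j => by
      have := i.isLt
      rw [Fin.lt_def, Fin.val_castAdd, Fin.val_natAdd]; omega
    rw [List.filter_append, List.map_append, List.filter_map, List.map_map, List.map_map]
    congr 1
    simp [h]
  · have h0 : ∀ (i : Fin n) (j : Fin 2), ¬ Fin.natAdd n j < Fin.castAdd 2 i := fun i j => by
      have := i.isLt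
      rw [Fin.lt_def, Fin.val_castAdd, Fin.val_natAdd]; omega
    have h1 : ∀ i j : Fin 2, Fin.natAdd n i < Fin.natAdd n j ↔ i < j := fun i j => by
      rw [Fin.lt_def, Fin.val_natAdd, Fin.val_natAdd, Fin.lt_def]; omega
    have h2 : ∀ j : Fin 2, ((List.finRange n).map (Fin.castAdd 2)).filter
        (fun x => decide (Fin.natAdd n j < x)) = [] := fun j => by
      rw [List.filter_eq_nil_iff]
      intro x hx
      obtain ⟨i, _, rfl⟩ := List.mem_map.1 hx
      simp [h0]
    simp [List.filter_append, h2, h1, List.filter_cons]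

end Pairs

/-! ### The trace identity and invariance of the quantum determinant action. -/

section Bracket

variable {W : Type*} [AddCommGroup W] [Module ℂ⟦X⟧ W] {n : ℕ} (hW : TopologicallyFree W)
include hW

theorem qTrace_foldr_pairs {ρ : ℤ → Matrix (Fin 2 × Fin 2) (Fin 2 × Fin 2) ℂ⟦X⟧}
    (hρ : UpperNull ρ) (M : ℤ) {S : Dist (n + 2) W} (hS : Tame S) (P : List (Fin n × Fin n))
    (hP : ∀ p ∈ P, p.1 < p.2) :
    Tame ((P.map fun p => (Fin.castAdd 2 p.1, Fin.castAdd 2 p.2)).foldr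
      (fun ij S => mulLeft ρ ij.1 ij.2 S) S) ∧
    qTrace M ((P.map fun p => (Fin.castAdd 2 p.1, Fin.castAdd 2 p.2)).foldr
      (fun ij S => mulLeft ρ ij.1 ij.2 S) S) =
      P.foldr (fun ij S => mulLeft ρ ij.1 ij.2 S) (qTrace M S) := by
  induction P with
  | nil => exact ⟨hS, rfl⟩
  | cons p P ih =>
    obtain ⟨h1, h2⟩ := ih fun q hq => hP q (List.mem_cons_of_mem _ hq)
    have hp := hP p List.mem_cons_self
    rw [List.map_cons, List.foldr_cons, List.foldr_cons, ← h2]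
    exact ⟨h1.mulLeft hρ hW _ hp, qTrace_mulLeft hρ hW h1 M hp⟩

/-- Rows are treated from the outermost inwards: the R_{ij} with j ≤ n move out of the trace, after
which the two factors ending the row stand next to A and are absorbed. -/
theorem qTrace_foldr {s : ℂ⟦X⟧} (hs : PowerSeries.X ∣ s) (hs0 : s ≠ 0) (M : ℤ)
    {S : Dist (n + 2) W} (hS : Tame S) (L : List (Fin n)) :
    Tame ((L.flatMap fun i => (((List.finRange n).filter fun j => i < j).map fun j => (i, j)).map
        (fun p => (Fin.castAdd 2 p.1, Fin.castAdd 2 p.2)) ++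
      [(Fin.castAdd 2 i, Fin.natAdd n 0), (Fin.castAdd 2 i, Fin.natAdd n 1)]).foldr
        (fun ij S => mulLeft (Rinfty s) ij.1 ij.2 S) S) ∧
    qTrace M ((L.flatMap fun i =>
        (((List.finRange n).filter fun j => i < j).map fun j => (i, j)).map
        (fun p => (Fin.castAdd 2 p.1, Fin.castAdd 2 p.2)) ++
      [(Fin.castAdd 2 i, Fin.natAdd n 0), (Fin.castAdd 2 i, Fin.natAdd n 1)]).foldr
        (fun ij S => mulLeft (Rinfty s) ij.1 ij.2 S) S) =
      (L.flatMap fun i => ((List.finRange n).filter fun j => i < j).map fun j => (i, j)).foldr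
        (fun ij S => mulLeft (Rinfty s) ij.1 ij.2 S) (qTrace M S) := by
  have hρ : UpperNull (Rinfty s) := Rinfty_eventually s
  induction L with
  | nil => exact ⟨hS, rfl⟩
  | cons i L ih =>
    obtain ⟨h1, h2⟩ := ih
    have hlt : ∀ j : Fin 2, Fin.castAdd 2 i < Fin.natAdd n j := fun j => by
      have := i.isLt
      rw [Fin.lt_def, Fin.val_castAdd, Fin.val_natAdd]; omega
    rw [List.flatMap_cons, List.flatMap_cons, List.foldr_append, List.foldr_append,
      List.foldr_append, ← h2, ← qTrace_absorb hW hs hs0 h1 M i]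
    refine qTrace_foldr_pairs hW hρ M
      ((h1.mulLeft hρ hW i (hlt 1)).mulLeft hρ hW i (hlt 0)) _ fun p hp => ?_
    obtain ⟨j, hj, rfl⟩ := List.mem_map.1 hp
    simpa using (List.mem_filter.1 hj).2

omit hW in
theorem shift_append_natAdd {l : ℕ} (m : Fin n → ℤ) (m' : Fin l → ℤ) (i j : Fin l) (r : ℤ) :
    shift (Fin.append m m') (Fin.natAdd n i) (Fin.natAdd n j) r =
      Fin.append m (shift m' i j r) := by
  funext y
  refine Fin.addCases (fun x => ?_) (fun x => ?_) y
  · rw [shift_apply_of_ne _ (by simp [Fin.ext_iff]; omega) (by simp [Fin.ext_iff]; omega),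
      Fin.append_left, Fin.append_left]
  · rw [shift_apply, Fin.append_right, Fin.append_right, shift_apply]
    simp only [(Fin.natAdd_injective l n).eq_iff]

omit hW in
theorem bracket_two (a : ℝ) (b : ℕ) (𝓛 : OpSeries W) (w : W) :
    bracket a b 𝓛 2 w = mulLeft (Rinfty (nome a b)) 0 1 (opProd 𝓛 2 w) := by
  rw [bracket, orderedPairs_two]
  rfl

variable {a : ℝ} {b : ℕ} {c : ℂ} {𝓛 : OpSeries W} (h𝓛 : IsFRTOperator a b c 𝓛)
include h𝓛

/-- R_{n+1,n+2} has scalar entries and acts on the last two factors only, so the first n operators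
can be pulled out of its h-adic sum by linearity. -/
theorem mulLeft_opProd_append (w : W) (m : Fin n → ℤ) (e : Fin 2 → ℤ) (K K' : Fin n → Fin 2)
    (I J : Fin 2 → Fin 2) :
    mulLeft (Rinfty (nome a b)) (Fin.natAdd n 0) (Fin.natAdd n 1) (opProd 𝓛 (n + 2) w)
      (Fin.append m e) (Fin.append K J) (Fin.append K' I) =
      opCoeff 𝓛 m K K' (bracket a b 𝓛 2 w e J I) := by
  rw [bracket_two, mulLeft_apply, mulLeft_apply, map_sum]
  refine Finset.sum_congr rfl fun p _ => ?_
  rw [map_hSum hW hW _ ((opProd_lowerFinite h𝓛 2 w).isNull (Rinfty_eventually (nome a b))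
    (show (0 : Fin 2) < 1 by decide) e _ _ _ _)]
  refine congrArg hSum (funext fun r => ?_)
  rw [shift_append_natAdd, update_append_right, update_append_right, Fin.append_right,
    Fin.append_right, opProd_apply, opCoeff_append, map_smul]
  rfl

omit hW h𝓛 in
/-- The exponents `e` with `e 0 + e 1 = M` are parametrised by `e 1`. -/
def pairEquiv (M : ℤ) : ℤ ≃ {e : Fin 2 → ℤ // e 0 + e 1 = M} where
  toFun l := ⟨![M - l, l], by simp⟩
  invFun e := e.1 1
  left_inv l := rfl
  right_inv e := by
    ext y
    refine Fin.cases ?_ (fun y => ?_) y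
    · show M - e.1 1 = e.1 0
      have := e.2
      omega
    · rw [Subsingleton.elim y 0]
      rfl

omit hW h𝓛 in
theorem qdetAction_eq (w : W) (M : ℤ) : qdetAction a b 𝓛 w M =
    ∑ q : (Fin 2 → Fin 2) × (Fin 2 → Fin 2), antisym q.1 q.2 • hSum fun l : ℤ =>
      hExp (-(l : ℂ) / 2) • bracket a b 𝓛 2 w ![M - l, l] q.2 q.1 := by
  rw [qdetAction, Fintype.sum_prod_type]
  refine Finset.sum_congr rfl fun I _ => Finset.sum_congr rfl fun J _ => ?_
  rw [← hSum_equiv (pairEquiv M)]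
  rfl

variable {w : W} (hw : w ∈ invariants a b 𝓛)
include hw

-- Invariance for n = 2 leaves only the exponents 0 ≤ l ≤ M, so the specialization is a finite sum.
omit hW h𝓛 in
theorem bracket_two_isNull (M : ℤ) (I J : Fin 2 → Fin 2) :
    IsNull fun l : ℤ => bracket a b 𝓛 2 w ![M - l, l] I J := by
  intro k
  refine (Set.finite_Icc 0 M).subset fun l hl => ?_
  by_contra hc
  have h0 : bracket a b 𝓛 2 w ![M - l, l] = 0 := by
    refine hw 2 one_le_two _ ?_
    rw [Set.mem_Icc, not_and_or] at hc
    rcases hc with hc | hc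
    · exact ⟨1, by simpa using hc⟩
    · exact ⟨0, by simpa using hc⟩
  apply hl
  show bracket a b 𝓛 2 w ![M - l, l] I J ∈ hPow W k
  rw [h0]
  exact Submodule.zero_mem _

/-- Boundedness in x_{n+1} comes from invariance for n = 2: 𝓛_{[2]} w has no negative powers of its
first variable, and the first n operators act coefficientwise. -/
theorem tame_mulLeft_opProd (n : ℕ) : Tame (mulLeft (Rinfty (nome a b)) (Fin.natAdd n 0)
    (Fin.natAdd n 1) (opProd 𝓛 (n + 2) w)) := by
  refine ⟨(opProd_lowerFinite h𝓛 _ w).mulLeft (Rinfty_eventually _) hW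
    (by rw [Fin.lt_def, Fin.val_natAdd, Fin.val_natAdd]; simp), fun k => ⟨0, fun m hm I J => ?_⟩⟩
  rw [← Fin.append_castAdd_natAdd (f := m), ← Fin.append_castAdd_natAdd (f := I),
    ← Fin.append_castAdd_natAdd (f := J), mulLeft_opProd_append hW h𝓛, hw 2 one_le_two _ ⟨0, hm⟩]
  exact (congrArg _ (map_zero _)).mpr (Submodule.zero_mem _)

/-- The trace of `𝓛_{[n+2]}(x_1, …, x_n, z, z e^{-h/2}) w` is the action of `𝓛_{[n]}(x_1, …, x_n)`
on the action of the quantum determinant. -/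
theorem qTrace_bracket (ha : 0 < a) (hb : 0 < b) (M : ℤ) (n : ℕ) :
    qTrace M (bracket a b 𝓛 (n + 2) w) = bracket a b 𝓛 n (qdetAction a b 𝓛 w M) := by
  rw [bracket, orderedPairs_add_two, List.foldr_append, List.foldr_cons, List.foldr_nil,
    (qTrace_foldr hW (X_dvd_nome a hb) (nome_ne_zero ha b) M
      (tame_mulLeft_opProd hW h𝓛 hw n) _).2, bracket, orderedPairs]
  congr 1
  funext m
  ext K K'
  rw [qTrace_apply, opProd_apply, qdetAction_eq, map_sum]
  refine Finset.sum_congr rfl fun q _ => ?_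
  rw [map_smul, map_hSum hW hW _ ((bracket_two_isNull hw M _ _).smul _)]
  congr 2
  funext l
  rw [map_smul, mulLeft_opProd_append hW h𝓛]

/-- By the trace identity, a coefficient with some m_i < 0 is a combination of coefficients of
𝓛_{[n+2]} w with the same negative exponent at x_i, and these vanish. -/
theorem qdetAction_mem (ha : 0 < a) (hb : 0 < b) (M : ℤ) :
    qdetAction a b 𝓛 w M ∈ invariants a b 𝓛 := by
  rintro n - m ⟨i, hi⟩
  rw [← qTrace_bracket hW h𝓛 hw ha hb]
  ext K K'
  rw [qTrace_apply]
  refine Finset.sum_eq_zero fun q _ => ?_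
  have h0 : ∀ l : ℤ, bracket a b 𝓛 (n + 2) w (Fin.append m ![M - l, l]) = 0 := fun l =>
    hw (n + 2) (by omega) _ ⟨Fin.castAdd 2 i, by rwa [Fin.append_left]⟩
  simp only [h0, Matrix.zero_apply, smul_zero]
  rw [hSum_zero hW, smul_zero]

end Bracket

/-! ### The quantum determinant at u = 0 in V(R). -/

section Algebra

theorem freeLh_smul_def (r : ℂ⟦X⟧) (x : FreeLh) :
    r • x = PowerSeries.map (algebraMap ℂ FreeL) r * x := rfl

theorem mk_eq_sum_add (t : ℕ → FreeL) (N : ℕ) : (PowerSeries.mk t : FreeLh) =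
    ∑ k ∈ Finset.range N, (PowerSeries.X ^ k : ℂ⟦X⟧) • (PowerSeries.C (t k) : FreeLh) +
      (PowerSeries.X ^ N : ℂ⟦X⟧) • (PowerSeries.mk fun k => t (k + N) : FreeLh) := by
  induction N with
  | zero => simp
  | succ N ih =>
    rw [ih, Finset.sum_range_succ, add_assoc]
    congr 1
    have h := PowerSeries.eq_X_mul_shift_add_const (PowerSeries.mk fun k => t (k + N) : FreeLh)
    rw [h, smul_add, add_comm, pow_succ, mul_smul]
    congr 2
    · simp
    · rw [freeLh_smul_def PowerSeries.X, PowerSeries.map_X]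
      congr 2
      funext k
      rw [PowerSeries.coeff_mk]
      congr 1
      ring

theorem C_smul_eq (r : ℂ) (x : FreeL) :
    (PowerSeries.C (r • x) : FreeLh) = (PowerSeries.C r : ℂ⟦X⟧) • (PowerSeries.C x : FreeLh) := by
  rw [freeLh_smul_def, PowerSeries.map_C, ← map_mul, Algebra.smul_def]

variable (a : ℝ) (b : ℕ) (c : ℂ)

theorem toVR_add (x y : FreeLh) : toVR a b c (x + y) = toVR a b c x + toVR a b c y := rfl

theorem toVR_smul (r : ℂ⟦X⟧) (x : FreeLh) : toVR a b c (r • x) = r • toVR a b c x := rfl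

/-- The linear map underlying the projection onto `V(R)`. -/
def toVRLinear : FreeLh →ₗ[ℂ⟦X⟧] VR a b c where
  toFun := toVR a b c
  map_add' := toVR_add a b c
  map_smul' := toVR_smul a b c

/-- The shifted generator matrix is an infinite h-series in the generators, whereas Y is prescribed
on finite products of them. Splitting off an explicit tail in h^N V(R) reduces to finite sums. -/
theorem mul_toVR_mk (v : VR a b c) (d : ℕ → ℂ) (i j : Fin 2) (N : ℕ) : ∃ u : VR a b c,
    v * toVR a b c (PowerSeries.mk fun k => d k • lgen i j k) =
      ∑ k ∈ Finset.range N, (PowerSeries.X ^ k * PowerSeries.C (d k) : ℂ⟦X⟧) •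
        (v * vgen a b c i j k) + (PowerSeries.X ^ N : ℂ⟦X⟧) • u := by
  refine ⟨v * toVR a b c (PowerSeries.mk fun k => d (k + N) • lgen i j (k + N)), ?_⟩
  rw [mk_eq_sum_add _ N]
  have h := map_add (toVRLinear a b c)
    (∑ k ∈ Finset.range N, (PowerSeries.X ^ k : ℂ⟦X⟧) • (PowerSeries.C (d k • lgen i j k) : FreeLh))
    ((PowerSeries.X ^ N : ℂ⟦X⟧) • (PowerSeries.mk fun k => d (k + N) • lgen i j (k + N) : FreeLh))
  rw [map_sum, map_smul] at h
  change v * toVRLinear a b c _ = _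
  rw [h, mul_add, Finset.mul_sum, mul_smul_comm]
  congr 1
  refine Finset.sum_congr rfl fun k _ => ?_
  rw [C_smul_eq, smul_smul, map_smul, mul_smul_comm]
  rfl

theorem constantCoeff_qdet : PowerSeries.constantCoeff (qdet a b c) =
    ∑ q : (Fin 2 → Fin 2) × (Fin 2 → Fin 2), antisym q.1 q.2 • (vgen a b c (q.2 0) (q.1 0) 0 *
      toVR a b c (PowerSeries.mk fun k => ((-1 / 2 : ℂ) ^ k) • lgen (q.2 1) (q.1 1) k)) := by
  rw [qdet, map_sum, Fintype.sum_prod_type]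
  refine Finset.sum_congr rfl fun I _ => ?_
  rw [map_sum]
  refine Finset.sum_congr rfl fun J _ => ?_
  rw [map_mul, PowerSeries.constantCoeff_C, map_mul, Algebra.smul_def]
  congr 2
  rw [← PowerSeries.coeff_zero_eq_constantCoeff_apply, LplusShift, Matrix.of_apply,
    PowerSeries.coeff_mk]
  simp

theorem X_pow_dvd_hExp_sub (α : ℂ) (N : ℕ) : PowerSeries.X ^ N ∣ hExp α -
    ∑ k ∈ Finset.range N, PowerSeries.X ^ k * PowerSeries.C (α ^ k / k.factorial) := by
  rw [PowerSeries.X_pow_dvd_iff]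
  intro n hn
  rw [map_sub, map_sum, Finset.sum_eq_single n]
  · rw [PowerSeries.coeff_X_pow_mul', if_pos le_rfl, Nat.sub_self]
    simp [hExp, PowerSeries.coeff_exp, div_eq_mul_inv]
  · intro k _ hk
    rw [PowerSeries.coeff_X_pow_mul']
    split_ifs with h
    · rw [PowerSeries.coeff_C, if_neg (by omega)]
    · rfl
  · intro h
    exact absurd (Finset.mem_range.2 hn) h

end Algebra

/-! ### Comparison with the module map Y_W. -/

section ModuleMap

variable {W : Type*} [AddCommGroup W] [Module ℂ⟦X⟧ W] (hW : TopologicallyFree W)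
  {a : ℝ} {b : ℕ} {c : ℂ} {𝓛 : OpSeries W} {w : W}
  {Y : VR a b c →ₗ[ℂ⟦X⟧] W →ₗ[ℂ⟦X⟧] (ℤ → W)} (hY : IsModuleMap a b c 𝓛 Y)
include hY

/-- The coefficient of u_1^0 u_2^k in 𝓛_{[2]} at x_i = z^{1/2} e^{u_i}: an exponent l of x_2
contributes e^{l u_2}, hence l^k / k!. -/
theorem moduleMap_generators (I J : Fin 2 → Fin 2) (k : ℕ) (w : W) (M : ℤ) :
    Y (vgen a b c (J 0) (I 0) 0 * vgen a b c (J 1) (I 1) k) w M = hSum fun l : ℤ =>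
      (PowerSeries.C ((l : ℂ) ^ k / k.factorial) : ℂ⟦X⟧) • bracket a b 𝓛 2 w ![M - l, l] J I := by
  have h := hY.bracket 2 one_le_two J I ![0, k] w M
  have e : (List.ofFn fun x : Fin 2 => vgen a b c (J x) (I x) (![0, k] x)).prod =
      vgen a b c (J 0) (I 0) 0 * vgen a b c (J 1) (I 1) k := by
    rw [List.ofFn_succ, List.ofFn_succ, List.ofFn_zero, List.prod_cons, List.prod_cons,
      List.prod_nil, mul_one]
    rfl
  rw [e] at h
  rw [h, ← hSum_equiv ((pairEquiv M).trans
    (Equiv.subtypeEquivRight fun e => by rw [Fin.sum_univ_two]))]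
  refine congrArg hSum (funext fun l => ?_)
  rw [Fin.prod_univ_two]
  show (PowerSeries.C (((M - l : ℤ) : ℂ) ^ 0 / (0).factorial * ((l : ℂ) ^ k / k.factorial)) : ℂ⟦X⟧) •
    bracket a b 𝓛 2 w ![M - l, l] J I = _
  rw [pow_zero, Nat.factorial_zero, Nat.cast_one, div_one, one_mul]

include hW

/-- Modulo h^N, the series L^+(-h/2) contributes (-h/2)^k times the generators of index k < N, and
the module map multiplies these by l^k / k!. The result is the truncation of e^{-lh/2}, the weight
in the quantum determinant action. -/
theorem moduleMap_qdet (hw : w ∈ invariants a b 𝓛) (M : ℤ) :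
    Y (PowerSeries.constantCoeff (qdet a b c)) w M = qdetAction a b 𝓛 w M := by
  rw [constantCoeff_qdet, map_sum, LinearMap.sum_apply, Finset.sum_apply, qdetAction_eq]
  refine Finset.sum_congr rfl fun q _ => ?_
  rw [map_smul, LinearMap.smul_apply, Pi.smul_apply]
  congr 1
  have hn := bracket_two_isNull hw M q.2 q.1
  refine hW.eq_of_forall fun N => ?_
  obtain ⟨u, hu⟩ := mul_toVR_mk a b c (vgen a b c (q.2 0) (q.1 0) 0) (fun k => (-1 / 2 : ℂ) ^ k)
    (q.2 1) (q.1 1) N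
  rw [hu, map_add, map_sum, map_smul, LinearMap.add_apply, Pi.add_apply, LinearMap.smul_apply,
    Pi.smul_apply, LinearMap.sum_apply, Finset.sum_apply, add_sub_right_comm]
  -- The tail is h^N times an element of V(R), and Y is ℂ[[h]]-linear, so it contributes an element
  -- of h^N W.
  refine Submodule.add_mem _ ?_ (smul_mem_hPow (dvd_refl _) _)
  have e1 : ∀ k ∈ Finset.range N, Y ((PowerSeries.X ^ k * PowerSeries.C ((-1 / 2 : ℂ) ^ k) : ℂ⟦X⟧) •
      (vgen a b c (q.2 0) (q.1 0) 0 * vgen a b c (q.2 1) (q.1 1) k)) w M = hSum fun l : ℤ =>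
        (PowerSeries.X ^ k * PowerSeries.C ((-(l : ℂ) / 2) ^ k / k.factorial) : ℂ⟦X⟧) •
          bracket a b 𝓛 2 w ![M - l, l] q.2 q.1 := by
    intro k _
    rw [map_smul, LinearMap.smul_apply, Pi.smul_apply, moduleMap_generators hY, smul_hSum hW _ (hn.smul _)]
    refine congrArg hSum (funext fun l => ?_)
    rw [smul_smul, mul_assoc, ← map_mul]
    congr 3
    rw [show -(l : ℂ) / 2 = (-1 / 2) * l by ring, mul_pow]
    ring
  rw [Finset.sum_congr rfl e1, ← hSum_sum hW fun k _ => hn.smul _]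
  have h1 : IsNull fun l : ℤ => ∑ k ∈ Finset.range N, (PowerSeries.X ^ k *
      PowerSeries.C ((-(l : ℂ) / 2) ^ k / k.factorial) : ℂ⟦X⟧) •
        bracket a b 𝓛 2 w ![M - l, l] q.2 q.1 := IsNull.sum fun k _ => hn.smul _
  have h2 : IsNull fun l : ℤ => hExp (-(l : ℂ) / 2) • bracket a b 𝓛 2 w ![M - l, l] q.2 q.1 :=
    hn.smul _
  have hF : ∀ l ∉ (hn N).toFinset, bracket a b 𝓛 2 w ![M - l, l] q.2 q.1 ∈ hPow W N := by
    intro l hl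
    by_contra hc
    exact hl ((hn N).mem_toFinset.2 hc)
  have d1 := hSum_sub_sum_mem hW h1 N (F := (hn N).toFinset) fun l hl =>
    Submodule.sum_mem _ fun k _ => Submodule.smul_mem _ _ (hF l hl)
  have d2 := hSum_sub_sum_mem hW h2 N (F := (hn N).toFinset) fun l hl =>
    Submodule.smul_mem _ _ (hF l hl)
  have d3 : ∑ l ∈ (hn N).toFinset, hExp (-(l : ℂ) / 2) • bracket a b 𝓛 2 w ![M - l, l] q.2 q.1 -
      ∑ l ∈ (hn N).toFinset, ∑ k ∈ Finset.range N, (PowerSeries.X ^ k *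
        PowerSeries.C ((-(l : ℂ) / 2) ^ k / k.factorial) : ℂ⟦X⟧) •
          bracket a b 𝓛 2 w ![M - l, l] q.2 q.1 ∈ hPow W N := by
    rw [← Finset.sum_sub_distrib]
    refine Submodule.sum_mem _ fun l _ => ?_
    rw [← Finset.sum_smul, ← sub_smul]
    exact smul_mem_hPow (X_pow_dvd_hExp_sub _ _) _
  have := Submodule.sub_mem _ (Submodule.sub_mem _ d1 d2) d3
  convert this using 1
  abel

end ModuleMap

end EllipticFRT

end

theorem mainTheorem5 (a : ℝ) (ha : 0 < a) (b : ℕ) (hb : 0 < b) (c : ℂ)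
    {W : Type*} [AddCommGroup W] [Module (PowerSeries ℂ) W]
    (hW : EllipticFRT.TopologicallyFree W)
    (𝓛 : EllipticFRT.OpSeries W) (h𝓛 : EllipticFRT.IsFRTOperator a b c 𝓛)
    (w : W) (hw : w ∈ EllipticFRT.invariants a b 𝓛) :
    (∀ m : ℤ, EllipticFRT.qdetAction a b 𝓛 w m ∈ EllipticFRT.invariants a b 𝓛) ∧
    ∀ Y : EllipticFRT.VR a b c →ₗ[PowerSeries ℂ] W →ₗ[PowerSeries ℂ] (ℤ → W),
      EllipticFRT.IsModuleMap a b c 𝓛 Y →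
      ∀ m : ℤ,
        Y (PowerSeries.constantCoeff (EllipticFRT.qdet a b c)) w m =
            EllipticFRT.qdetAction a b 𝓛 w m ∧
          Y (PowerSeries.constantCoeff (EllipticFRT.qdet a b c)) w m ∈
            EllipticFRT.invariants a b 𝓛 := by
  have h := fun m => EllipticFRT.qdetAction_mem hW h𝓛 hw ha hb m
  refine ⟨h, fun Y hY m => ?_⟩
  have e := EllipticFRT.moduleMap_qdet hW hY hw m
  exact ⟨e, e ▸ h m⟩
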